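/- Let $\mathbb{K}$ be a field of characteristic zero, let $X$ be a topological space and let $\mathcal{O}_X$ be a sheaf of commutative $\mathbb{K}$-algebras on $X$ (for instance the structure sheaf of a smooth or complex manifold, of an analytic space or of an algebraic variety). **Lie algebroids.** A Lie algebroid over $(X,\mathcal{O}_X)$ is a sheaf $\mathcal{L}$ of $\mathcal{O}_X$-modules and of $\mathbb{K}$-Lie algebras with an anchor: sections $D$ of $\mathcal{L}$ act on sections $f$ of $\mathcal{O}_X$ by $\mathbb{K}$-derivations $f\mapsto D(f)$, compatibly with restriction, such that $D\mapsto D(\cdot)$ is $\mathcal{O}_X$-linear and a homomorphism of Lie algebras and $[D,fD']=f[D,D']+D(f)D'$. Morphisms are morphisms of sheaves of $\mathcal{O}_X$-modules which preserve bracket and anchor. It is locally free if it is locally free as a sheaf of $\mathcal{O}_X$-modules (of possibly infinite rank). **Bialgebras.** An $\mathcal{O}_X/\mathbb{K}_X$-bialgebra is a sheaf $\mathcal{A}$ of unital associative $\mathbb{K}$-algebras containing $\mathcal{O}_X$ as a (not necessarily central) sheaf of subalgebras, with morphisms of sheaves of left $\mathcal{O}_X$-modules $\Delta:\mathcal{A}\to\mathcal{A}\otimes_{\mathcal{O}_X}\mathcal{A}$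 (tensor product of left modules) and $\epsilon:\mathcal{A}\to\mathcal{O}_X$ such that * $\Delta$ is coassociative and cocommutative with counit $\epsilon$; * $\Delta(\mathcal{A})$ lies in the subsheaf of the sections $t=\sum a_i\otimes b_i$ with $\sum a_if\otimes b_i=\sum a_i\otimes b_if$ for all sections $f$ of $\mathcal{O}_X$, on which factorwise multiplication is well defined; * $\Delta(1)=1\otimes1$, $\epsilon(1)=1$, $\Delta(ab)=\Delta(a)\Delta(b)$ and $\epsilon(ab)=\epsilon(a\,\epsilon(b))$. Morphisms are morphisms of sheaves of unital algebras which are $\mathcal{O}_X$-linear and compatible with $\Delta$ and $\epsilon$. Let $\bar{\mathcal{A}}=\operatorname{Ker}\epsilon$, so that $\mathcal{A}=\mathcal{O}_X\oplus\bar{\mathcal{A}}$, let $\bar\Delta:\bar{\mathcal{A}}\to\bar{\mathcal{A}}\otimes\bar{\mathcal{A}}$, $\bar\Delta(s)=\Delta(s)-s\otimes1-1\otimes s$, let $\bar\Delta^{(0)}=\mathrm{Id}$, $\bar\Delta^{(1)}=\bar\Delta$, $\bar\Delta^{(n)}=(\bar\Delta\otimes\mathrm{Id})\circ\bar\Delta^{(n-1)}$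 ($\bar\Delta$ applied to the first factor), and let $\bar{\mathcal{A}}_n=\operatorname{Ker}\bar\Delta^{(n)}$, $\mathcal{A}_n=\mathcal{O}_X\oplus\bar{\mathcal{A}}_n$. The bialgebra $\mathcal{A}$ is *cocomplete* if $\mathcal{A}=\bigcup_n\mathcal{A}_n$ (every section of $\mathcal{A}$ is locally a section of some $\mathcal{A}_n$), and *locally graded free* if all quotient sheaves $\bar{\mathcal{A}}_{n+1}/\bar{\mathcal{A}}_n$, $n\ge0$, are locally free $\mathcal{O}_X$-modules. **The functors.** $\mathscr{P}(\mathcal{A})=\bar{\mathcal{A}}_1$ is the sheaf of primitive elements, a Lie algebroid with the commutator bracket and the anchor $D(f)=\epsilon(Df)$; morphisms are restricted. $\mathscr{U}(\mathcal{L})$ is the sheafification of $U\mapsto\mathcal{U}(\mathcal{O}_X(U),\mathcal{L}(U))$, where $\mathcal{U}(R,L)$ is the universal enveloping algebra of a Lie–Rinehart algebra, that is, the unital $\mathbb{K}$-algebra generated by the algebra $R$ and by elements $\iota(D)$, $D\in L$, additive in $D$, with $\iota([D,E])=\iota(D)\iota(E)-\iota(E)\iota(D)$, $\iota(fD)=f\iota(D)$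 and $\iota(D)f=f\iota(D)+D(f)$. It is a bialgebra with $\Delta(\iota(D))=\iota(D)\otimes1+1\otimes\iota(D)$ and $\epsilon(\iota(D))=0$ for sections $D$ of $\mathcal{L}$; a morphism $\phi$ of Lie algebroids induces the morphism of bialgebras with $\iota(D)\mapsto\iota(\phi(D))$. **Theorem.** 1. The functor $\mathscr{U}$ from Lie algebroids over $(X,\mathcal{O}_X)$ to $\mathcal{O}_X/\mathbb{K}_X$-bialgebras is left adjoint to $\mathscr{P}$; there is an adjunction with unit $\mathcal{L}\to\mathscr{P}(\mathscr{U}(\mathcal{L}))$, $D\mapsto\iota(D)$. 2. The functors $\mathscr{U}$ and $\mathscr{P}$ restrict to mutually inverse equivalences between the full subcategory of locally free Lie algebroids over $(X,\mathcal{O}_X)$ and the full subcategory of cocomplete, locally graded free $\mathcal{O}_X/\mathbb{K}_X$-bialgebras: $\mathscr{U}$ and $\mathscr{P}$ map these subcategories to each other, and on them the unit and the counit of the adjunction in (1) are isomorphisms. -/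

import Mathlib

open CategoryTheory TopologicalSpace Opposite
open scoped TensorProduct

universe u

set_option linter.unusedSectionVars false
set_option linter.unusedVariables false

noncomputable section

namespace LieAlgd

/-! ### Sections and stalks of presheaves of algebras -/

section Stalks

variable {K : Type u} [Field K] {X : TopCat.{u}}

/-- Open neighbourhoods of `x`, ordered by reverse inclusion. -/
abbrev Nbhd (x : X) : Type u := {U : Opens X // x ∈ U}ᵒᵈ

instance (x : X) : IsDirectedOrder (Nbhd x) where
  directed U V := ⟨OrderDual.toDual ⟨U.1 ⊓ V.1, U.2, V.2⟩, fun _ h => h.1, fun _ h => h.2⟩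

instance (x : X) : Nonempty (Nbhd x) := ⟨OrderDual.toDual ⟨⊤, trivial⟩⟩

/-- The neighbourhood of `x` given by an open set containing `x`. -/
abbrev nbhd {x : X} (U : Opens X) (hx : x ∈ U) : Nbhd x := OrderDual.toDual ⟨U, hx⟩

variable (F G : X.Presheaf (AlgCat.{u} K))

/-- Sections over `U`. -/
abbrev Sec (U : Opens X) : Type u := F.obj (op U)

/-- Restriction of sections. -/
def res {U V : Opens X} (h : V ≤ U) : Sec F U →ₐ[K] Sec F V := (F.map (homOfLE h).op).hom

lemma res_self {U : Opens X} (h : U ≤ U) (a : Sec F U) : res F h a = a := by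
  simp [res]

lemma res_res {U V W : Opens X} (h : V ≤ U) (h' : W ≤ V) (a : Sec F U) :
    res F h' (res F h a) = res F (h'.trans h) a := by
  have : (homOfLE (h'.trans h)).op = (homOfLE h).op ≫ (homOfLE h').op := rfl
  simp [res, this]

instance (x : X) : DirectedSystem (fun V : Nbhd x => Sec F V.1)
    (fun V W h => res F (U := V.1) (V := W.1) h) where
  map_self _ a := res_self F _ a
  map_map _ _ _ _ _ a := res_res F _ _ a

/-- The stalk at `x`: the direct limit of the sections over the neighbourhoods of `x`. -/
def Stalk (x : X) : Type u :=
  DirectLimit (fun V : Nbhd x => Sec F V.1) (fun V W h => res F (U := V.1) (V := W.1) h)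

instance (x : X) : Ring (Stalk F x) := inferInstanceAs (Ring (DirectLimit _ _))

instance (x : X) : Algebra K (Stalk F x) := inferInstanceAs (Algebra K (DirectLimit _ _))

/-- The germ at `x` of a section over `U ∋ x`. -/
def germ {U : Opens X} (x : X) (hx : x ∈ U) : Sec F U →ₐ[K] Stalk F x where
  __ := DirectLimit.Ring.of (fun V : Nbhd x => Sec F V.1)
    (fun V W h => res F (U := V.1) (V := W.1) h) (nbhd U hx)
  commutes' k := by
    rw [Algebra.algebraMap_eq_smul_one, Algebra.algebraMap_eq_smul_one]
    exact ((congrArg (k • ·) (DirectLimit.one_def (nbhd U hx))).trans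
      (DirectLimit.smul_def (nbhd U hx) _ k)).symm

lemma germ_res {U V : Opens X} (h : V ≤ U) (x : X) (hx : x ∈ V) (a : Sec F U) :
    germ F x hx (res F h a) = germ F x (h hx) a :=
  Quotient.sound ⟨nbhd V hx, le_rfl, h, res_self F _ _⟩

lemma exists_germ {x : X} (s : Stalk F x) :
    ∃ (U : Opens X) (hx : x ∈ U) (a : Sec F U), germ F x hx a = s := by
  induction s using Quotient.inductionOn with
  | _ s => exact ⟨s.1.1, s.1.2, s.2, rfl⟩

lemma germ_eq {U V : Opens X} {x : X} {hU : x ∈ U} {hV : x ∈ V} {a : Sec F U} {b : Sec F V}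
    (h : germ F x hU a = germ F x hV b) :
    ∃ (W : Opens X) (_ : x ∈ W) (h₁ : W ≤ U) (h₂ : W ≤ V), res F h₁ a = res F h₂ b := by
  obtain ⟨W, h₁, h₂, e⟩ := Quotient.exact h
  exact ⟨W.1, W.2, h₁, h₂, e⟩

variable {F} in
/-- Ring homomorphisms out of a stalk. -/
def stalkLift {x : X} {P : Type u} [Ring P] (g : ∀ (U : Opens X) (_ : x ∈ U), Sec F U →+* P)
    (hg : ∀ (U V : Opens X) (h : V ≤ U) (hx : x ∈ V) (a : Sec F U),
      g V hx (res F h a) = g U (h hx) a) : Stalk F x →+* P :=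
  DirectLimit.Ring.lift (fun V : Nbhd x => Sec F V.1)
    (fun V W h => res F (U := V.1) (V := W.1) h) P (fun V => g V.1 V.2)
    (fun V W h a => hg V.1 W.1 h W.2 a)

variable {F} in
lemma stalkLift_germ {x : X} {P : Type u} [Ring P]
    (g : ∀ (U : Opens X) (_ : x ∈ U), Sec F U →+* P)
    (hg : ∀ (U V : Opens X) (h : V ≤ U) (hx : x ∈ V) (a : Sec F U),
      g V hx (res F h a) = g U (h hx) a) {U : Opens X} (hx : x ∈ U) (a : Sec F U) :
    stalkLift g hg (germ F x hx a) = g U hx a := rfl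

variable {F G}

/-- The action of a morphism of presheaves on sections. -/
abbrev onSec (ψ : F ⟶ G) (U : Opens X) : Sec F U →ₐ[K] Sec G U := (ψ.app (op U)).hom

lemma onSec_res (ψ : F ⟶ G) {U V : Opens X} (h : V ≤ U) (a : Sec F U) :
    onSec ψ V (res F h a) = res G h (onSec ψ U a) :=
  congrArg (fun f => AlgCat.Hom.hom f a) (ψ.naturality (homOfLE h).op)

/-- The map induced on stalks by a morphism of presheaves. -/
def onStalk (ψ : F ⟶ G) (x : X) : Stalk F x →ₐ[K] Stalk G x :=
  { stalkLift (P := Stalk G x) (fun U hx => ((germ G x hx).comp (onSec ψ U)).toRingHom)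
      (fun U V h hx a => by
        change germ G x hx (onSec ψ V (res F h a)) = germ G x _ (onSec ψ U a)
        rw [onSec_res, germ_res]) with
    commutes' := fun k => by
      rw [← AlgHom.commutes (germ F x (U := ⊤) trivial) k]
      change germ G x _ (onSec ψ ⊤ (algebraMap K _ k)) = _
      simp }

lemma onStalk_germ (ψ : F ⟶ G) {U : Opens X} (x : X) (hx : x ∈ U) (a : Sec F U) :
    onStalk ψ x (germ F x hx a) = germ G x hx (onSec ψ U a) := rfl

/-- A family of elements of stalks is *locally a section* if near each point it is given by the
germs of a section. -/
def IsLocallySection (F : X.Presheaf (AlgCat.{u} K)) {U : Opens X}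
    (s : ∀ y : U, Stalk F y.1) : Prop :=
  ∀ x : U, ∃ (V : Opens X) (_ : x.1 ∈ V) (hV : V ≤ U) (a : Sec F V),
    ∀ (y : X) (hy : y ∈ V), s ⟨y, hV hy⟩ = germ F y hy a

lemma sec_ext (hF : F.IsSheaf) {U : Opens X} {a b : Sec F U}
    (h : ∀ (x : X) (hx : x ∈ U), germ F x hx a = germ F x hx b) : a = b := by
  choose W hx h₁ h₂ e using fun x : U => germ_eq F (h x.1 x.2)
  refine TopCat.Sheaf.eq_of_locally_eq' ⟨F, hF⟩ W U (fun x => homOfLE (h₁ x)) ?_ a b e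
  intro x hxU
  exact Opens.mem_iSup.2 ⟨⟨x, hxU⟩, hx ⟨x, hxU⟩⟩

lemma exists_sec (hF : F.IsSheaf) {U : Opens X} {s : ∀ y : U, Stalk F y.1}
    (hs : IsLocallySection F s) :
    ∃ a : Sec F U, ∀ (y : X) (hy : y ∈ U), germ F y hy a = s ⟨y, hy⟩ := by
  choose V hx hV a e using hs
  have hcov : U ≤ iSup V := fun x hxU => Opens.mem_iSup.2 ⟨⟨x, hxU⟩, hx ⟨x, hxU⟩⟩
  obtain ⟨g, hg, -⟩ := TopCat.Sheaf.existsUnique_gluing' ⟨F, hF⟩ V U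
    (fun x => homOfLE (hV x)) hcov a (by
      intro x y
      change res F inf_le_left (a x) = res F inf_le_right (a y)
      refine sec_ext hF fun z hz => ?_
      rw [germ_res, germ_res, ← e x z hz.1, ← e y z hz.2])
  refine ⟨g, fun y hy => ?_⟩
  have h1 : res F (hV ⟨y, hy⟩) g = a ⟨y, hy⟩ := hg ⟨y, hy⟩
  rw [e ⟨y, hy⟩ y (hx ⟨y, hy⟩), ← h1, germ_res]

end Stalks

/-! ### Algebras extending the structure sheaf -/

section Structure

variable {K : Type u} [Field K] {X : TopCat.{u}}

instance : Limits.PreservesLimits (forget (CommAlgCat.{u} K)) :=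
  Limits.preservesLimits_of_natIso (F := (commAlgCatEquivUnder (CommRingCat.of K)).functor ⋙
    Under.forget _ ⋙ forget CommRingCat) (Iso.refl _)

variable (O : X.Sheaf (CommAlgCat.{u} K))

/-- A sheaf of commutative algebras as a presheaf of algebras. -/
def oPre : X.Presheaf (AlgCat.{u} K) := O.presheaf ⋙ forget₂ (CommAlgCat.{u} K) (AlgCat.{u} K)

lemma oPre_isSheaf : (oPre O).IsSheaf :=
  (TopCat.Presheaf.isSheaf_iff_isSheaf_comp (forget (AlgCat.{u} K)) _).2
    ((TopCat.Presheaf.isSheaf_iff_isSheaf_comp (forget (CommAlgCat.{u} K)) _).1 O.property)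

/-- Sections of the structure sheaf. -/
abbrev OSec (U : Opens X) : Type u := Sec (oPre O) U

instance (U : Opens X) : CommRing (OSec O U) where
  mul_comm a b := mul_comm (G := O.presheaf.obj (op U)) a b

/-- Stalks of the structure sheaf. -/
abbrev OStalk (x : X) : Type u := Stalk (oPre O) x

instance (x : X) : CommRing (OStalk O x) where
  mul_comm a b := by
    obtain ⟨U, hU, a, rfl⟩ := exists_germ _ a
    obtain ⟨V, hV, b, rfl⟩ := exists_germ _ b
    rw [← germ_res _ (inf_le_left : U ⊓ V ≤ U) x ⟨hU, hV⟩,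
      ← germ_res _ (inf_le_right : U ⊓ V ≤ V) x ⟨hU, hV⟩, ← map_mul, ← map_mul]
    exact congrArg _ (mul_comm (_ : OSec O (U ⊓ V)) _)

/-- A sheaf of unital associative `K`-algebras together with a homomorphism from the structure
sheaf. -/
structure ExtAlg where
  presheaf : X.Presheaf (AlgCat.{u} K)
  isSheaf : presheaf.IsSheaf
  unit : oPre O ⟶ presheaf

variable {O}

namespace ExtAlg

variable (A : ExtAlg O)

/-- Sections over `U`. -/
abbrev Sec (U : Opens X) : Type u := LieAlgd.Sec A.presheaf U

/-- The stalk at `x`. -/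
abbrev Stalk (x : X) : Type u := LieAlgd.Stalk A.presheaf x

/-- Restriction of sections. -/
abbrev res {U V : Opens X} (h : V ≤ U) : A.Sec U →ₐ[K] A.Sec V := LieAlgd.res A.presheaf h

/-- Germs of sections. -/
abbrev germ {U : Opens X} (x : X) (hx : x ∈ U) : A.Sec U →ₐ[K] A.Stalk x :=
  LieAlgd.germ A.presheaf x hx

/-- The structure map `O(U) → A(U)`. -/
abbrev η (U : Opens X) : OSec O U →ₐ[K] A.Sec U := onSec A.unit U

/-- The structure map on stalks. -/
abbrev ηx (x : X) : OStalk O x →ₐ[K] A.Stalk x := onStalk A.unit x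

/-- Sections of `A` form a left module over sections of `O`. -/
instance (U : Opens X) : Module (OSec O U) (A.Sec U) := Module.compHom _ (A.η U).toRingHom

instance (x : X) : Module (OStalk O x) (A.Stalk x) := Module.compHom _ (A.ηx x).toRingHom

lemma smul_def {U : Opens X} (f : OSec O U) (a : A.Sec U) : f • a = A.η U f * a := rfl

lemma stalk_smul_def {x : X} (f : OStalk O x) (a : A.Stalk x) : f • a = A.ηx x f * a := rfl

instance (U : Opens X) : IsScalarTower (OSec O U) (A.Sec U) (A.Sec U) :=
  ⟨fun f a b => mul_assoc (A.η U f) a b⟩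

instance (x : X) : IsScalarTower (OStalk O x) (A.Stalk x) (A.Stalk x) :=
  ⟨fun f a b => mul_assoc (A.ηx x f) a b⟩

lemma germ_smul {U : Opens X} {x : X} (hx : x ∈ U) (f : OSec O U) (a : A.Sec U) :
    A.germ x hx (f • a) = LieAlgd.germ (oPre O) x hx f • A.germ x hx a := by
  rw [smul_def, map_mul, stalk_smul_def, onStalk_germ]

end ExtAlg

end Structure

/-! ### Bialgebras over a commutative ring which need not be central -/

section RBialgebra

variable (R A : Type u) [CommRing R] [Ring A] [Module R A] [IsScalarTower R A A]

variable {A} in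
/-- `a ⊗ b ↦ a * c ⊗ b * d` on the tensor product of left modules. -/
def rmul (c d : A) : A ⊗[R] A →ₗ[R] A ⊗[R] A :=
  TensorProduct.map (LinearMap.mulRight R c) (LinearMap.mulRight R d)

/-- Let `A` be a ring which is a left `R`-module with `(r • a) * b = r • (a * b)`, that is, a ring
with a ring homomorphism `R → A`, `r ↦ r • 1`, whose image need not be central. A cocommutative
coalgebra structure on the left `R`-module `A` makes `A` a *bialgebra* if `Δ(A)` is contained in
the submodule `{t | t (r ⊗ 1) = t (1 ⊗ r) for all r}` of `A ⊗ A`, on which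
`t (∑ cᵢ ⊗ dᵢ) = ∑ t (cᵢ ⊗ dᵢ)` is a well defined multiplication, and if the stated compatibility
conditions of `Δ` and `ε` with unit and multiplication hold. -/
class IsRBialgebra [Coalgebra R A] : Prop extends Coalgebra.IsCocomm R A where
  comul_mem (a : A) (r : R) :
    rmul R (r • (1 : A)) 1 (Coalgebra.comul (R := R) a) =
      rmul R 1 (r • (1 : A)) (Coalgebra.comul (R := R) a)
  comul_one : Coalgebra.comul (R := R) (1 : A) = 1 ⊗ₜ[R] 1
  counit_one : Coalgebra.counit (R := R) (1 : A) = 1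
  comul_mul (a b : A) (n : ℕ) (c d : Fin n → A)
    (h : Coalgebra.comul (R := R) b = ∑ i, c i ⊗ₜ[R] d i) :
    Coalgebra.comul (R := R) (a * b) = ∑ i, rmul R (c i) (d i) (Coalgebra.comul (R := R) a)
  counit_mul (a b : A) :
    Coalgebra.counit (R := R) (a * b) =
      Coalgebra.counit (R := R) (a * (Coalgebra.counit (R := R) b • (1 : A)))

section Primitive

variable [Coalgebra R A]

/-- The augmentation ideal `Ā = Ker ε`. -/
abbrev augKer : Submodule R A := LinearMap.ker (Coalgebra.counit (R := R) (A := A))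

variable [IsRBialgebra R A]

/-- The projection `a ↦ a - ε(a) 1` onto the summand `Ā` of `A = R 1 ⊕ Ā`. -/
def augProj : A →ₗ[R] augKer R A :=
  (LinearMap.id - (Coalgebra.counit (R := R) (A := A)).smulRight (1 : A)).codRestrict _ fun a => by
    simp [IsRBialgebra.counit_one]

/-- The reduced coproduct `Ā → Ā ⊗ Ā`, that is, `s ↦ Δ(s) - s ⊗ 1 - 1 ⊗ s`. -/
def redComul : augKer R A →ₗ[R] augKer R A ⊗[R] augKer R A :=
  TensorProduct.map (augProj R A) (augProj R A) ∘ₗ Coalgebra.comul ∘ₗ (augKer R A).subtype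

/-- `Ā ⊗ ⋯ ⊗ Ā` with `n + 1` factors. -/
def augPow : ℕ → ModuleCat.{u} R
  | 0 => ModuleCat.of R (augKer R A)
  | n + 1 => ModuleCat.of R (augPow n ⊗[R] augKer R A)

/-- The iterated reduced coproduct `Δ̄⁽ⁿ⁾ : Ā → Ā ⊗ ⋯ ⊗ Ā` (with `n + 1` factors), the composition
of `n` coproducts `Δ̄ ⊗ id ⊗ ⋯ ⊗ id`; `Δ̄⁽⁰⁾` is the identity. -/
def iterComul : ∀ n : ℕ, augKer R A →ₗ[R] augPow R A n
  | 0 => LinearMap.id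
  | n + 1 => (iterComul n).rTensor (augKer R A) ∘ₗ redComul R A

/-- The `n`-th term `Āₙ` of the primitive filtration of `Ā`, as a submodule of `A`. -/
def primFil (n : ℕ) : Submodule R A := (LinearMap.ker (iterComul R A n)).map (augKer R A).subtype

/-- The subquotient `Āₙ₊₁ / Āₙ` of the primitive filtration. -/
abbrev primGr (n : ℕ) : Type u :=
  primFil R A (n + 1) ⧸ (primFil R A n).submoduleOf (primFil R A (n + 1))

end Primitive

end RBialgebra

section PrimitiveLemmas

variable {R A : Type u} [CommRing R] [Ring A] [Module R A] [IsScalarTower R A A]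
  [Coalgebra R A] [IsRBialgebra R A]

lemma coe_augProj (a : A) :
    (augProj R A a : A) = a - Coalgebra.counit (R := R) a • (1 : A) := rfl

lemma augProj_coe (s : augKer R A) : augProj R A s = s := by
  ext
  have h : Coalgebra.counit (R := R) (s : A) = 0 := s.2
  rw [coe_augProj, h, zero_smul, sub_zero]

lemma map_augProj_comul (a : A) :
    TensorProduct.map ((augKer R A).subtype ∘ₗ augProj R A) ((augKer R A).subtype ∘ₗ augProj R A)
      (Coalgebra.comul (R := R) a) =
    Coalgebra.comul (R := R) a - a ⊗ₜ[R] 1 - 1 ⊗ₜ[R] a +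
      Coalgebra.counit (R := R) a • ((1 : A) ⊗ₜ[R] (1 : A)) := by
  set e : A →ₗ[R] A := (Coalgebra.counit (R := R) (A := A)).smulRight (1 : A) with he
  have h : (augKer R A).subtype ∘ₗ augProj R A = LinearMap.id - e := by
    ext; simp [coe_augProj, he]
  have he' : e = (LinearMap.id : R →ₗ[R] R).smulRight (1 : A) ∘ₗ Coalgebra.counit := rfl
  have h1 : TensorProduct.map e (LinearMap.id : A →ₗ[R] A) (Coalgebra.comul (R := R) a) =
      1 ⊗ₜ[R] a := by
    have := congrArg (TensorProduct.map ((LinearMap.id : R →ₗ[R] R).smulRight (1 : A))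
      (LinearMap.id : A →ₗ[R] A)) (Coalgebra.rTensor_counit_comul (R := R) a)
    rw [LinearMap.rTensor, ← LinearMap.comp_apply, ← TensorProduct.map_comp, ← he'] at this
    simpa using this
  have h2 : TensorProduct.map (LinearMap.id : A →ₗ[R] A) e (Coalgebra.comul (R := R) a) =
      a ⊗ₜ[R] 1 := by
    have := congrArg (TensorProduct.map (LinearMap.id : A →ₗ[R] A)
      ((LinearMap.id : R →ₗ[R] R).smulRight (1 : A))) (Coalgebra.lTensor_counit_comul (R := R) a)
    rw [LinearMap.lTensor, ← LinearMap.comp_apply, ← TensorProduct.map_comp, ← he'] at this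
    simpa using this
  have h3 : TensorProduct.map e e (Coalgebra.comul (R := R) a) =
      Coalgebra.counit (R := R) a • ((1 : A) ⊗ₜ[R] (1 : A)) := by
    have : TensorProduct.map e e = TensorProduct.map e LinearMap.id ∘ₗ
        TensorProduct.map (LinearMap.id : A →ₗ[R] A) e := by
      rw [← TensorProduct.map_comp]; simp
    rw [this, LinearMap.comp_apply, h2]
    simp [he, TensorProduct.smul_tmul']
  have key : TensorProduct.map (LinearMap.id - e) (LinearMap.id - e) =
      LinearMap.id - TensorProduct.map LinearMap.id e - TensorProduct.map e LinearMap.id +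
        TensorProduct.map e e := by
    ext x y
    simp [TensorProduct.sub_tmul, TensorProduct.tmul_sub]
    abel
  rw [h, key]
  simp [h1, h2, h3]

lemma coe_redComul (s : augKer R A) :
    TensorProduct.map (augKer R A).subtype (augKer R A).subtype (redComul R A s) =
      Coalgebra.comul (R := R) (s : A) - (s : A) ⊗ₜ[R] 1 - 1 ⊗ₜ[R] (s : A) := by
  have h : Coalgebra.counit (R := R) (s : A) = 0 := s.2
  have := map_augProj_comul (R := R) (s : A)
  rw [h, zero_smul, add_zero] at this
  rw [← this, TensorProduct.map_comp]
  rfl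

/-- The first term of the primitive filtration consists of the primitive elements. -/
lemma mem_primFil_one (a : A) :
    a ∈ primFil R A 1 ↔ Coalgebra.comul (R := R) a = a ⊗ₜ[R] 1 + 1 ⊗ₜ[R] a := by
  have inj : ∀ t : augKer R A ⊗[R] augKer R A,
      TensorProduct.map (augKer R A).subtype (augKer R A).subtype t = 0 → t = 0 := by
    intro t ht
    have := congrArg (TensorProduct.map (augProj R A) (augProj R A)) ht
    rw [← LinearMap.comp_apply, ← TensorProduct.map_comp, map_zero] at this
    have h : augProj R A ∘ₗ (augKer R A).subtype = LinearMap.id :=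
      LinearMap.ext augProj_coe
    rwa [h, TensorProduct.map_id, LinearMap.id_apply] at this
  have h1 : ∀ s : augKer R A, iterComul R A 1 s = redComul R A s := by
    intro s
    change (LinearMap.rTensor (augKer R A) LinearMap.id) (redComul R A s) = redComul R A s
    rw [LinearMap.rTensor_id]; rfl
  constructor
  · rintro ⟨s, hs, rfl⟩
    have hs' : redComul R A s = 0 := (h1 s).symm.trans hs
    have := coe_redComul s
    rw [hs', map_zero] at this
    rw [← sub_eq_zero, ← sub_sub]
    exact this.symm
  · intro h
    have hε : Coalgebra.counit (R := R) a = 0 := by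
      have h0 := Coalgebra.rTensor_counit_comul (R := R) a
      rw [h] at h0
      have h1 := congrArg (TensorProduct.lid R A) h0
      simp [IsRBialgebra.counit_one] at h1
      have h2 := congrArg (Coalgebra.counit (R := R)) h1
      simpa [IsRBialgebra.counit_one] using h2
    refine ⟨⟨a, hε⟩, ?_, rfl⟩
    refine (h1 _).trans (inj _ ?_)
    rw [coe_redComul]
    simp [h]

end PrimitiveLemmas

/-! ### Sheaves of bialgebras -/

section Bialgebroids

variable {K : Type u} [Field K] {X : TopCat.{u}} {O : X.Sheaf (CommAlgCat.{u} K)}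

/-- The sections over `U` of the sheaf `A ⊗_O A`, the sheafification of
`V ↦ A(V) ⊗_{O(V)} A(V)`: families of elements of the stalks `A_y ⊗_{O_y} A_y` which near each
point are the germs of a finite sum `∑ bᵢ ⊗ cᵢ` with sections `bᵢ`, `cᵢ` of `A`. -/
def ExtAlg.IsTensorSection (A : ExtAlg O) {U : Opens X}
    (t : ∀ y : U, A.Stalk y.1 ⊗[OStalk O y.1] A.Stalk y.1) : Prop :=
  ∀ x : U, ∃ (V : Opens X) (_ : x.1 ∈ V) (hV : V ≤ U) (n : ℕ) (b c : Fin n → A.Sec V),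
    ∀ (y : X) (hy : y ∈ V),
      t ⟨y, hV hy⟩ = ∑ i, A.germ y hy (b i) ⊗ₜ[OStalk O y] A.germ y hy (c i)

variable (O) in
/-- A sheaf of bialgebras over `(X, O)`: a sheaf of `K`-algebras `A` extending `O` with morphisms
of sheaves of left `O`-modules `Δ : A → A ⊗_O A` and `ε : A → O` subject to the axioms of a
bialgebra. The morphisms `Δ` and `ε` are given by their action on stalks, which has to carry
sections to sections; the axioms are equations between morphisms of sheaves and are imposed on
stalks. The homomorphism `O → A` is injective because of `ε(f • 1) = f`. -/
structure Bialgebroid where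
  alg : ExtAlg O
  [coalgebra : ∀ x : X, Coalgebra (OStalk O x) (alg.Stalk x)]
  [bialgebra : ∀ x : X, IsRBialgebra (OStalk O x) (alg.Stalk x)]
  comul_section {U : Opens X} (a : alg.Sec U) :
    alg.IsTensorSection (U := U)
      fun y => Coalgebra.comul (R := OStalk O y.1) (alg.germ y.1 y.2 a)
  counit_section {U : Opens X} (a : alg.Sec U) :
    IsLocallySection (oPre O) (U := U)
      fun y => Coalgebra.counit (R := OStalk O y.1) (alg.germ y.1 y.2 a)

attribute [instance] Bialgebroid.coalgebra Bialgebroid.bialgebra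

/-- Morphisms of sheaves of algebras under `O`. -/
structure ExtAlg.Hom (A B : ExtAlg O) where
  hom : A.presheaf ⟶ B.presheaf
  unit_hom : A.unit ≫ hom = B.unit

namespace ExtAlg.Hom

variable {A B C : ExtAlg O}

lemma hom_η (ψ : ExtAlg.Hom A B) {U : Opens X} (f : OSec O U) :
    onSec ψ.hom U (A.η U f) = B.η U f :=
  congrArg (fun χ : oPre O ⟶ B.presheaf => onSec χ U f) ψ.unit_hom

/-- The induced linear map on stalks. -/
def stalk (ψ : ExtAlg.Hom A B) (x : X) : A.Stalk x →ₗ[OStalk O x] B.Stalk x where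
  toFun := onStalk ψ.hom x
  map_add' := map_add _
  map_smul' f a := by
    obtain ⟨U, hx, f, rfl⟩ := exists_germ _ f
    simp only [stalk_smul_def, map_mul, RingHom.id_apply, onStalk_germ, hom_η]

lemma stalk_germ (ψ : ExtAlg.Hom A B) {U : Opens X} {x : X} (hx : x ∈ U) (a : A.Sec U) :
    ψ.stalk x (A.germ x hx a) = B.germ x hx (onSec ψ.hom U a) := rfl

lemma stalk_mul (ψ : ExtAlg.Hom A B) {x : X} (a b : A.Stalk x) :
    ψ.stalk x (a * b) = ψ.stalk x a * ψ.stalk x b := map_mul (onStalk ψ.hom x) a b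

lemma stalk_one (ψ : ExtAlg.Hom A B) (x : X) : ψ.stalk x 1 = 1 := map_one (onStalk ψ.hom x)

/-- The identity morphism. -/
protected def id (A : ExtAlg O) : ExtAlg.Hom A A := ⟨𝟙 _, Category.comp_id _⟩

/-- Composition of morphisms. -/
protected def comp (φ : ExtAlg.Hom A B) (ψ : ExtAlg.Hom B C) : ExtAlg.Hom A C :=
  ⟨φ.hom ≫ ψ.hom, by rw [← Category.assoc, φ.unit_hom, ψ.unit_hom]⟩

lemma stalk_id (A : ExtAlg O) (x : X) : (ExtAlg.Hom.id A).stalk x = LinearMap.id := by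
  ext a
  obtain ⟨U, hx, a, rfl⟩ := exists_germ _ a
  rfl

lemma stalk_comp (φ : ExtAlg.Hom A B) (ψ : ExtAlg.Hom B C) (x : X) :
    (φ.comp ψ).stalk x = ψ.stalk x ∘ₗ φ.stalk x := by
  ext a
  obtain ⟨U, hx, a, rfl⟩ := exists_germ _ a
  rfl

end ExtAlg.Hom

namespace Bialgebroid

/-- Morphisms of sheaves of bialgebras: morphisms of sheaves of unital `K`-algebras which are
morphisms of coalgebras in the category of sheaves of left `O`-modules. -/
structure Hom (A B : Bialgebroid O) where
  map : ExtAlg.Hom A.alg B.alg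
  counit_comp (x : X) :
    Coalgebra.counit (R := OStalk O x) ∘ₗ map.stalk x = Coalgebra.counit (R := OStalk O x)
  comul_comp (x : X) :
    Coalgebra.comul (R := OStalk O x) ∘ₗ map.stalk x =
      TensorProduct.map (map.stalk x) (map.stalk x) ∘ₗ Coalgebra.comul (R := OStalk O x)

lemma Hom.ext' {A B : Bialgebroid O} {φ ψ : Hom A B} (h : φ.map.hom = ψ.map.hom) : φ = ψ := by
  rcases φ with ⟨⟨φ, _⟩, _, _⟩
  rcases ψ with ⟨⟨ψ, _⟩, _, _⟩
  cases h
  rfl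

/-- The identity morphism. -/
def Hom.id (A : Bialgebroid O) : Hom A A where
  map := .id _
  counit_comp x := by rw [ExtAlg.Hom.stalk_id]; rfl
  comul_comp x := by rw [ExtAlg.Hom.stalk_id, TensorProduct.map_id]; rfl

/-- Composition of morphisms. -/
def Hom.comp {A B C : Bialgebroid O} (φ : Hom A B) (ψ : Hom B C) : Hom A C where
  map := φ.map.comp ψ.map
  counit_comp x := by
    rw [ExtAlg.Hom.stalk_comp, ← LinearMap.comp_assoc, ψ.counit_comp, φ.counit_comp]
  comul_comp x := by
    rw [ExtAlg.Hom.stalk_comp, ← LinearMap.comp_assoc, ψ.comul_comp, LinearMap.comp_assoc,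
      φ.comul_comp, ← LinearMap.comp_assoc, ← TensorProduct.map_comp]

instance : Category (Bialgebroid O) where
  Hom := Hom
  id := Hom.id
  comp := Hom.comp
  id_comp φ := Hom.ext' (Category.id_comp φ.map.hom)
  comp_id φ := Hom.ext' (Category.comp_id φ.map.hom)
  assoc φ ψ χ := Hom.ext' (Category.assoc φ.map.hom ψ.map.hom χ.map.hom)

variable (A : Bialgebroid O)

lemma exists_ε {U : Opens X} (a : A.alg.Sec U) :
    ∃ f : OSec O U, ∀ (x : X) (hx : x ∈ U),
      germ (oPre O) x hx f = Coalgebra.counit (R := OStalk O x) (A.alg.germ x hx a) :=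
  exists_sec (oPre_isSheaf O) (A.counit_section a)

/-- The counit on sections. -/
def ε {U : Opens X} (a : A.alg.Sec U) : OSec O U := (A.exists_ε a).choose

lemma germ_ε {U : Opens X} (a : A.alg.Sec U) (x : X) (hx : x ∈ U) :
    germ (oPre O) x hx (A.ε a) = Coalgebra.counit (R := OStalk O x) (A.alg.germ x hx a) :=
  (A.exists_ε a).choose_spec x hx

end Bialgebroid

end Bialgebroids

/-! ### Lie algebroids -/

section LieAlgebroids

variable {K : Type u} [Field K] {X : TopCat.{u}}

/-- A Lie algebroid over `(X, O)`: a sheaf of Lie-Rinehart algebras. The anchor is the action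
`⁅D, f⁆` of sections `D` of the Lie algebroid on sections `f` of `O` by derivations. -/
structure LieAlgebroid (O : X.Sheaf (CommAlgCat.{u} K)) where
  presheaf : X.Presheaf (Type u)
  isSheaf : presheaf.IsSheaf
  [lieRing : ∀ U : Opens X, LieRing (presheaf.obj (op U))]
  [lieAlgebra : ∀ U : Opens X, LieAlgebra K (presheaf.obj (op U))]
  [module : ∀ U : Opens X, Module (OSec O U) (presheaf.obj (op U))]
  [anchor : ∀ U : Opens X, LieRingModule (presheaf.obj (op U)) (OSec O U)]
  [lieRinehartRing : ∀ U : Opens X, LieRinehartRing (OSec O U) (presheaf.obj (op U))]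
  [lieRinehart : ∀ U : Opens X, LieRinehartAlgebra K (OSec O U) (presheaf.obj (op U))]
  map_add' {U V : Opens X} (h : V ≤ U) (D E : presheaf.obj (op U)) :
    presheaf.map (homOfLE h).op (D + E) =
      presheaf.map (homOfLE h).op D + presheaf.map (homOfLE h).op E
  map_smul' {U V : Opens X} (h : V ≤ U) (f : OSec O U) (D : presheaf.obj (op U)) :
    presheaf.map (homOfLE h).op (f • D) = res (oPre O) h f • presheaf.map (homOfLE h).op D
  map_lie' {U V : Opens X} (h : V ≤ U) (D E : presheaf.obj (op U)) :
    presheaf.map (homOfLE h).op ⁅D, E⁆ =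
      ⁅presheaf.map (homOfLE h).op D, presheaf.map (homOfLE h).op E⁆
  map_anchor' {U V : Opens X} (h : V ≤ U) (D : presheaf.obj (op U)) (f : OSec O U) :
    res (oPre O) h ⁅D, f⁆ = ⁅presheaf.map (homOfLE h).op D, res (oPre O) h f⁆

attribute [instance] LieAlgebroid.lieRing LieAlgebroid.lieAlgebra LieAlgebroid.module
  LieAlgebroid.anchor LieAlgebroid.lieRinehartRing LieAlgebroid.lieRinehart

namespace LieAlgebroid

variable {O : X.Sheaf (CommAlgCat.{u} K)} (L M N : LieAlgebroid O)

/-- Sections over `U`. -/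
abbrev Sec (U : Opens X) : Type u := L.presheaf.obj (op U)

/-- Restriction of sections. -/
def res {U V : Opens X} (h : V ≤ U) : L.Sec U →+ L.Sec V :=
  AddMonoidHom.mk' (L.presheaf.map (homOfLE h).op) (L.map_add' h)

lemma res_self {U : Opens X} (h : U ≤ U) (D : L.Sec U) : L.res h D = D := by
  change L.presheaf.map (𝟙 (op U)) D = D
  simp

lemma res_res {U V W : Opens X} (h : V ≤ U) (h' : W ≤ V) (D : L.Sec U) :
    L.res h' (L.res h D) = L.res (h'.trans h) D := by
  change _ = L.presheaf.map ((homOfLE h).op ≫ (homOfLE h').op) D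
  simp [res]

lemma res_smul {U V : Opens X} (h : V ≤ U) (f : OSec O U) (D : L.Sec U) :
    L.res h (f • D) = LieAlgd.res (oPre O) h f • L.res h D := L.map_smul' h f D

lemma res_lie {U V : Opens X} (h : V ≤ U) (D E : L.Sec U) :
    L.res h ⁅D, E⁆ = ⁅L.res h D, L.res h E⁆ := L.map_lie' h D E

lemma res_anchor {U V : Opens X} (h : V ≤ U) (D : L.Sec U) (f : OSec O U) :
    LieAlgd.res (oPre O) h ⁅D, f⁆ = ⁅L.res h D, LieAlgd.res (oPre O) h f⁆ := L.map_anchor' h D f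

variable {L M N}

variable (L M) in
/-- Morphisms of Lie algebroids: morphisms of sheaves of Lie-Rinehart algebras. -/
structure Hom where
  app (U : Opens X) : LieRinehartAlgebra.Hom (AlgHom.id K (OSec O U)) (L.Sec U) (M.Sec U)
  naturality {U V : Opens X} (h : V ≤ U) (D : L.Sec U) : app V (L.res h D) = M.res h (app U D)

lemma Hom.ext' {φ ψ : Hom L M} (h : ∀ U D, φ.app U D = ψ.app U D) : φ = ψ := by
  have : φ.app = ψ.app := by
    funext U
    have h' : (φ.app U).toLieHom = (ψ.app U).toLieHom := LieHom.ext (h U)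
    rcases e : φ.app U with ⟨f, _, _⟩
    rcases e' : ψ.app U with ⟨g, _, _⟩
    rw [e, e'] at h'
    cases h'
    rfl
  rcases φ with ⟨φ, _⟩
  cases this
  rfl

instance : Category (LieAlgebroid O) where
  Hom := Hom
  id L := ⟨fun _ => .id, fun _ _ => rfl⟩
  comp φ ψ := ⟨fun U => (φ.app U).comp (ψ.app U), fun h D => by
    change (ψ.app _) ((φ.app _) _) = _
    rw [φ.naturality, ψ.naturality]
    rfl⟩
  id_comp _ := Hom.ext' fun _ _ => rfl
  comp_id _ := Hom.ext' fun _ _ => rfl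
  assoc _ _ _ := Hom.ext' fun _ _ => rfl

instance (x : X) : DirectedSystem (fun V : Nbhd x => L.Sec V.1)
    (fun V W h => L.res (U := V.1) (V := W.1) h) where
  map_self _ a := L.res_self _ a
  map_map _ _ _ _ _ a := L.res_res _ _ a

variable (L) in
/-- The stalk at `x`: the direct limit of the sections over the neighbourhoods of `x`. -/
def Stalk (x : X) : Type u :=
  DirectLimit (fun V : Nbhd x => L.Sec V.1) (fun V W h => L.res (U := V.1) (V := W.1) h)

instance (x : X) : AddCommGroup (L.Stalk x) := inferInstanceAs (AddCommGroup (DirectLimit _ _))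

variable (L) in
/-- The germ at `x` of a section over `U ∋ x`. -/
def germ {U : Opens X} (x : X) (hx : x ∈ U) : L.Sec U →+ L.Stalk x where
  toFun a := (⟦⟨nbhd U hx, a⟩⟧ : DirectLimit _ _)
  map_zero' := (DirectLimit.zero_def (G := fun V : Nbhd x => L.Sec V.1)
    (f := fun V W h => L.res (U := V.1) (V := W.1) h) (nbhd U hx)).symm
  map_add' a b := (DirectLimit.add_def (G := fun V : Nbhd x => L.Sec V.1)
    (f := fun V W h => L.res (U := V.1) (V := W.1) h) (nbhd U hx) a b).symm

lemma exists_germ {x : X} (s : L.Stalk x) :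
    ∃ (U : Opens X) (hx : x ∈ U) (a : L.Sec U), L.germ x hx a = s := by
  induction s using Quotient.inductionOn with
  | _ s => exact ⟨s.1.1, s.1.2, s.2, rfl⟩

lemma germ_res {U V : Opens X} (h : V ≤ U) (x : X) (hx : x ∈ V) (a : L.Sec U) :
    L.germ x hx (L.res h a) = L.germ x (h hx) a :=
  Quotient.sound ⟨nbhd V hx, le_rfl, h, L.res_self _ _⟩

instance (x : X) : SMul (OStalk O x) (L.Stalk x) where
  smul := DirectLimit.map₂ (F₁ := fun V : Nbhd x => OSec O V.1)
    (F₂ := fun V : Nbhd x => L.Sec V.1) (F := fun V : Nbhd x => L.Sec V.1)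
    (fun V W h => LieAlgd.res (oPre O) (U := V.1) (V := W.1) h)
    (fun V W h => L.res (U := V.1) (V := W.1) h) (fun V W h => L.res (U := V.1) (V := W.1) h)
    (fun V (f : OSec O V.1) (D : L.Sec V.1) => f • D) (fun _ _ h f D => L.res_smul h f D)

lemma germ_smul {U : Opens X} {x : X} (hx : x ∈ U) (f : OSec O U) (D : L.Sec U) :
    L.germ x hx (f • D) = LieAlgd.germ (oPre O) x hx f • L.germ x hx D :=
  (DirectLimit.map₂_def (F₁ := fun V : Nbhd x => OSec O V.1) (F₂ := fun V : Nbhd x => L.Sec V.1)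
    (F := fun V : Nbhd x => L.Sec V.1)
    (fun V W h => LieAlgd.res (oPre O) (U := V.1) (V := W.1) h)
    (fun V W h => L.res (U := V.1) (V := W.1) h) (fun V W h => L.res (U := V.1) (V := W.1) h)
    (fun V (f : OSec O V.1) (D : L.Sec V.1) => f • D) (fun _ _ h f D => L.res_smul h f D)
    (nbhd U hx) f D).symm

/-- The stalks of a Lie algebroid are modules over the stalks of the structure sheaf. -/
instance (x : X) : Module (OStalk O x) (L.Stalk x) where
  one_smul D := by
    obtain ⟨U, hx, D, rfl⟩ := exists_germ D
    rw [← map_one (LieAlgd.germ (oPre O) x hx), ← germ_smul, one_smul]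
  mul_smul f g D := by
    obtain ⟨U, hU, f, rfl⟩ := LieAlgd.exists_germ _ f
    obtain ⟨V, hV, g, rfl⟩ := LieAlgd.exists_germ _ g
    obtain ⟨W, hW, D, rfl⟩ := exists_germ D
    have hx : x ∈ U ⊓ (V ⊓ W) := ⟨hU, hV, hW⟩
    rw [← LieAlgd.germ_res _ (inf_le_left : U ⊓ (V ⊓ W) ≤ U) x hx,
      ← LieAlgd.germ_res _ (inf_le_right.trans inf_le_left : U ⊓ (V ⊓ W) ≤ V) x hx,
      ← germ_res (inf_le_right.trans inf_le_right : U ⊓ (V ⊓ W) ≤ W) x hx, ← map_mul,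
      ← germ_smul, ← germ_smul, ← germ_smul]
    exact congrArg _ (mul_smul _ _ _)
  smul_zero f := by
    obtain ⟨U, hU, f, rfl⟩ := LieAlgd.exists_germ _ f
    rw [← map_zero (L.germ x hU), ← germ_smul, smul_zero]
  zero_smul D := by
    obtain ⟨U, hx, D, rfl⟩ := exists_germ D
    rw [← map_zero (LieAlgd.germ (oPre O) x hx), ← germ_smul, zero_smul, map_zero]
  smul_add f D E := by
    obtain ⟨U, hU, f, rfl⟩ := LieAlgd.exists_germ _ f
    obtain ⟨V, hV, D, rfl⟩ := exists_germ D
    obtain ⟨W, hW, E, rfl⟩ := exists_germ E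
    have hx : x ∈ U ⊓ (V ⊓ W) := ⟨hU, hV, hW⟩
    rw [← LieAlgd.germ_res _ (inf_le_left : U ⊓ (V ⊓ W) ≤ U) x hx,
      ← germ_res (inf_le_right.trans inf_le_left : U ⊓ (V ⊓ W) ≤ V) x hx,
      ← germ_res (inf_le_right.trans inf_le_right : U ⊓ (V ⊓ W) ≤ W) x hx, ← map_add,
      ← germ_smul, ← germ_smul, ← germ_smul, ← map_add]
    exact congrArg _ (smul_add _ _ _)
  add_smul f g D := by
    obtain ⟨U, hU, f, rfl⟩ := LieAlgd.exists_germ _ f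
    obtain ⟨V, hV, g, rfl⟩ := LieAlgd.exists_germ _ g
    obtain ⟨W, hW, D, rfl⟩ := exists_germ D
    have hx : x ∈ U ⊓ (V ⊓ W) := ⟨hU, hV, hW⟩
    rw [← LieAlgd.germ_res _ (inf_le_left : U ⊓ (V ⊓ W) ≤ U) x hx,
      ← LieAlgd.germ_res _ (inf_le_right.trans inf_le_left : U ⊓ (V ⊓ W) ≤ V) x hx,
      ← germ_res (inf_le_right.trans inf_le_right : U ⊓ (V ⊓ W) ≤ W) x hx, ← map_add,
      ← germ_smul, ← germ_smul, ← germ_smul, ← map_add]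
    exact congrArg _ (add_smul _ _ _)

end LieAlgebroid

end LieAlgebroids

/-! ### Local freeness -/

section LocallyFree

variable {K : Type u} [Field K] {X : TopCat.{u}} {O : X.Sheaf (CommAlgCat.{u} K)}

variable (O) in
/-- Let a sheaf of `O`-modules be given by its stalks `M y` and by its sections over open sets
`U`, regarded as families of elements of the stalks `M y`, `y ∈ U`. It is locally free if each
point has an open neighbourhood `U` with a family `e` of sections over `U` (which may be infinite)
whose germs form a basis of `M y` for all `y ∈ U`, that is, for which the morphism
`O^{⊕ I} → M` defined by `e` is an isomorphism over `U`. -/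
def IsLocallyFreeSheaf (M : X → Type u) [∀ y, AddCommGroup (M y)] [∀ y, Module (OStalk O y) (M y)]
    (IsSection : ∀ U : Opens X, (∀ y : U, M y.1) → Prop) : Prop :=
  ∀ x : X, ∃ (U : Opens X) (_ : x ∈ U) (I : Type u) (e : I → ∀ y : U, M y.1),
    (∀ i, IsSection U (e i)) ∧
    ∀ y : U, LinearIndependent (OStalk O y.1) (fun i => e i y) ∧
      Submodule.span (OStalk O y.1) (Set.range fun i => e i y) = ⊤

/-- Locally free Lie algebroids. -/
def LieAlgebroid.IsLocallyFree (L : LieAlgebroid O) : Prop :=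
  IsLocallyFreeSheaf O L.Stalk fun U s => ∃ D : L.Sec U, ∀ y : U, s y = L.germ y.1 y.2 D

namespace Bialgebroid

variable (A : Bialgebroid O)

/-- The stalk at `x` of the term `Āₙ` of the primitive filtration of `Ā = Ker ε`. -/
abbrev fil (n : ℕ) (x : X) : Submodule (OStalk O x) (A.alg.Stalk x) :=
  primFil (OStalk O x) (A.alg.Stalk x) n

/-- The stalk at `x` of the subquotient `Āₙ₊₁ / Āₙ`. -/
abbrev gr (n : ℕ) (x : X) : Type u := primGr (OStalk O x) (A.alg.Stalk x) n

/-- The sections over `U` of the quotient sheaf `Āₙ₊₁ / Āₙ`: families of elements of the stalks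
which near each point are induced by a section of `Āₙ₊₁`. -/
def IsGrSection (n : ℕ) (U : Opens X) (s : ∀ y : U, A.gr n y.1) : Prop :=
  ∀ x : U, ∃ (V : Opens X) (_ : x.1 ∈ V) (hV : V ≤ U) (a : A.alg.Sec V)
    (ha : ∀ (y : X) (hy : y ∈ V), A.alg.germ y hy a ∈ A.fil (n + 1) y),
    ∀ (y : X) (hy : y ∈ V), s ⟨y, hV hy⟩ = Submodule.Quotient.mk ⟨A.alg.germ y hy a, ha y hy⟩

/-- `A` is locally graded free if all subquotients `Āₙ₊₁ / Āₙ` of the primitive filtration are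
locally free. -/
def IsLocallyGradedFree : Prop := ∀ n, IsLocallyFreeSheaf O (A.gr n) (A.IsGrSection n)

/-- `A` is cocomplete if it is the union of the subsheaves `Aₙ = O ⊕ Āₙ`, that is, if each section
of `A` is locally a section of some `Aₙ`. -/
def IsCocomplete : Prop :=
  ∀ (U : Opens X) (a : A.alg.Sec U) (x : X) (hx : x ∈ U), ∃ n : ℕ,
    A.alg.germ x hx a ∈ Submodule.span (OStalk O x) {1} ⊔ A.fil n x

end Bialgebroid

end LocallyFree

section PrimitiveElements

variable {R A : Type u} [CommRing R] [Ring A] [Module R A] [IsScalarTower R A A]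
  [Coalgebra R A] [IsRBialgebra R A]

lemma counit_smul_one (r : R) : Coalgebra.counit (R := R) (r • (1 : A)) = r := by
  rw [map_smul, IsRBialgebra.counit_one, smul_eq_mul, mul_one]

lemma counit_of_prim {a : A} (ha : a ∈ primFil R A 1) : Coalgebra.counit (R := R) a = 0 := by
  obtain ⟨s, -, rfl⟩ := ha
  exact s.2

lemma prim_mul_smul_one {a : A} (ha : a ∈ primFil R A 1) (r : R) :
    a * (r • (1 : A)) = r • a + Coalgebra.counit (R := R) (a * (r • (1 : A))) • (1 : A) := by
  have h := IsRBialgebra.comul_mem a r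
  rw [(mem_primFil_one a).1 ha] at h
  have h' := congrArg (fun t => TensorProduct.lid R A
    ((Coalgebra.counit (R := R) (A := A)).rTensor A t)) h
  simp only [rmul, map_add, TensorProduct.map_tmul, LinearMap.mulRight_apply,
    LinearMap.rTensor_tmul, TensorProduct.lid_tmul, mul_one, one_mul, counit_smul_one,
    counit_of_prim ha, IsRBialgebra.counit_one, zero_smul, one_smul, zero_add] at h'
  exact ((add_comm _ _).trans h').symm

lemma prim_lie {a b : A} (ha : a ∈ primFil R A 1) (hb : b ∈ primFil R A 1) :
    a * b - b * a ∈ primFil R A 1 := by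
  have key : ∀ {a b : A}, a ∈ primFil R A 1 → b ∈ primFil R A 1 →
      Coalgebra.comul (R := R) (a * b) =
        (a * b) ⊗ₜ[R] 1 + b ⊗ₜ[R] a + (a ⊗ₜ[R] b + 1 ⊗ₜ[R] (a * b)) := by
    intro a b ha hb
    rw [IsRBialgebra.comul_mul a b 2 ![b, 1] ![1, b] (by simp [(mem_primFil_one b).1 hb])]
    simp [rmul, (mem_primFil_one a).1 ha]
  rw [mem_primFil_one, map_sub, key ha hb, key hb ha, TensorProduct.sub_tmul,
    TensorProduct.tmul_sub]
  abel

end PrimitiveElements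

/-! ### The Lie algebroid of primitive elements -/

section Prim

variable {K : Type u} [Field K] {X : TopCat.{u}} {O : X.Sheaf (CommAlgCat.{u} K)}

attribute [local instance] LieRing.ofAssociativeRing

lemma ExtAlg.ηx_eq (A : ExtAlg O) {x : X} (f : OStalk O x) : A.ηx x f = f • (1 : A.Stalk x) := by
  rw [ExtAlg.stalk_smul_def, mul_one]

namespace Bialgebroid

variable (A : Bialgebroid O) {U V : Opens X}

lemma ε_add (a b : A.alg.Sec U) : A.ε (a + b) = A.ε a + A.ε b :=
  sec_ext (oPre_isSheaf O) fun x hx => by simp only [map_add, germ_ε]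

lemma ε_η (f : OSec O U) : A.ε (A.alg.η U f) = f :=
  sec_ext (oPre_isSheaf O) fun x hx => by
    rw [germ_ε, ← onStalk_germ, ExtAlg.ηx_eq, counit_smul_one]

lemma ε_res (h : V ≤ U) (a : A.alg.Sec U) : A.ε (A.alg.res h a) = res (oPre O) h (A.ε a) :=
  sec_ext (oPre_isSheaf O) fun x hx => by rw [germ_res, germ_ε, germ_ε, germ_res]

lemma η_injective : Function.Injective (A.alg.η U) := fun f g h => by
  rw [← A.ε_η f, h, ε_η]

/-- The sections over `U` of the first term of the primitive filtration: the sections of `A` which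
are primitive, with the commutator bracket. -/
def prim (U : Opens X) : LieSubalgebra K (A.alg.Sec U) where
  carrier := {a | ∀ (x : X) (hx : x ∈ U), A.alg.germ x hx a ∈ A.fil 1 x}
  zero_mem' x hx := by rw [map_zero]; exact zero_mem _
  add_mem' ha hb x hx := by rw [map_add]; exact add_mem (ha x hx) (hb x hx)
  smul_mem' k a ha x hx := by
    have h : A.alg.germ x hx (k • a) = algebraMap K (OStalk O x) k • A.alg.germ x hx a := by
      rw [map_smul, ExtAlg.stalk_smul_def, AlgHom.commutes, ← Algebra.smul_def]
    rw [h]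
    exact Submodule.smul_mem _ _ (ha x hx)
  lie_mem' ha hb x hx := by
    rw [Ring.lie_def, map_sub, map_mul, map_mul]
    exact prim_lie (ha x hx) (hb x hx)

variable {A}

lemma smul_mem_prim (f : OSec O U) {a : A.alg.Sec U} (ha : a ∈ A.prim U) : f • a ∈ A.prim U :=
  fun x hx => by
    rw [ExtAlg.germ_smul]
    exact Submodule.smul_mem _ _ (ha x hx)

lemma res_mem_prim (h : V ≤ U) {a : A.alg.Sec U} (ha : a ∈ A.prim U) :
    A.alg.res h a ∈ A.prim V := fun x hx => by
  rw [germ_res]; exact ha x (h hx)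

/-- For a primitive section `D` the section `ε(D f)` of `O` acts as the commutator of `D`
and `f`. -/
lemma η_anchor {D : A.alg.Sec U} (hD : D ∈ A.prim U) (f : OSec O U) :
    A.alg.η U (A.ε (D * A.alg.η U f)) = ⁅D, A.alg.η U f⁆ := by
  refine sec_ext A.alg.isSheaf fun x hx => ?_
  have e : A.alg.germ x hx (A.alg.η U f) = LieAlgd.germ (oPre O) x hx f • (1 : A.alg.Stalk x) := by
    rw [← onStalk_germ, ExtAlg.ηx_eq]
  rw [← onStalk_germ, germ_ε, ExtAlg.ηx_eq, Ring.lie_def, map_sub,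
    map_mul (A.alg.germ x hx) D, map_mul (A.alg.germ x hx) _ D, e, eq_sub_iff_add_eq,
    smul_mul_assoc, one_mul, add_comm]
  exact (prim_mul_smul_one (hD x hx) _).symm

instance : Module (OSec O U) (A.prim U) where
  smul f D := ⟨f • D.1, smul_mem_prim f D.2⟩
  one_smul D := Subtype.ext (one_smul _ D.1)
  mul_smul f g D := Subtype.ext (mul_smul f g D.1)
  smul_zero f := Subtype.ext (smul_zero f)
  smul_add f D E := Subtype.ext (smul_add f D.1 E.1)
  add_smul f g D := Subtype.ext (add_smul f g D.1)
  zero_smul D := Subtype.ext (zero_smul _ D.1)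

lemma coe_smul_prim (f : OSec O U) (D : A.prim U) :
    ((f • D : A.prim U) : A.alg.Sec U) = A.alg.η U f * D := rfl

/-- The anchor of the Lie algebroid of primitive elements: `D` acts by `f ↦ ε(D f)`. -/
instance : Bracket (A.prim U) (OSec O U) := ⟨fun D f => A.ε (D.1 * A.alg.η U f)⟩

lemma lie_prim_def (D : A.prim U) (f : OSec O U) : ⁅D, f⁆ = A.ε (D.1 * A.alg.η U f) := rfl

lemma η_lie_prim (D : A.prim U) (f : OSec O U) :
    A.alg.η U ⁅D, f⁆ = ⁅D.1, A.alg.η U f⁆ := η_anchor D.2 f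

instance : LieRingModule (A.prim U) (OSec O U) where
  add_lie D E f := A.η_injective (by
    rw [map_add, η_lie_prim, η_lie_prim, η_lie_prim, ← add_lie]; rfl)
  lie_add D f g := A.η_injective (by
    rw [map_add, η_lie_prim, η_lie_prim, η_lie_prim, map_add, lie_add])
  leibniz_lie D E f := A.η_injective (by
    rw [map_add]
    simp only [η_lie_prim]
    exact leibniz_lie D.1 E.1 (A.alg.η U f))

instance : LieRinehartRing (OSec O U) (A.prim U) where
  lie_smul_eq_mul' f g D := A.η_injective (by
    rw [map_mul, η_lie_prim, η_lie_prim, coe_smul_prim, Ring.lie_def, Ring.lie_def, mul_sub,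
      ← mul_assoc, ← mul_assoc, ← mul_assoc, ← map_mul, ← map_mul, mul_comm f g])
  leibniz_mul_right' D f g := A.η_injective (by
    rw [map_add, smul_eq_mul, map_mul, map_mul, η_lie_prim, η_lie_prim, η_lie_prim, map_mul]
    simp only [Ring.lie_def]
    noncomm_ring)
  leibniz_smul_right' D E f := Subtype.ext (by
    change ⁅D.1, A.alg.η U f * E.1⁆ = A.alg.η U f * ⁅D.1, E.1⁆ + A.alg.η U ⁅D, f⁆ * E.1
    rw [η_lie_prim]
    simp only [Ring.lie_def]
    noncomm_ring)

instance : LieRinehartAlgebra K (OSec O U) (A.prim U) where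
  smul_assoc k f D := Subtype.ext (by
    change A.alg.η U (k • f) * D.1 = k • (A.alg.η U f * D.1)
    rw [map_smul, smul_mul_assoc])
  smul_lie k D f := A.η_injective (by
    rw [map_smul, η_lie_prim, η_lie_prim]
    exact smul_lie k D.1 (A.alg.η U f))
  lie_smul k D f := A.η_injective (by
    rw [map_smul, η_lie_prim, η_lie_prim, map_smul]
    exact lie_smul k D.1 (A.alg.η U f))

variable (A) in
/-- The sheaf of primitive elements. -/
def primPresheaf : X.Presheaf (Type u) where
  obj U := A.prim U.unop
  map {U V} i := TypeCat.ofHom fun D => ⟨A.alg.res (leOfHom i.unop) D.1, res_mem_prim _ D.2⟩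
  map_id U := by
    ext D
    exact res_self _ _ _
  map_comp i j := by
    ext D
    exact (res_res _ _ _ _).symm

variable (A) in
lemma primPresheaf_isSheaf : A.primPresheaf.IsSheaf := by
  refine TopCat.Presheaf.isSheaf_of_isSheafUniqueGluing_types _ fun ι W s hs => ?_
  obtain ⟨g, hg, hu⟩ := A.alg.isSheaf.isSheafUniqueGluing W (fun i => (s i).1)
    fun i j => congrArg Subtype.val (hs i j)
  have hg' : ∀ i, A.alg.res (le_iSup W i) g = (s i).1 := hg
  refine ⟨⟨g, fun x hx => ?_⟩, fun i => Subtype.ext (hg i), fun t ht =>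
    Subtype.ext (hu _ fun i => congrArg Subtype.val (ht i))⟩
  obtain ⟨i, hi⟩ := Opens.mem_iSup.1 hx
  have := (s i).2 x hi
  rwa [← hg' i, germ_res] at this

variable (A) in
/-- The Lie algebroid of primitive elements of a sheaf of bialgebras. -/
def primAlgebroid : LieAlgebroid O where
  presheaf := A.primPresheaf
  isSheaf := A.primPresheaf_isSheaf
  lieRing U := inferInstanceAs (LieRing (A.prim U))
  lieAlgebra U := inferInstanceAs (LieAlgebra K (A.prim U))
  module U := inferInstanceAs (Module (OSec O U) (A.prim U))
  anchor U := inferInstanceAs (LieRingModule (A.prim U) (OSec O U))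
  lieRinehartRing U := inferInstanceAs (LieRinehartRing (OSec O U) (A.prim U))
  lieRinehart U := inferInstanceAs (LieRinehartAlgebra K (OSec O U) (A.prim U))
  map_add' h D E := Subtype.ext (map_add (A.alg.res h) D.1 E.1)
  map_smul' h f D := Subtype.ext (by
    change A.alg.res h (A.alg.η _ f * D.1) = A.alg.η _ (res (oPre O) h f) * A.alg.res h D.1
    rw [map_mul, onSec_res])
  map_lie' h D E := Subtype.ext (by
    change A.alg.res h (D.1 * E.1 - E.1 * D.1) = _
    rw [map_sub, map_mul, map_mul]
    rfl)
  map_anchor' h D f := by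
    change res (oPre O) h (A.ε (D.1 * A.alg.η _ f)) =
      A.ε (A.alg.res h D.1 * A.alg.η _ (res (oPre O) h f))
    rw [← ε_res, map_mul, onSec_res]

variable {B : Bialgebroid O}

lemma Hom.germ_map_mem_prim (ψ : A ⟶ B) {D : A.alg.Sec U} (hD : D ∈ A.prim U) :
    onSec ψ.map.hom U D ∈ B.prim U := fun x hx => by
  rw [← ExtAlg.Hom.stalk_germ, mem_primFil_one]
  have h := LinearMap.congr_fun (ψ.comul_comp x) (A.alg.germ x hx D)
  rw [LinearMap.comp_apply, LinearMap.comp_apply, (mem_primFil_one _).1 (hD x hx)] at h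
  rw [h, map_add, TensorProduct.map_tmul, TensorProduct.map_tmul, ExtAlg.Hom.stalk_one]

lemma Hom.ε_map (ψ : A ⟶ B) (a : A.alg.Sec U) : B.ε (onSec ψ.map.hom U a) = A.ε a :=
  sec_ext (oPre_isSheaf O) fun x hx => by
    rw [germ_ε, germ_ε, ← ExtAlg.Hom.stalk_germ]
    exact LinearMap.congr_fun (ψ.counit_comp x) _

/-- The morphism of Lie algebroids of primitive elements induced by a morphism of bialgebras. -/
def primMap (ψ : A ⟶ B) : A.primAlgebroid ⟶ B.primAlgebroid where
  app U :=
    { toFun := fun D : A.prim U => (⟨onSec ψ.map.hom U D.1, ψ.germ_map_mem_prim D.2⟩ : B.prim U)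
      map_add' := fun D E => Subtype.ext (map_add (onSec ψ.map.hom U) D.1 E.1)
      map_smul' := fun k D => Subtype.ext (map_smul (onSec ψ.map.hom U) k D.1)
      map_lie' := fun {D E} => Subtype.ext (by
        change onSec ψ.map.hom U (D.1 * E.1 - E.1 * D.1) = _
        rw [map_sub, map_mul, map_mul]
        rfl)
      map_smul_apply' := fun f D => Subtype.ext (by
        change onSec ψ.map.hom U (A.alg.η U f * D.1) = B.alg.η U f * onSec ψ.map.hom U D.1
        rw [map_mul, ExtAlg.Hom.hom_η])
      apply_lie' := fun f D => by
        change A.ε (D.1 * A.alg.η U f) = B.ε (onSec ψ.map.hom U D.1 * B.alg.η U f)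
        rw [← ExtAlg.Hom.hom_η ψ.map, ← map_mul, ψ.ε_map] }
  naturality h D := Subtype.ext (onSec_res ψ.map.hom h D.1)

end Bialgebroid

variable (O) in
/-- The functor `𝒫` of primitive elements. -/
def primFunctor : Bialgebroid O ⥤ LieAlgebroid O where
  obj A := A.primAlgebroid
  map ψ := Bialgebroid.primMap ψ
  map_id _ := LieAlgebroid.Hom.ext' fun _ _ => rfl
  map_comp _ _ := LieAlgebroid.Hom.ext' fun _ _ => rfl

end Prim

/-! ### The universal enveloping algebra of a Lie-Rinehart algebra -/

section Env

variable (K R L : Type u) [Field K] [CommRing R] [Algebra K R] [LieRing L]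
  [Module R L] [LieRingModule L R]

/-- The defining relations of the universal enveloping algebra, for the generators `f` in `R` and
`D` in `L`. -/
inductive EnvRel : FreeAlgebra K (R ⊕ L) → FreeAlgebra K (R ⊕ L) → Prop
  | scalar (k : K) : EnvRel (.ι K (.inl (algebraMap K R k))) (algebraMap K _ k)
  | add_left (f g : R) :
      EnvRel (.ι K (.inl (f + g))) (.ι K (.inl f) + .ι K (.inl g))
  | mul_left (f g : R) :
      EnvRel (.ι K (.inl (f * g))) (.ι K (.inl f) * .ι K (.inl g))
  | add_right (D E : L) :
      EnvRel (.ι K (.inr (D + E))) (.ι K (.inr D) + .ι K (.inr E))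
  | lie (D E : L) :
      EnvRel (.ι K (.inr ⁅D, E⁆)) (.ι K (.inr D) * .ι K (.inr E) - .ι K (.inr E) * .ι K (.inr D))
  | smul (f : R) (D : L) :
      EnvRel (.ι K (.inr (f • D))) (.ι K (.inl f) * .ι K (.inr D))
  | anchor (D : L) (f : R) :
      EnvRel (.ι K (.inr D) * .ι K (.inl f)) (.ι K (.inl f) * .ι K (.inr D) + .ι K (.inl ⁅D, f⁆))

/-- The universal enveloping algebra `U(R, L)` of a Lie-Rinehart algebra `L` over `R`. -/
def Env : Type u := RingQuot (EnvRel K R L)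

namespace Env

instance : Ring (Env K R L) := inferInstanceAs (Ring (RingQuot _))

instance : Algebra K (Env K R L) := inferInstanceAs (Algebra K (RingQuot _))

/-- The quotient map. -/
def mk : FreeAlgebra K (R ⊕ L) →ₐ[K] Env K R L := RingQuot.mkAlgHom K (EnvRel K R L)

variable {K R L}

lemma mk_rel {a b : FreeAlgebra K (R ⊕ L)} (h : EnvRel K R L a b) : mk K R L a = mk K R L b :=
  RingQuot.mkAlgHom_rel K h

/-- The canonical homomorphism `R → U(R, L)`. -/
def η : R →ₐ[K] Env K R L :=
  AlgHom.ofLinearMap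
    { toFun := fun f => mk K R L (.ι K (.inl f))
      map_add' := fun f g => by
        rw [mk_rel (EnvRel.add_left f g), map_add]
      map_smul' := fun k f => by
        rw [Algebra.smul_def, mk_rel (EnvRel.mul_left _ f), map_mul,
          mk_rel (EnvRel.scalar k), AlgHom.commutes, RingHom.id_apply,
          Algebra.smul_def] }
    (by
      change mk K R L (.ι K (.inl 1)) = 1
      rw [← map_one (algebraMap K R), mk_rel (EnvRel.scalar 1), map_one, map_one])
    (fun f g => by
      change mk K R L (.ι K (.inl (f * g))) = _
      rw [mk_rel (EnvRel.mul_left f g), map_mul]; rfl)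

/-- The canonical map `L → U(R, L)`. -/
def δ : L →+ Env K R L :=
  AddMonoidHom.mk' (fun D => mk K R L (.ι K (.inr D))) fun D E => by
    rw [mk_rel (EnvRel.add_right D E), map_add]

lemma δ_lie (D E : L) : (δ ⁅D, E⁆ : Env K R L) = δ D * δ E - δ E * δ D := by
  change mk K R L (.ι K (.inr ⁅D, E⁆)) = _
  rw [mk_rel (EnvRel.lie D E), map_sub, map_mul, map_mul]; rfl

lemma δ_smul (f : R) (D : L) : (δ (f • D) : Env K R L) = η f * δ D := by
  change mk K R L (.ι K (.inr (f • D))) = _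
  rw [mk_rel (EnvRel.smul f D), map_mul]; rfl

lemma δ_mul_η (D : L) (f : R) : (δ D * η f : Env K R L) = η f * δ D + η ⁅D, f⁆ := by
  change mk K R L (.ι K (.inr D)) *
    mk K R L (.ι K (.inl f)) = _
  rw [← map_mul, mk_rel (EnvRel.anchor D f), map_add, map_mul]; rfl

section Lift

variable {P : Type u} [Ring P] [Algebra K P] (φ : R →ₐ[K] P) (ψ : L →+ P)
  (h_lie : ∀ D E, ψ ⁅D, E⁆ = ψ D * ψ E - ψ E * ψ D)
  (h_smul : ∀ f D, ψ (f • D) = φ f * ψ D)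
  (h_anchor : ∀ D f, ψ D * φ f = φ f * ψ D + φ ⁅D, f⁆)

/-- The universal property of the universal enveloping algebra. -/
def lift : Env K R L →ₐ[K] P :=
  RingQuot.liftAlgHom K ⟨FreeAlgebra.lift K (Sum.elim φ ψ), fun a b h => by
    cases h with
    | scalar k => simp
    | add_left f g => simp
    | mul_left f g => simp
    | add_right D E => simp
    | lie D E => simp [h_lie]
    | smul f D => simp [h_smul]
    | anchor D f => simp [h_anchor]⟩

lemma lift_η (f : R) : lift φ ψ h_lie h_smul h_anchor (η f) = φ f :=
  (RingQuot.liftAlgHom_mkAlgHom_apply K _ _ _).trans (FreeAlgebra.lift_ι_apply _ _)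

lemma lift_δ (D : L) : lift φ ψ h_lie h_smul h_anchor (δ D) = ψ D :=
  (RingQuot.liftAlgHom_mkAlgHom_apply K _ _ _).trans (FreeAlgebra.lift_ι_apply _ _)

end Lift

/-- The universal enveloping algebra is generated by `R` and `L`. -/
lemma induction {p : Env K R L → Prop} (h_one : p 1) (h_add : ∀ a b, p a → p b → p (a + b))
    (h_η : ∀ f a, p a → p (η f * a)) (h_δ : ∀ D a, p a → p (δ D * a)) (a : Env K R L) : p a := by
  obtain ⟨w, rfl⟩ : ∃ w, mk K R L w = a := RingQuot.mkAlgHom_surjective K (EnvRel K R L) a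
  suffices h : ∀ a, p a → p (mk K R L w * a) by
    simpa using h 1 h_one
  induction w using FreeAlgebra.induction with
  | grade0 k =>
    intro a ha
    have := h_η (algebraMap K R k) a ha
    rwa [AlgHom.commutes, ← AlgHom.commutes (mk K R L)] at this
  | grade1 s =>
    rcases s with f | D
    · exact fun a => h_η f a
    · exact fun a => h_δ D a
  | mul v w hv hw =>
    intro a ha
    rw [map_mul, mul_assoc]
    exact hv _ (hw _ ha)
  | add v w hv hw =>
    intro a ha
    rw [map_add, add_mul]
    exact h_add _ _ (hv _ ha) (hw _ ha)

lemma ringHom_ext {P : Type u} [Ring P] {g h : Env K R L →+* P}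
    (h_η : ∀ f, g (η f) = h (η f)) (h_δ : ∀ D, g (δ D) = h (δ D)) : g = h := by
  ext a
  induction a using induction with
  | h_one => rw [map_one, map_one]
  | h_add a b ha hb => rw [map_add, map_add, ha, hb]
  | h_η f a ha => rw [map_mul, map_mul, ha, h_η]
  | h_δ D a ha => rw [map_mul, map_mul, ha, h_δ]

end Env

end Env

/-! ### Bialgebras generated by primitive elements -/

section Box

variable {K R M N S : Type u} [Field K] [CommRing R] [AddCommGroup M] [AddCommGroup N]
  [AddCommGroup S] [Module R M] [Module R N] [Module R S] [Module K M] [Module K N] [Module K S]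
  [SMulCommClass R K M] [SMulCommClass R K N] [SMulCommClass R K S]

/-- A `K`-linear endomorphism of an `R`-module satisfying a Leibniz rule. -/
def IsLeibniz (d : R → R) (P : M →ₗ[K] M) : Prop := ∀ (r : R) (m : M), P (r • m) = r • P m + d r • m

/-- The operator `m ⊗ n ↦ P m ⊗ n + m ⊗ Q n` as an additive map. -/
def boxAdd {d : R → R} {P : M →ₗ[K] M} {Q : N →ₗ[K] N} (hP : IsLeibniz d P) (hQ : IsLeibniz d Q) :
    M ⊗[R] N →+ M ⊗[R] N :=
  TensorProduct.liftAddHom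
    (AddMonoidHom.mk' (fun m => AddMonoidHom.mk' (fun n => P m ⊗ₜ[R] n + m ⊗ₜ[R] Q n)
        fun n n' => by rw [Q.map_add, TensorProduct.tmul_add, TensorProduct.tmul_add]; abel)
      fun m m' => by
        ext n
        change P (m + m') ⊗ₜ[R] n + (m + m') ⊗ₜ[R] Q n =
          (P m ⊗ₜ[R] n + m ⊗ₜ[R] Q n) + (P m' ⊗ₜ[R] n + m' ⊗ₜ[R] Q n)
        rw [P.map_add, TensorProduct.add_tmul, TensorProduct.add_tmul]
        abel)
    fun r m n => by
      change P (r • m) ⊗ₜ[R] n + (r • m) ⊗ₜ[R] Q n = P m ⊗ₜ[R] (r • n) + m ⊗ₜ[R] Q (r • n)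
      rw [hP r m, hQ r n, TensorProduct.add_tmul, TensorProduct.tmul_add,
        TensorProduct.smul_tmul r m (Q n), TensorProduct.smul_tmul r (P m) n,
        TensorProduct.smul_tmul (d r) m n]
      abel

/-- The operator `m ⊗ n ↦ P m ⊗ n + m ⊗ Q n`. -/
def box {d : R → R} {P : M →ₗ[K] M} {Q : N →ₗ[K] N} (hP : IsLeibniz d P) (hQ : IsLeibniz d Q) :
    M ⊗[R] N →ₗ[K] M ⊗[R] N where
  toFun := boxAdd hP hQ
  map_add' := map_add _
  map_smul' k t := by
    induction t with
    | zero => rw [smul_zero, map_zero, smul_zero]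
    | add s t hs ht => rw [smul_add, map_add, hs, ht, map_add, smul_add]
    | tmul m n =>
      change P (k • m) ⊗ₜ[R] n + (k • m) ⊗ₜ[R] Q n = k • (P m ⊗ₜ[R] n + m ⊗ₜ[R] Q n)
      rw [P.map_smul, smul_add, TensorProduct.smul_tmul', TensorProduct.smul_tmul']

variable {d : R → R} {P : M →ₗ[K] M} {Q : N →ₗ[K] N} {T : S →ₗ[K] S}
  (hP : IsLeibniz d P) (hQ : IsLeibniz d Q) (hT : IsLeibniz d T)

lemma box_tmul (m : M) (n : N) : box hP hQ (m ⊗ₜ[R] n) = P m ⊗ₜ[R] n + m ⊗ₜ[R] Q n := rfl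

lemma isLeibniz_box : IsLeibniz d (box hP hQ) := fun r t => by
  induction t with
  | zero => simp
  | add s t hs ht => simp only [smul_add, map_add, hs, ht]; abel
  | tmul m n =>
    rw [TensorProduct.smul_tmul', box_tmul, box_tmul, hP r m, TensorProduct.add_tmul, smul_add,
      TensorProduct.smul_tmul', TensorProduct.smul_tmul', TensorProduct.smul_tmul']
    abel

lemma comm_box (t : M ⊗[R] N) :
    TensorProduct.comm R M N (box hP hQ t) = box hQ hP (TensorProduct.comm R M N t) := by
  induction t with
  | zero => simp
  | add s t hs ht => simp only [map_add, hs, ht]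
  | tmul m n =>
    rw [box_tmul, map_add, TensorProduct.comm_tmul, TensorProduct.comm_tmul,
      TensorProduct.comm_tmul, box_tmul, add_comm]

lemma assoc_box (t : (M ⊗[R] N) ⊗[R] S) :
    TensorProduct.assoc R M N S (box (isLeibniz_box hP hQ) hT t) =
      box hP (isLeibniz_box hQ hT) (TensorProduct.assoc R M N S t) := by
  induction t with
  | zero => simp
  | add s t hs ht => simp only [map_add, hs, ht]
  | tmul t s =>
    induction t with
    | zero => simp
    | add t t' h h' => simp only [TensorProduct.add_tmul, map_add, h, h']
    | tmul m n =>
      simp only [box_tmul, TensorProduct.add_tmul, map_add, TensorProduct.assoc_tmul,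
        TensorProduct.tmul_add]
      abel

end Box

section Generated

variable (K R A : Type u) [Field K] [CommRing R] [Algebra K R] [Ring A] [Algebra K A] [Module R A]
  [IsScalarTower R A A] [SMulCommClass R K A]

/-- Let the ring `A` be generated by `R` and by elements `D` acting on `R` by derivations `d D`
with `D r = r D + d_D(r)`. This structure expresses that there is an action `ρ` of `A` on `A ⊗ A`
under which each `D` acts by `a ⊗ b ↦ D a ⊗ b + a ⊗ D b`, and an action `σ` of `A` on `R` under
which each `D` acts by `d_D`. -/
structure CoalgData where
  gen : Type u
  gens : gen → A
  d : gen → R →ₗ[K] R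
  d_one (D : gen) : d D 1 = 0
  leibniz (D : gen) : IsLeibniz (d D) (LinearMap.mulLeft K (gens D))
  induction (p : A → Prop) (h_one : p 1) (h_add : ∀ a b, p a → p b → p (a + b))
    (h_smul : ∀ (r : R) a, p a → p (r • a)) (h_gen : ∀ D a, p a → p (gens D * a)) (a : A) : p a
  ρ : A →+* Module.End K (A ⊗[R] A)
  ρ_smul (r : R) (a : A) (t) : ρ (r • a) t = r • ρ a t
  ρ_gen (D : gen) : ρ (gens D) = box (leibniz D) (leibniz D)
  σ : A →+* Module.End K R
  σ_smul (r : R) (a : A) (t) : σ (r • a) t = r * σ a t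
  σ_gen (D : gen) : σ (gens D) = d D

namespace CoalgData

variable {K R A} (C : CoalgData K R A)

/-- The coproduct. -/
def comul : A →ₗ[R] A ⊗[R] A where
  toFun a := C.ρ a (1 ⊗ₜ 1)
  map_add' a b := by rw [map_add]; rfl
  map_smul' r a := C.ρ_smul r a _

/-- The counit. -/
def counit : A →ₗ[R] R where
  toFun a := C.σ a 1
  map_add' a b := by rw [map_add]; rfl
  map_smul' r a := C.σ_smul r a _

lemma comul_one : C.comul 1 = 1 ⊗ₜ 1 := by
  change C.ρ 1 _ = _
  rw [map_one]; rfl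

lemma counit_one : C.counit 1 = 1 := by
  change C.σ 1 1 = 1
  rw [map_one C.σ]; rfl

lemma comul_gen_mul (D : C.gen) (a : A) :
    C.comul (C.gens D * a) = box (C.leibniz D) (C.leibniz D) (C.comul a) := by
  change C.ρ (C.gens D * a) _ = box _ _ (C.ρ a _)
  rw [map_mul, ← ρ_gen]; rfl

lemma counit_gen_mul (D : C.gen) (a : A) : C.counit (C.gens D * a) = C.d D (C.counit a) := by
  change C.σ (C.gens D * a) _ = C.d D (C.σ a _)
  rw [map_mul, ← σ_gen]; rfl

lemma comm_comul (a : A) : TensorProduct.comm R A A (C.comul a) = C.comul a := by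
  induction a using C.induction with
  | h_one => rw [comul_one, TensorProduct.comm_tmul]
  | h_add a b ha hb => rw [map_add, map_add, ha, hb]
  | h_smul r a ha => rw [map_smul, map_smul, ha]
  | h_gen D a ha => rw [comul_gen_mul, comm_box, ha]

lemma lid_rTensor_counit_box (D : C.gen) (t : A ⊗[R] A) :
    TensorProduct.lid R A (C.counit.rTensor A (box (C.leibniz D) (C.leibniz D) t)) =
      C.gens D * TensorProduct.lid R A (C.counit.rTensor A t) := by
  induction t with
  | zero => simp
  | add s t hs ht => simp only [map_add, hs, ht, mul_add]
  | tmul a b =>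
    have := C.leibniz D (C.counit a) b
    simp only [LinearMap.mulLeft_apply] at this
    simp only [box_tmul, map_add, LinearMap.rTensor_tmul, TensorProduct.lid_tmul,
      LinearMap.mulLeft_apply, counit_gen_mul, this]
    abel

lemma lid_rTensor_counit_comul (a : A) :
    TensorProduct.lid R A (C.counit.rTensor A (C.comul a)) = a := by
  induction a using C.induction with
  | h_one => simp [comul_one, counit_one]
  | h_add a b ha hb => simp only [map_add, ha, hb]
  | h_smul r a ha => simp only [map_smul, ha]
  | h_gen D a ha => rw [comul_gen_mul, lid_rTensor_counit_box, ha]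

lemma rTensor_comul_box (D : C.gen) (t : A ⊗[R] A) :
    C.comul.rTensor A (box (C.leibniz D) (C.leibniz D) t) =
      box (isLeibniz_box (C.leibniz D) (C.leibniz D)) (C.leibniz D) (C.comul.rTensor A t) := by
  induction t with
  | zero => simp
  | add s t hs ht => simp only [map_add, hs, ht]
  | tmul a b =>
    simp only [box_tmul, map_add, LinearMap.rTensor_tmul, LinearMap.mulLeft_apply, comul_gen_mul]

lemma lTensor_comul_box (D : C.gen) (t : A ⊗[R] A) :
    C.comul.lTensor A (box (C.leibniz D) (C.leibniz D) t) =
      box (C.leibniz D) (isLeibniz_box (C.leibniz D) (C.leibniz D)) (C.comul.lTensor A t) := by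
  induction t with
  | zero => simp
  | add s t hs ht => simp only [map_add, hs, ht]
  | tmul a b =>
    simp only [box_tmul, map_add, LinearMap.lTensor_tmul, LinearMap.mulLeft_apply, comul_gen_mul]

lemma coassoc (a : A) :
    TensorProduct.assoc R A A A (C.comul.rTensor A (C.comul a)) =
      C.comul.lTensor A (C.comul a) := by
  induction a using C.induction with
  | h_one => simp [comul_one]
  | h_add a b ha hb => simp only [map_add, ha, hb]
  | h_smul r a ha => simp only [map_smul, ha]
  | h_gen D a ha => rw [comul_gen_mul, rTensor_comul_box, assoc_box, ha, lTensor_comul_box]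

/-- The coalgebra structure. -/
@[reducible]
def coalgebra : Coalgebra R A where
  comul := C.comul
  counit := C.counit
  coassoc := LinearMap.ext C.coassoc
  rTensor_counit_comp_comul := LinearMap.ext fun a => by
    apply (TensorProduct.lid R A).injective
    simpa using C.lid_rTensor_counit_comul a
  lTensor_counit_comp_comul := LinearMap.ext fun a => by
    apply (TensorProduct.rid R A).injective
    have h : ∀ t : A ⊗[R] A, TensorProduct.rid R A (C.counit.lTensor A t) =
        TensorProduct.lid R A (C.counit.rTensor A (TensorProduct.comm R A A t)) := by
      intro t
      induction t with
      | zero => simp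
      | add s t hs ht => simp only [map_add, hs, ht]
      | tmul a b => simp
    have := h (C.comul a)
    rw [comm_comul, lid_rTensor_counit_comul] at this
    simpa using this

lemma ρ_rmul (a c d : A) (t : A ⊗[R] A) : C.ρ a (rmul R c d t) = rmul R c d (C.ρ a t) := by
  induction a using C.induction generalizing t with
  | h_one => rw [map_one]; rfl
  | h_add a b ha hb => simp only [map_add, LinearMap.add_apply, ha, hb]
  | h_smul r a ha => simp only [ρ_smul, map_smul, ha]
  | h_gen D a ha =>
    rw [map_mul, Module.End.mul_apply, Module.End.mul_apply, ha, ρ_gen]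
    generalize C.ρ a t = t
    induction t with
    | zero => simp
    | add s t hs ht => simp only [map_add, hs, ht]
    | tmul a b => simp [rmul, box_tmul, mul_assoc]

lemma ρ_tmul (a c d : A) : C.ρ a (c ⊗ₜ d) = rmul R c d (C.comul a) := by
  change _ = rmul R c d (C.ρ a _)
  rw [← ρ_rmul]
  simp [rmul]

lemma isRBialgebra :
    letI := C.coalgebra
    IsRBialgebra R A :=
  letI := C.coalgebra
  { comm_comp_comul := LinearMap.ext C.comm_comul
    comul_mem := fun a r => by
      change rmul R _ _ (C.comul a) = rmul R _ _ (C.comul a)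
      rw [← ρ_tmul, ← ρ_tmul, TensorProduct.smul_tmul]
    comul_one := C.comul_one
    counit_one := C.counit_one
    comul_mul := fun a b n c d h => by
      change C.comul (a * b) = ∑ i, rmul R (c i) (d i) (C.comul a)
      have h' : C.ρ b (1 ⊗ₜ 1) = ∑ i, c i ⊗ₜ[R] d i := h
      have e : C.comul (a * b) = C.ρ a (C.ρ b (1 ⊗ₜ 1)) := by
        change C.ρ (a * b) _ = _
        rw [map_mul]; rfl
      rw [e, h', map_sum]
      exact Finset.sum_congr rfl fun i _ => C.ρ_tmul _ _ _
    counit_mul := fun a b => by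
      change C.counit (a * b) = C.counit (a * (C.counit b • (1 : A)))
      have e : ∀ b, C.counit (a * b) = C.σ a (C.counit b) := fun b => by
        change C.σ (a * b) _ = _
        rw [map_mul]; rfl
      rw [e, e, map_smul, counit_one, smul_eq_mul, mul_one] }

end CoalgData

end Generated

/-! ### Sheafification -/

section Sheafification

variable {K : Type u} [Field K] {X : TopCat.{u}} (P Q : X.Presheaf (AlgCat.{u} K))

/-- The sections over `U` of the sheafification of `P`: families of elements of the stalks which
are locally given by sections of `P`. -/
def shfSec (U : Opens X) : Subalgebra K (∀ y : U, Stalk P y.1) where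
  carrier := {s | IsLocallySection P s}
  algebraMap_mem' k x := ⟨U, x.2, le_rfl, algebraMap K _ k, fun y hy => by
    rw [AlgHom.commutes]; rfl⟩
  add_mem' {s t} hs ht x := by
    obtain ⟨V, hx, hV, a, ha⟩ := hs x
    obtain ⟨W, hx', hW, b, hb⟩ := ht x
    refine ⟨V ⊓ W, ⟨hx, hx'⟩, inf_le_left.trans hV,
      res P inf_le_left a + res P inf_le_right b, fun y hy => ?_⟩
    rw [map_add, germ_res, germ_res, ← ha y hy.1, ← hb y hy.2]
    rfl
  mul_mem' {s t} hs ht x := by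
    obtain ⟨V, hx, hV, a, ha⟩ := hs x
    obtain ⟨W, hx', hW, b, hb⟩ := ht x
    refine ⟨V ⊓ W, ⟨hx, hx'⟩, inf_le_left.trans hV,
      res P inf_le_left a * res P inf_le_right b, fun y hy => ?_⟩
    rw [map_mul, germ_res, germ_res, ← ha y hy.1, ← hb y hy.2]
    rfl

variable {P} in
/-- Restriction of sections of the sheafification. -/
def shfRes {U V : Opens X} (h : V ≤ U) : shfSec P U →ₐ[K] shfSec P V where
  toFun s := ⟨fun y => s.1 ⟨y.1, h y.2⟩, fun x => by
    obtain ⟨W, hx, hW, a, ha⟩ := s.2 ⟨x.1, h x.2⟩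
    refine ⟨W ⊓ V, ⟨hx, x.2⟩, inf_le_right, res P inf_le_left a, fun y hy => ?_⟩
    rw [germ_res, ← ha y hy.1]⟩
  map_one' := rfl
  map_mul' _ _ := rfl
  map_zero' := rfl
  map_add' _ _ := rfl
  commutes' _ := rfl

/-- The sheafification of a presheaf of algebras. -/
def shf : X.Presheaf (AlgCat.{u} K) where
  obj U := AlgCat.of K (shfSec P U.unop)
  map i := AlgCat.ofHom (shfRes (leOfHom i.unop))
  map_id _ := rfl
  map_comp _ _ := rfl

/-- The value at `y` of a section of the sheafification. -/
def val {U : Opens X} (s : Sec (shf P) U) (y : X) (hy : y ∈ U) : Stalk P y :=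
  Subtype.val (p := fun s => s ∈ shfSec P U) s ⟨y, hy⟩

variable {P} in
lemma val_ext {U : Opens X} {s t : Sec (shf P) U} (h : ∀ y hy, val P s y hy = val P t y hy) :
    s = t :=
  Subtype.ext (funext fun y => h y.1 y.2)

lemma val_res {U V : Opens X} (h : V ≤ U) (s : Sec (shf P) U) (y : X) (hy : y ∈ V) :
    val P (res (shf P) h s) y hy = val P s y (h hy) := rfl

lemma shf_isSheaf : (shf P).IsSheaf := by
  refine (TopCat.Presheaf.isSheaf_iff_isSheafUniqueGluing _).2 fun ι W s hs => ?_
  have hs' : ∀ i j y (hi : y ∈ W i) (hj : y ∈ W j), val P (s i) y hi = val P (s j) y hj :=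
    fun i j y hi hj => congrArg (fun t : Sec (shf P) (W i ⊓ W j) => val P t y ⟨hi, hj⟩) (hs i j)
  choose c hc using fun y : (iSup W : Opens X) => Opens.mem_iSup.1 y.2
  refine ⟨(⟨fun y => val P (s (c y)) y.1 (hc y), fun x => ?_⟩ : shfSec P (iSup W)), fun i => ?_,
    fun t ht => ?_⟩
  · obtain ⟨V, hx, hV, a, ha⟩ := (s (c x) : shfSec P (W (c x))).2 ⟨x.1, hc x⟩
    exact ⟨V, hx, hV.trans (le_iSup W _), a, fun y hy => (hs' _ _ _ _ (hV hy)).trans (ha y hy)⟩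
  · exact val_ext fun y hy => hs' _ _ _ _ _
  · refine val_ext fun y hy => ?_
    obtain rfl := funext fun i => (ht i).symm
    rfl

/-- The canonical morphism to the sheafification. -/
def toShf : P ⟶ shf P where
  app U := AlgCat.ofHom
    { toFun := fun a => (⟨fun y => germ P y.1 y.2 a,
        fun x => ⟨U.unop, x.2, le_rfl, a, fun _ _ => rfl⟩⟩ : shfSec P U.unop)
      map_one' := Subtype.ext (funext fun y => map_one _)
      map_mul' := fun a b => Subtype.ext (funext fun y => map_mul _ a b)
      map_zero' := Subtype.ext (funext fun y => map_zero _)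
      map_add' := fun a b => Subtype.ext (funext fun y => map_add _ a b)
      commutes' := fun k => Subtype.ext (funext fun y => AlgHom.commutes _ k) }
  naturality U V i := by
    ext a
    exact val_ext fun y hy => germ_res P (leOfHom i.unop) y hy a

lemma val_toShf {U : Opens X} (a : Sec P U) (y : X) (hy : y ∈ U) :
    val P (onSec (toShf P) U a) y hy = germ P y hy a := rfl

/-- Evaluation of germs of sections of the sheafification. -/
def ev (x : X) : Stalk (shf P) x →+* Stalk P x :=
  stalkLift (fun _ hx =>
    { toFun := fun s => val P s x hx
      map_one' := rfl
      map_mul' := fun _ _ => rfl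
      map_zero' := rfl
      map_add' := fun _ _ => rfl }) fun _ _ _ _ _ => rfl

lemma ev_germ {U : Opens X} (x : X) (hx : x ∈ U) (s : Sec (shf P) U) :
    ev P x (germ (shf P) x hx s) = val P s x hx := rfl

lemma ev_onStalk (x : X) (a : Stalk P x) : ev P x (onStalk (toShf P) x a) = a := by
  obtain ⟨U, hx, a, rfl⟩ := exists_germ _ a
  rfl

lemma exists_local {U : Opens X} (s : Sec (shf P) U) (x : X) (hx : x ∈ U) :
    ∃ (V : Opens X) (_ : x ∈ V) (hV : V ≤ U) (a : Sec P V),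
      res (shf P) hV s = onSec (toShf P) V a := by
  obtain ⟨V, hx, hV, a, ha⟩ := (s : shfSec P U).2 ⟨x, hx⟩
  exact ⟨V, hx, hV, a, val_ext fun y hy => ha y hy⟩

lemma onStalk_surjective (x : X) : Function.Surjective (onStalk (toShf P) x) := fun s => by
  obtain ⟨U, hx, s, rfl⟩ := exists_germ _ s
  obtain ⟨V, hx', hV, a, ha⟩ := exists_local P s x hx
  exact ⟨germ P x hx' a, by rw [onStalk_germ, ← ha, germ_res]⟩

variable {P Q} in
/-- The morphism of sheafifications induced by a morphism of presheaves. -/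
def shfMap (ψ : P ⟶ Q) : shf P ⟶ shf Q where
  app U := AlgCat.ofHom
    { toFun := fun s : shfSec P U.unop => (⟨fun y => onStalk ψ y.1 (s.1 y), fun x => by
        obtain ⟨V, hx, hV, a, ha⟩ := s.2 x
        exact ⟨V, hx, hV, onSec ψ V a, fun y hy => congrArg (onStalk ψ y) (ha y hy)⟩⟩ :
        shfSec Q U.unop)
      map_one' := Subtype.ext (funext fun y => map_one _)
      map_mul' := fun a b => Subtype.ext (funext fun y => map_mul _ _ _)
      map_zero' := Subtype.ext (funext fun y => map_zero _)
      map_add' := fun a b => Subtype.ext (funext fun y => map_add _ _ _)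
      commutes' := fun k => Subtype.ext (funext fun y => AlgHom.commutes _ k) }
  naturality U V i := rfl

lemma toShf_shfMap (ψ : P ⟶ Q) : toShf P ≫ shfMap ψ = ψ ≫ toShf Q := by
  ext U a
  exact val_ext fun y hy => onStalk_germ ψ y hy a

lemma shfMap_id : shfMap (𝟙 P) = 𝟙 (shf P) := by
  ext U s
  refine val_ext fun y hy => ?_
  obtain ⟨V, hx, a, ha⟩ := exists_germ _ (val P s y hy)
  change onStalk (𝟙 P) y (val P s y hy) = val P s y hy
  rw [← ha]
  rfl

variable {P Q} in
lemma shfMap_comp {T : X.Presheaf (AlgCat.{u} K)} (ψ : P ⟶ Q) (χ : Q ⟶ T) :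
    shfMap (ψ ≫ χ) = shfMap ψ ≫ shfMap χ := by
  ext U s
  refine val_ext fun y hy => ?_
  obtain ⟨V, hx, a, ha⟩ := exists_germ _ (val P s y hy)
  change onStalk (ψ ≫ χ) y (val P s y hy) = onStalk χ y (onStalk ψ y (val P s y hy))
  rw [← ha]
  rfl

end Sheafification

/-! ### The universal enveloping algebroid -/

section Envelope

variable {K : Type u} [Field K] {X : TopCat.{u}}

lemma exists_germ_le (F : X.Presheaf (AlgCat.{u} K)) {x : X} (V : Opens X) (hV : x ∈ V)
    (s : Stalk F x) : ∃ (W : Opens X) (hx : x ∈ W) (_ : W ≤ V) (a : Sec F W),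
      germ F x hx a = s := by
  obtain ⟨W, hx, a, rfl⟩ := exists_germ F s
  exact ⟨W ⊓ V, ⟨hx, hV⟩, inf_le_right, res F inf_le_left a, germ_res _ _ _ _ _⟩

lemma exists_germ_le₂ (F : X.Presheaf (AlgCat.{u} K)) {x : X} (V : Opens X) (hV : x ∈ V)
    (s t : Stalk F x) : ∃ (W : Opens X) (hx : x ∈ W) (_ : W ≤ V) (a b : Sec F W),
      germ F x hx a = s ∧ germ F x hx b = t := by
  obtain ⟨W, hx, h, a, rfl⟩ := exists_germ_le F V hV s
  obtain ⟨W', hx', h', b, rfl⟩ := exists_germ_le F W hx t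
  exact ⟨W', hx', h'.trans h, res F h' a, b, germ_res _ _ _ _ _, rfl⟩

variable {O : X.Sheaf (CommAlgCat.{u} K)}

instance (A : ExtAlg O) (x : X) : SMulCommClass (OStalk O x) K (A.Stalk x) where
  smul_comm f k a := mul_smul_comm k (A.ηx x f) a

instance (A : ExtAlg O) (x : X) : IsScalarTower K (OStalk O x) (A.Stalk x) where
  smul_assoc k f a := by
    rw [ExtAlg.stalk_smul_def, ExtAlg.stalk_smul_def, map_smul, smul_mul_assoc]

namespace LieAlgebroid

variable (L M N : LieAlgebroid O)

/-- The restriction map of universal enveloping algebras. -/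
def envRes {U V : Opens X} (h : V ≤ U) :
    Env K (OSec O U) (L.Sec U) →ₐ[K] Env K (OSec O V) (L.Sec V) :=
  Env.lift (Env.η.comp (LieAlgd.res (oPre O) h)) (Env.δ.comp (L.res h))
    (fun D E => by simp [res_lie, Env.δ_lie])
    (fun f D => by simp [res_smul, Env.δ_smul])
    (fun D f => by simp [res_anchor, Env.δ_mul_η])

lemma envRes_η {U V : Opens X} (h : V ≤ U) (f : OSec O U) :
    L.envRes h (Env.η f) = Env.η (LieAlgd.res (oPre O) h f) := Env.lift_η _ _ _ _ _ f

lemma envRes_δ {U V : Opens X} (h : V ≤ U) (D : L.Sec U) :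
    L.envRes h (Env.δ D) = Env.δ (L.res h D) := Env.lift_δ _ _ _ _ _ D

lemma envRes_self {U : Opens X} (h : U ≤ U) (a : Env K (OSec O U) (L.Sec U)) :
    L.envRes h a = a := by
  induction a using Env.induction with
  | h_one => rw [map_one]
  | h_add a b ha hb => rw [map_add, ha, hb]
  | h_η f a ha => rw [map_mul, ha, envRes_η, LieAlgd.res_self]
  | h_δ D a ha => rw [map_mul, ha, envRes_δ, res_self]

lemma envRes_res {U V W : Opens X} (h : V ≤ U) (h' : W ≤ V) (a : Env K (OSec O U) (L.Sec U)) :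
    L.envRes h' (L.envRes h a) = L.envRes (h'.trans h) a := by
  induction a using Env.induction with
  | h_one => rw [map_one, map_one, map_one]
  | h_add a b ha hb => rw [map_add, map_add, map_add, ha, hb]
  | h_η f a ha =>
    rw [map_mul, map_mul, map_mul, ha, envRes_η, envRes_η, envRes_η, LieAlgd.res_res]
  | h_δ D a ha => rw [map_mul, map_mul, map_mul, ha, envRes_δ, envRes_δ, envRes_δ, res_res]

/-- The presheaf `U ↦ U(O(U), L(U))` of universal enveloping algebras. -/
def envPre : X.Presheaf (AlgCat.{u} K) where
  obj U := AlgCat.of K (Env K (OSec O U.unop) (L.Sec U.unop))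
  map i := AlgCat.ofHom (L.envRes (leOfHom i.unop))
  map_id U := by
    refine ConcreteCategory.hom_ext _ _ fun a => ?_
    exact L.envRes_self (U := U.unop) le_rfl a
  map_comp i j := by
    refine ConcreteCategory.hom_ext _ _ fun a => ?_
    exact (L.envRes_res (leOfHom i.unop) (leOfHom j.unop) a).symm

/-- The canonical morphism from the structure sheaf. -/
def envUnit : oPre O ⟶ L.envPre where
  app U := AlgCat.ofHom (A := OSec O U.unop) (Env.η : OSec O U.unop →ₐ[K] _)
  naturality U V i := by
    refine ConcreteCategory.hom_ext _ _ fun f => ?_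
    exact (L.envRes_η (U := U.unop) (V := V.unop) (leOfHom i.unop) f).symm

/-- The sheafification of the presheaf of universal enveloping algebras. -/
def envAlg : ExtAlg O where
  presheaf := shf L.envPre
  isSheaf := shf_isSheaf _
  unit := L.envUnit ≫ toShf _

variable {L} in
/-- The class of an element of `U(O(U), L(U))`. -/
def cl {U : Opens X} : Env K (OSec O U) (L.Sec U) →ₐ[K] L.envAlg.Sec U := onSec (toShf L.envPre) U

lemma cl_η {U : Opens X} (f : OSec O U) : cl (Env.η f) = L.envAlg.η U f := rfl

lemma res_cl {U V : Opens X} (h : V ≤ U) (a : Env K (OSec O U) (L.Sec U)) :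
    L.envAlg.res h (cl a) = cl (L.envRes h a) := (onSec_res (toShf L.envPre) h a).symm

/-- The canonical map `L → 𝒰(L)` on sections. -/
def ι {U : Opens X} : L.Sec U →+ L.envAlg.Sec U := (cl : _ →ₐ[K] _).toRingHom.toAddMonoidHom.comp Env.δ

lemma cl_δ {U : Opens X} (D : L.Sec U) : cl (Env.δ D) = L.ι D := rfl

lemma res_ι {U V : Opens X} (h : V ≤ U) (D : L.Sec U) :
    L.envAlg.res h (L.ι D) = L.ι (L.res h D) := by
  rw [← cl_δ, res_cl, envRes_δ, cl_δ]

lemma ι_lie {U : Opens X} (D E : L.Sec U) : L.ι ⁅D, E⁆ = L.ι D * L.ι E - L.ι E * L.ι D := by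
  simp only [← cl_δ, Env.δ_lie, map_sub, map_mul]

lemma ι_smul {U : Opens X} (f : OSec O U) (D : L.Sec U) :
    L.ι (f • D) = L.envAlg.η U f * L.ι D := by
  simp only [← cl_δ, ← cl_η, Env.δ_smul, map_mul]

lemma ι_mul_η {U : Opens X} (D : L.Sec U) (f : OSec O U) :
    L.ι D * L.envAlg.η U f = L.envAlg.η U f * L.ι D + L.envAlg.η U ⁅D, f⁆ := by
  simp only [← cl_δ, ← cl_η, ← map_mul, Env.δ_mul_η, map_add]

/-- The germ at `x` of the section of `𝒰(L)` defined by a section of `L`. -/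
def ιx {x : X} {V : Opens X} (hx : x ∈ V) : L.Sec V →+ L.envAlg.Stalk x :=
  (L.envAlg.germ x hx).toRingHom.toAddMonoidHom.comp L.ι

lemma ιx_res {x : X} {V W : Opens X} (h : W ≤ V) (hx : x ∈ W) (D : L.Sec V) :
    L.ιx hx (L.res h D) = L.ιx (h hx) D := by
  change L.envAlg.germ x hx (L.ι _) = L.envAlg.germ x _ (L.ι D)
  rw [← res_ι, LieAlgd.germ_res]

lemma germ_η {x : X} {V : Opens X} (hx : x ∈ V) (f : OSec O V) :
    L.envAlg.germ x hx (L.envAlg.η V f) = L.envAlg.ηx x (LieAlgd.germ (oPre O) x hx f) := rfl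

variable {L} in
lemma env_induction {x : X} {p : L.envAlg.Stalk x → Prop} (h_one : p 1)
    (h_add : ∀ a b, p a → p b → p (a + b)) (h_smul : ∀ (r : OStalk O x) a, p a → p (r • a))
    (h_ι : ∀ (V : Opens X) (hx : x ∈ V) (D : L.Sec V) a, p a → p (L.ιx hx D * a))
    (a : L.envAlg.Stalk x) : p a := by
  obtain ⟨a, rfl⟩ := onStalk_surjective L.envPre x a
  obtain ⟨V, hx, a, rfl⟩ := LieAlgd.exists_germ _ a
  change p (L.envAlg.germ x hx (cl a))
  induction a using Env.induction with
  | h_one => rwa [map_one, map_one]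
  | h_add a b ha hb => rw [map_add, map_add]; exact h_add _ _ ha hb
  | h_η f a ha =>
    rw [map_mul, map_mul, cl_η, germ_η, ← ExtAlg.stalk_smul_def]
    exact h_smul _ _ ha
  | h_δ D a ha =>
    rw [map_mul, map_mul]
    exact h_ι V hx D _ ha

lemma anchor_smul {W : Opens X} (D : L.Sec W) (k : K) (f : OSec O W) :
    ⁅D, k • f⁆ = k • ⁅D, f⁆ := lie_smul k D f

/-- The map of the stalk of `O` defined by a section of `L`. -/
def derFun {x : X} {V : Opens X} (hV : x ∈ V) (D : L.Sec V) : OStalk O x → OStalk O x :=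
  DirectLimit.lift (fun V W h => LieAlgd.res (oPre O) (U := V.1) (V := W.1) h)
    (fun (W : Nbhd x) (f : OSec O W.1) => LieAlgd.germ (oPre O) x (U := W.1 ⊓ V) ⟨W.2, hV⟩
      ⁅L.res inf_le_right D, LieAlgd.res (oPre O) inf_le_left f⁆) (by
    intro W W' h f
    have h' : W'.1 ⊓ V ≤ W.1 ⊓ V := inf_le_inf_right V h
    rw [← LieAlgd.germ_res _ h' x ⟨W'.2, hV⟩, res_anchor, res_res, LieAlgd.res_res,
      LieAlgd.res_res])

lemma derFun_germ {x : X} {V W : Opens X} (h : W ≤ V) (hx : x ∈ W) (D : L.Sec V) (f : OSec O W) :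
    L.derFun (h hx) D (LieAlgd.germ (oPre O) x hx f) =
      LieAlgd.germ (oPre O) x hx ⁅L.res h D, f⁆ := by
  have h' : W ≤ W ⊓ V := le_inf le_rfl h
  change LieAlgd.germ (oPre O) x (U := W ⊓ V) ⟨hx, h hx⟩
      ⁅L.res (inf_le_right : W ⊓ V ≤ V) D,
        LieAlgd.res (oPre O) (inf_le_left : W ⊓ V ≤ W) f⁆ = _
  rw [← LieAlgd.germ_res _ h' x hx, res_anchor, res_res, LieAlgd.res_res, LieAlgd.res_self]

/-- The derivation of the stalk of `O` defined by a section of `L`. -/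
def der {x : X} {V : Opens X} (hV : x ∈ V) (D : L.Sec V) : OStalk O x →ₗ[K] OStalk O x where
  toFun := L.derFun hV D
  map_add' r s := by
    obtain ⟨W, hx, h, f, g, rfl, rfl⟩ := exists_germ_le₂ _ V hV r s
    rw [← map_add, L.derFun_germ h hx, L.derFun_germ h hx, L.derFun_germ h hx, lie_add, map_add]
  map_smul' k r := by
    obtain ⟨W, hx, h, f, rfl⟩ := exists_germ_le _ V hV r
    rw [← map_smul, L.derFun_germ h hx, L.derFun_germ h hx, anchor_smul, map_smul,
      RingHom.id_apply]

lemma der_germ {x : X} {V W : Opens X} {hV : x ∈ V} (h : W ≤ V) (hx : x ∈ W) (D : L.Sec V)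
    (f : OSec O W) : L.der hV D (LieAlgd.germ (oPre O) x hx f) =
      LieAlgd.germ (oPre O) x hx ⁅L.res h D, f⁆ := L.derFun_germ h hx D f

lemma isLeibniz_der {x : X} {V : Opens X} (hV : x ∈ V) (D : L.Sec V) :
    IsLeibniz (M := OStalk O x) (L.der hV D) (L.der hV D) := fun r s => by
  obtain ⟨W, hx, h, f, g, rfl, rfl⟩ := exists_germ_le₂ _ V hV r s
  rw [smul_eq_mul, smul_eq_mul, smul_eq_mul, ← map_mul, L.der_germ h hx, L.der_germ h hx, L.der_germ h hx, ← map_mul,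
    ← map_mul, ← map_add, LieRinehartRing.leibniz_mul_right]
  rfl

lemma der_one {x : X} {V : Opens X} (hV : x ∈ V) (D : L.Sec V) : L.der hV D 1 = 0 := by
  have := L.isLeibniz_der hV D 1 1
  simpa using this

lemma der_add {x : X} {V : Opens X} (hV : x ∈ V) (D E : L.Sec V) :
    L.der hV (D + E) = L.der hV D + L.der hV E := by
  ext r
  obtain ⟨W, hx, h, f, rfl⟩ := exists_germ_le _ V hV r
  rw [LinearMap.add_apply, L.der_germ h hx, L.der_germ h hx, L.der_germ h hx, map_add, add_lie, map_add]

lemma der_lie {x : X} {V : Opens X} (hV : x ∈ V) (D E : L.Sec V) :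
    L.der hV ⁅D, E⁆ = L.der hV D * L.der hV E - L.der hV E * L.der hV D := by
  ext r
  obtain ⟨W, hx, h, f, rfl⟩ := exists_germ_le _ V hV r
  rw [LinearMap.sub_apply, Module.End.mul_apply, Module.End.mul_apply]
  simp only [L.der_germ h hx]
  rw [res_lie, lie_lie, map_sub]

lemma der_smul {x : X} {V : Opens X} (hV : x ∈ V) (f : OSec O V) (D : L.Sec V) (r : OStalk O x) :
    L.der hV (f • D) r = LieAlgd.germ (oPre O) x hV f * L.der hV D r := by
  obtain ⟨W, hx, h, g, rfl⟩ := exists_germ_le _ V hV r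
  rw [L.der_germ h hx, L.der_germ h hx, res_smul, LieRinehartRing.lie_smul_eq_mul, map_mul, LieAlgd.germ_res]

lemma der_res {x : X} {V W : Opens X} (h : W ≤ V) (hx : x ∈ W) (D : L.Sec V) :
    L.der hx (L.res h D) = L.der (h hx) D := by
  ext r
  obtain ⟨W', hx', h', f, rfl⟩ := exists_germ_le _ W hx r
  rw [L.der_germ h', L.der_germ (h'.trans h), res_res]

lemma isLeibniz_ιx {x : X} {V : Opens X} (hV : x ∈ V) (D : L.Sec V) :
    IsLeibniz (L.der hV D) (LinearMap.mulLeft K (L.ιx hV D)) := fun r a => by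
  obtain ⟨W, hx, h, f, rfl⟩ := exists_germ_le _ V hV r
  rw [L.der_germ h hx, LinearMap.mulLeft_apply, LinearMap.mulLeft_apply, ← L.ιx_res h hx]
  simp only [ExtAlg.stalk_smul_def]
  rw [← mul_assoc, ← mul_assoc, ← add_mul, ← germ_η, ← germ_η]
  congr 1
  change L.envAlg.germ x hx (L.ι (L.res h D)) * _ = _ * L.envAlg.germ x hx (L.ι (L.res h D)) + _
  rw [← map_mul, ι_mul_η, map_add, map_mul]

end LieAlgebroid

end Envelope

section EnvelopeBialgebra

variable {K : Type u} [Field K] {X : TopCat.{u}} {O : X.Sheaf (CommAlgCat.{u} K)}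

namespace LieAlgebroid

variable (L M N : LieAlgebroid O)

section Action

variable {L} {x : X} {T : Type u} [AddCommGroup T] [Module (OStalk O x) T] [Module K T]
  [IsScalarTower K (OStalk O x) T] [SMulCommClass (OStalk O x) K T]
  (θ : ∀ (V : Opens X), x ∈ V → L.Sec V → Module.End K T)
  (h_add : ∀ V hV D E, θ V hV (D + E) = θ V hV D + θ V hV E)
  (h_lie : ∀ V hV D E, θ V hV ⁅D, E⁆ = θ V hV D * θ V hV E - θ V hV E * θ V hV D)
  (h_smul : ∀ V hV (f : OSec O V) D t,
    θ V hV (f • D) t = LieAlgd.germ (oPre O) x hV f • θ V hV D t)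
  (h_leib : ∀ V hV D, IsLeibniz (L.der hV D) (θ V hV D))
  (h_res : ∀ V W (h : W ≤ V) (hx : x ∈ W) D, θ W hx (L.res h D) = θ V (h hx) D)

/-- An action of the sections of `L` near `x` extends to the universal enveloping algebras. -/
def actSec (V : Opens X) (hV : x ∈ V) : Env K (OSec O V) (L.Sec V) →ₐ[K] Module.End K T :=
  Env.lift ((Algebra.lsmul K K T).comp (LieAlgd.germ (oPre O) x hV))
    (AddMonoidHom.mk' (θ V hV) (h_add V hV)) (fun D E => by exact h_lie V hV D E)
    (fun f D => LinearMap.ext fun t => by exact h_smul V hV f D t)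
    (fun D f => LinearMap.ext fun t => by
      have h : L.der hV D (LieAlgd.germ (oPre O) x hV f) = LieAlgd.germ (oPre O) x hV ⁅D, f⁆ := by
        rw [L.der_germ le_rfl hV, res_self]
      have := h_leib V hV D (LieAlgd.germ (oPre O) x hV f) t
      rw [h] at this
      exact this)

/-- An action of the sections of `L` near `x` extends to the stalk of `𝒰(L)`. -/
def act : L.envAlg.Stalk x →+* Module.End K T :=
  (stalkLift (fun V hV => (actSec θ h_add h_lie h_smul h_leib V hV).toRingHom) (by
    intro U V h hx a
    change actSec θ h_add h_lie h_smul h_leib V hx (L.envRes h a) =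
      actSec θ h_add h_lie h_smul h_leib U (h hx) a
    induction a using Env.induction with
    | h_one => rw [map_one, map_one, map_one]
    | h_add a b ha hb => rw [map_add, map_add, map_add, ha, hb]
    | h_η f a ha =>
      rw [map_mul, map_mul, map_mul, ha, envRes_η]
      congr 1
      refine (Env.lift_η _ _ _ _ _ _).trans (Eq.trans ?_ (Env.lift_η _ _ _ _ _ _).symm)
      exact congrArg (Algebra.lsmul K K T) (LieAlgd.germ_res _ h x hx f)
    | h_δ D a ha =>
      rw [map_mul, map_mul, map_mul, ha, envRes_δ]
      congr 1
      refine (Env.lift_δ _ _ _ _ _ _).trans (Eq.trans ?_ (Env.lift_δ _ _ _ _ _ _).symm)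
      exact h_res U V h hx D)).comp (ev L.envPre x)

lemma act_germ (V : Opens X) (hV : x ∈ V) (a : Env K (OSec O V) (L.Sec V)) :
    act θ h_add h_lie h_smul h_leib h_res (L.envAlg.germ x hV (cl a)) =
      actSec θ h_add h_lie h_smul h_leib V hV a := rfl

lemma act_ιx (V : Opens X) (hV : x ∈ V) (D : L.Sec V) :
    act θ h_add h_lie h_smul h_leib h_res (L.ιx hV D) = θ V hV D :=
  (act_germ θ h_add h_lie h_smul h_leib h_res V hV (Env.δ D)).trans (Env.lift_δ _ _ _ _ _ D)

lemma act_smul (r : OStalk O x) (a : L.envAlg.Stalk x) (t : T) :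
    act θ h_add h_lie h_smul h_leib h_res (r • a) t =
      r • act θ h_add h_lie h_smul h_leib h_res a t := by
  obtain ⟨V, hV, f, rfl⟩ := LieAlgd.exists_germ _ r
  rw [ExtAlg.stalk_smul_def, map_mul, Module.End.mul_apply]
  have h : act θ h_add h_lie h_smul h_leib h_res
      (L.envAlg.ηx x (LieAlgd.germ (oPre O) x hV f)) =
        Algebra.lsmul K K T (LieAlgd.germ (oPre O) x hV f) :=
    (act_germ θ h_add h_lie h_smul h_leib h_res V hV (Env.η f)).trans (Env.lift_η _ _ _ _ _ f)
  rw [h]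
  rfl

end Action

attribute [irreducible] act

/-- The operator `a ⊗ b ↦ D a ⊗ b + a ⊗ D b`. -/
def boxι {x : X} {V : Opens X} (hV : x ∈ V) (D : L.Sec V) :
    Module.End K (L.envAlg.Stalk x ⊗[OStalk O x] L.envAlg.Stalk x) :=
  box (L.isLeibniz_ιx hV D) (L.isLeibniz_ιx hV D)

lemma boxι_tmul {x : X} {V : Opens X} (hV : x ∈ V) (D : L.Sec V) (a b : L.envAlg.Stalk x) :
    L.boxι hV D (a ⊗ₜ b) = (L.ιx hV D * a) ⊗ₜ b + a ⊗ₜ (L.ιx hV D * b) := rfl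

lemma end_ext {x : X} {P Q : Module.End K (L.envAlg.Stalk x ⊗[OStalk O x] L.envAlg.Stalk x)}
    (h : ∀ a b, P (a ⊗ₜ b) = Q (a ⊗ₜ b)) : P = Q := by
  ext t
  induction t with
  | zero => rw [map_zero, map_zero]
  | add s t hs ht => rw [map_add, map_add, hs, ht]
  | tmul a b => exact h a b

lemma ιx_lie {x : X} {V : Opens X} (hV : x ∈ V) (D E : L.Sec V) :
    L.ιx hV ⁅D, E⁆ = L.ιx hV D * L.ιx hV E - L.ιx hV E * L.ιx hV D := by
  change L.envAlg.germ x hV (L.ι _) = L.envAlg.germ x hV (L.ι _) * L.envAlg.germ x hV (L.ι _) -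
    L.envAlg.germ x hV (L.ι _) * L.envAlg.germ x hV (L.ι _)
  rw [ι_lie, map_sub, map_mul, map_mul]

lemma ιx_smul {x : X} {V : Opens X} (hV : x ∈ V) (f : OSec O V) (D : L.Sec V) :
    L.ιx hV (f • D) = LieAlgd.germ (oPre O) x hV f • L.ιx hV D := by
  change L.envAlg.germ x hV (L.ι _) = _ • L.envAlg.germ x hV (L.ι _)
  rw [ι_smul, map_mul]
  rfl

/-- The action of the stalk of `𝒰(L)` on the tensor product of two copies of itself. -/
def ρx (x : X) : L.envAlg.Stalk x →+*
    Module.End K (L.envAlg.Stalk x ⊗[OStalk O x] L.envAlg.Stalk x) :=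
  act (fun _ hV D => L.boxι hV D)
    (fun V hV D E => L.end_ext fun a b => by
      rw [LinearMap.add_apply, boxι_tmul, boxι_tmul, boxι_tmul, map_add, add_mul, add_mul,
        TensorProduct.add_tmul, TensorProduct.tmul_add]
      abel)
    (fun V hV D E => L.end_ext fun a b => by
      rw [LinearMap.sub_apply, Module.End.mul_apply, Module.End.mul_apply]
      simp only [boxι_tmul, ιx_lie, map_add, sub_mul, TensorProduct.sub_tmul,
        TensorProduct.tmul_sub, mul_assoc]
      abel)
    (fun V hV f D t => by
      induction t with
      | zero => rw [map_zero, map_zero, smul_zero]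
      | add s t hs ht => rw [map_add, map_add, hs, ht, smul_add]
      | tmul a b =>
        rw [boxι_tmul, boxι_tmul, ιx_smul, smul_mul_assoc, smul_mul_assoc, smul_add,
          TensorProduct.smul_tmul', TensorProduct.tmul_smul])
    (fun V hV D => isLeibniz_box _ _)
    (fun V W h hx D => L.end_ext fun a b => by rw [boxι_tmul, boxι_tmul, ιx_res])

lemma ρx_ιx {x : X} {V : Opens X} (hV : x ∈ V) (D : L.Sec V) :
    L.ρx x (L.ιx hV D) = L.boxι hV D := act_ιx _ _ _ _ _ _ V hV D

lemma ρx_smul {x : X} (r : OStalk O x) (a : L.envAlg.Stalk x)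
    (t : L.envAlg.Stalk x ⊗[OStalk O x] L.envAlg.Stalk x) : L.ρx x (r • a) t = r • L.ρx x a t :=
  act_smul (fun _ hV D => L.boxι hV D) _ _ _ _ _ r a t

/-- The action of the stalk of `𝒰(L)` on the stalk of `O`. -/
def σx (x : X) : L.envAlg.Stalk x →+* Module.End K (OStalk O x) :=
  act (fun _ hV D => L.der hV D) (fun _ hV D E => L.der_add hV D E)
    (fun _ hV D E => L.der_lie hV D E) (fun _ hV f D r => L.der_smul hV f D r)
    (fun _ hV D => L.isLeibniz_der hV D) (fun _ _ h hx D => L.der_res h hx D)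

lemma σx_ιx {x : X} {V : Opens X} (hV : x ∈ V) (D : L.Sec V) :
    L.σx x (L.ιx hV D) = L.der hV D := act_ιx _ _ _ _ _ _ V hV D

lemma σx_smul {x : X} (r : OStalk O x) (a : L.envAlg.Stalk x) (t : OStalk O x) :
    L.σx x (r • a) t = r * L.σx x a t :=
  act_smul (fun _ hV D => L.der hV D) _ _ _ _ _ r a t

/-- The actions of the stalk of `𝒰(L)` which define the coproduct and the counit. -/
def coalgData (x : X) : CoalgData K (OStalk O x) (L.envAlg.Stalk x) where
  gen := (V : Nbhd x) × L.Sec V.1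
  gens D := L.ιx D.1.2 D.2
  d D := L.der D.1.2 D.2
  d_one D := L.der_one D.1.2 D.2
  leibniz D := L.isLeibniz_ιx D.1.2 D.2
  induction _ h_one h_add h_smul h_gen a :=
    env_induction h_one h_add h_smul (fun V hx D a ha => h_gen ⟨nbhd V hx, D⟩ a ha) a
  ρ := L.ρx x
  ρ_smul r a t := L.ρx_smul r a t
  ρ_gen D := L.ρx_ιx D.1.2 D.2
  σ := L.σx x
  σ_smul r a t := L.σx_smul r a t
  σ_gen D := L.σx_ιx D.1.2 D.2

/-- The coalgebra structure on the stalks of `𝒰(L)`. It is the unique bialgebra structure for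
which the elements of `L` are primitive. -/
instance (x : X) : Coalgebra (OStalk O x) (L.envAlg.Stalk x) := (L.coalgData x).coalgebra

instance (x : X) : IsRBialgebra (OStalk O x) (L.envAlg.Stalk x) := (L.coalgData x).isRBialgebra

lemma comul_ιx_mul {x : X} {V : Opens X} (hx : x ∈ V) (D : L.Sec V) (a : L.envAlg.Stalk x) :
    Coalgebra.comul (R := OStalk O x) (L.ιx hx D * a) =
      L.boxι hx D (Coalgebra.comul (R := OStalk O x) a) :=
  (L.coalgData x).comul_gen_mul ⟨nbhd V hx, D⟩ a

lemma counit_ιx_mul {x : X} {V : Opens X} (hx : x ∈ V) (D : L.Sec V) (a : L.envAlg.Stalk x) :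
    Coalgebra.counit (R := OStalk O x) (L.ιx hx D * a) =
      L.der hx D (Coalgebra.counit (R := OStalk O x) a) :=
  (L.coalgData x).counit_gen_mul ⟨nbhd V hx, D⟩ a

lemma comul_ιx {x : X} {V : Opens X} (hx : x ∈ V) (D : L.Sec V) :
    Coalgebra.comul (R := OStalk O x) (L.ιx hx D) = L.ιx hx D ⊗ₜ 1 + 1 ⊗ₜ L.ιx hx D := by
  rw [← mul_one (L.ιx hx D), comul_ιx_mul, IsRBialgebra.comul_one, boxι_tmul, mul_one]

lemma exists_counit {V : Opens X} (a : Env K (OSec O V) (L.Sec V)) :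
    ∃ f : OSec O V, ∀ (y : X) (hy : y ∈ V), Coalgebra.counit (R := OStalk O y)
      (L.envAlg.germ y hy (cl a)) = LieAlgd.germ (oPre O) y hy f := by
  induction a using Env.induction with
  | h_one => exact ⟨1, fun y hy => by simp only [map_one, IsRBialgebra.counit_one]⟩
  | h_add a b ha hb =>
    obtain ⟨f, hf⟩ := ha
    obtain ⟨g, hg⟩ := hb
    exact ⟨f + g, fun y hy => by simp only [map_add, hf, hg]⟩
  | h_η g a ha =>
    obtain ⟨f, hf⟩ := ha
    refine ⟨g * f, fun y hy => ?_⟩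
    rw [map_mul, map_mul, cl_η, germ_η, ← ExtAlg.stalk_smul_def, LinearMap.map_smul, hf, map_mul]
    rfl
  | h_δ D a ha =>
    obtain ⟨f, hf⟩ := ha
    refine ⟨⁅D, f⁆, fun y hy => ?_⟩
    rw [map_mul, map_mul]
    refine (L.counit_ιx_mul hy D _).trans ?_
    rw [hf, L.der_germ le_rfl hy, res_self]

/-- The element `∑ b ⊗ c` of the stalk for a list of pairs `(b, c)` of sections. -/
def tens {V : Opens X} (l : List (L.envAlg.Sec V × L.envAlg.Sec V)) (y : X) (hy : y ∈ V) :
    L.envAlg.Stalk y ⊗[OStalk O y] L.envAlg.Stalk y :=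
  (l.map fun p => L.envAlg.germ y hy p.1 ⊗ₜ[OStalk O y] L.envAlg.germ y hy p.2).sum

lemma exists_comul {V : Opens X} (a : Env K (OSec O V) (L.Sec V)) :
    ∃ l, ∀ (y : X) (hy : y ∈ V), Coalgebra.comul (R := OStalk O y)
      (L.envAlg.germ y hy (cl a)) = L.tens l y hy := by
  induction a using Env.induction with
  | h_one => exact ⟨[(1, 1)], fun y hy => by simp [tens, IsRBialgebra.comul_one]⟩
  | h_add a b ha hb =>
    obtain ⟨l, hl⟩ := ha
    obtain ⟨m, hm⟩ := hb
    exact ⟨l ++ m, fun y hy => by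
      rw [map_add, map_add, map_add, hl, hm, tens, tens, tens, List.map_append, List.sum_append]⟩
  | h_η g a ha =>
    obtain ⟨l, hl⟩ := ha
    refine ⟨l.map fun p => (L.envAlg.η V g * p.1, p.2), fun y hy => ?_⟩
    rw [map_mul, map_mul, cl_η, germ_η, ← ExtAlg.stalk_smul_def, LinearMap.map_smul, hl]
    clear hl
    induction l with
    | nil => exact smul_zero _
    | cons p l ih =>
      simp only [tens, List.map_cons, List.sum_cons] at ih ⊢
      rw [smul_add, ih, map_mul, germ_η, TensorProduct.smul_tmul', ExtAlg.stalk_smul_def]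
  | h_δ D a ha =>
    obtain ⟨l, hl⟩ := ha
    refine ⟨(l.map fun p => (L.ι D * p.1, p.2)) ++ l.map fun p => (p.1, L.ι D * p.2),
      fun y hy => ?_⟩
    rw [map_mul, map_mul]
    refine (L.comul_ιx_mul hy D _).trans ?_
    rw [hl]
    clear hl
    induction l with
    | nil => exact (map_zero _).trans (by simp [tens])
    | cons p l ih =>
      simp only [tens, List.map_cons, List.map_append, List.sum_append, List.sum_cons] at ih ⊢
      rw [map_add, ih, boxι_tmul, map_mul, map_mul]
      have e : L.envAlg.germ y hy (L.ι D) = L.ιx hy D := rfl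
      rw [e]
      abel

/-- The universal enveloping algebroid of a Lie algebroid. -/
def envBialgebroid : Bialgebroid O where
  alg := L.envAlg
  comul_section {U} a x := by
    obtain ⟨V, hx, hV, b, hb⟩ := exists_local L.envPre a x.1 x.2
    obtain ⟨l, hl⟩ := L.exists_comul b
    refine ⟨V, hx, hV, l.length, fun i => (l.get i).1, fun i => (l.get i).2, fun y hy => ?_⟩
    have e : L.envAlg.germ y (hV hy) a = L.envAlg.germ y hy (cl b) := by
      rw [← LieAlgd.germ_res _ hV y hy]
      exact congrArg _ hb
    change Coalgebra.comul (R := OStalk O y) (L.envAlg.germ y (hV hy) a) = _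
    rw [e, hl, tens]
    exact (Fin.sum_univ_fun_getElem l fun p =>
      L.envAlg.germ y hy p.1 ⊗ₜ[OStalk O y] L.envAlg.germ y hy p.2).symm
  counit_section {U} a x := by
    obtain ⟨V, hx, hV, b, hb⟩ := exists_local L.envPre a x.1 x.2
    obtain ⟨f, hf⟩ := L.exists_counit b
    refine ⟨V, hx, hV, f, fun y hy => ?_⟩
    rw [← hf y hy]
    change Coalgebra.counit (R := OStalk O y) (L.envAlg.germ y (hV hy) a) = _
    rw [← LieAlgd.germ_res _ hV y hy]
    exact congrArg (fun b => Coalgebra.counit (R := OStalk O y) (L.envAlg.germ y hy b)) hb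

end LieAlgebroid

end EnvelopeBialgebra

section EnvelopeFunctor

variable {K : Type u} [Field K] {X : TopCat.{u}} {O : X.Sheaf (CommAlgCat.{u} K)}

namespace LieAlgebroid

variable {L M N : LieAlgebroid O}

/-- The homomorphism of universal enveloping algebras induced by a morphism. -/
def envMap (φ : L ⟶ M) (U : Opens X) :
    Env K (OSec O U) (L.Sec U) →ₐ[K] Env K (OSec O U) (M.Sec U) :=
  Env.lift Env.η (Env.δ.comp (φ.app U).toLieHom.toLinearMap.toAddMonoidHom)
    (fun D E => (congrArg Env.δ ((φ.app U).toLieHom.map_lie D E)).trans (Env.δ_lie _ _))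
    (fun f D => (congrArg Env.δ ((φ.app U).map_smul_apply f D)).trans (Env.δ_smul _ _))
    (fun D f => by
      have h : ⁅D, f⁆ = ⁅φ.app U D, f⁆ := (φ.app U).apply_lie f D
      rw [h]
      exact Env.δ_mul_η (φ.app U D) f)

lemma envMap_η (φ : L ⟶ M) {U : Opens X} (f : OSec O U) : envMap φ U (Env.η f) = Env.η f :=
  Env.lift_η _ _ _ _ _ f

lemma envMap_δ (φ : L ⟶ M) {U : Opens X} (D : L.Sec U) :
    envMap φ U (Env.δ D) = Env.δ (φ.app U D) :=
  Env.lift_δ _ _ _ _ _ D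

/-- The morphism of presheaves of universal enveloping algebras induced by a morphism. -/
def envPreMap (φ : L ⟶ M) : L.envPre ⟶ M.envPre where
  app U := AlgCat.ofHom (envMap φ U.unop)
  naturality U V i := by
    ext a
    change envMap φ V.unop (L.envRes (leOfHom i.unop) a) =
      M.envRes (leOfHom i.unop) (envMap φ U.unop a)
    induction a using Env.induction with
    | h_one => simp only [map_one]
    | h_add a b ha hb => simp only [map_add, ha, hb]
    | h_η f a ha => simp only [map_mul, ha, envRes_η, envMap_η]
    | h_δ D a ha =>
      have h := φ.naturality (leOfHom i.unop) D
      simp only [map_mul, ha, envRes_δ, envMap_δ, h]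

/-- The morphism of sheaves of algebras induced by a morphism. -/
def envAlgMap (φ : L ⟶ M) : ExtAlg.Hom L.envAlg M.envAlg where
  hom := shfMap (envPreMap φ)
  unit_hom := by
    change (L.envUnit ≫ toShf L.envPre) ≫ shfMap (envPreMap φ) = M.envUnit ≫ toShf M.envPre
    rw [Category.assoc, toShf_shfMap, ← Category.assoc]
    congr 1
    ext U f
    exact envMap_η φ f

lemma envAlgMap_stalk_ιx (φ : L ⟶ M) {x : X} {V : Opens X} (hx : x ∈ V) (D : L.Sec V) :
    (envAlgMap φ).stalk x (L.ιx hx D) = M.ιx hx (φ.app V D) := by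
  change M.envAlg.germ x hx (onSec (toShf L.envPre ≫ shfMap (envPreMap φ)) V (Env.δ D)) = _
  rw [toShf_shfMap]
  exact congrArg (fun a => M.envAlg.germ x hx (cl a)) (envMap_δ φ D)

lemma der_map (φ : L ⟶ M) {x : X} {V : Opens X} (hx : x ∈ V) (D : L.Sec V) :
    M.der hx (φ.app V D) = L.der hx D := by
  ext r
  obtain ⟨W, hW, h, f, rfl⟩ := exists_germ_le _ V hx r
  rw [M.der_germ h hW, L.der_germ h hW, ← φ.naturality]
  exact congrArg _ ((φ.app W).apply_lie f (L.res h D)).symm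

/-- The morphism of universal enveloping algebroids induced by a morphism. -/
def envBialgebroidMap (φ : L ⟶ M) : L.envBialgebroid ⟶ M.envBialgebroid where
  map := envAlgMap φ
  counit_comp x := by
    ext a
    change Coalgebra.counit (R := OStalk O x) (A := M.envAlg.Stalk x)
      ((envAlgMap φ).stalk x a) = Coalgebra.counit (R := OStalk O x) (A := L.envAlg.Stalk x) a
    induction a using env_induction with
    | h_one => rw [ExtAlg.Hom.stalk_one, IsRBialgebra.counit_one, IsRBialgebra.counit_one]
    | h_add a b ha hb => rw [map_add, map_add, map_add, ha, hb]
    | h_smul r a ha => rw [map_smul, map_smul, map_smul, ha]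
    | h_ι V hx D a ha =>
      rw [ExtAlg.Hom.stalk_mul, envAlgMap_stalk_ιx, counit_ιx_mul, counit_ιx_mul, ha, der_map]
  comul_comp x := by
    ext a
    change Coalgebra.comul (R := OStalk O x) (A := M.envAlg.Stalk x)
      ((envAlgMap φ).stalk x a) =
        TensorProduct.map ((envAlgMap φ).stalk x) ((envAlgMap φ).stalk x)
          (Coalgebra.comul (R := OStalk O x) (A := L.envAlg.Stalk x) a)
    induction a using env_induction with
    | h_one =>
      rw [ExtAlg.Hom.stalk_one, IsRBialgebra.comul_one, IsRBialgebra.comul_one,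
        TensorProduct.map_tmul, ExtAlg.Hom.stalk_one]
    | h_add a b ha hb => rw [map_add, map_add, map_add, map_add, ha, hb]
    | h_smul r a ha => rw [map_smul, map_smul, map_smul, map_smul, ha]
    | h_ι V hx D a ha =>
      rw [ExtAlg.Hom.stalk_mul, envAlgMap_stalk_ιx, comul_ιx_mul, comul_ιx_mul, ha]
      generalize Coalgebra.comul (R := OStalk O x) a = t
      induction t with
      | zero => simp only [map_zero]
      | add s t hs ht => simp only [map_add, hs, ht]
      | tmul b c =>
        rw [TensorProduct.map_tmul, boxι_tmul, boxι_tmul, map_add, TensorProduct.map_tmul,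
          TensorProduct.map_tmul, ExtAlg.Hom.stalk_mul, ExtAlg.Hom.stalk_mul,
          envAlgMap_stalk_ιx]

lemma envMap_id {U : Opens X} (a : Env K (OSec O U) (L.Sec U)) : envMap (𝟙 L) U a = a := by
  induction a using Env.induction with
  | h_one => rw [map_one]
  | h_add a b ha hb => rw [map_add, ha, hb]
  | h_η f a ha => rw [map_mul, ha, envMap_η]
  | h_δ D a ha => rw [map_mul, ha, envMap_δ]; rfl

lemma envMap_comp (φ : L ⟶ M) (ψ : M ⟶ N) {U : Opens X} (a : Env K (OSec O U) (L.Sec U)) :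
    envMap (φ ≫ ψ) U a = envMap ψ U (envMap φ U a) := by
  induction a using Env.induction with
  | h_one => simp only [map_one]
  | h_add a b ha hb => simp only [map_add, ha, hb]
  | h_η f a ha => simp only [map_mul, ha, envMap_η]
  | h_δ D a ha => simp only [map_mul, ha, envMap_δ]; rfl

end LieAlgebroid

variable (O) in
/-- The functor `𝒰` of universal enveloping algebroids. -/
def envFunctor : LieAlgebroid O ⥤ Bialgebroid O where
  obj L := L.envBialgebroid
  map φ := LieAlgebroid.envBialgebroidMap φ
  map_id L := Bialgebroid.Hom.ext' (by
    have h : LieAlgebroid.envPreMap (𝟙 L) = 𝟙 L.envPre := by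
      ext U a
      exact LieAlgebroid.envMap_id a
    exact (congrArg shfMap h).trans (shfMap_id _))
  map_comp φ ψ := Bialgebroid.Hom.ext' (by
    have h : LieAlgebroid.envPreMap (φ ≫ ψ) =
        LieAlgebroid.envPreMap φ ≫ LieAlgebroid.envPreMap ψ := by
      ext U a
      exact LieAlgebroid.envMap_comp φ ψ a
    exact (congrArg shfMap h).trans (shfMap_comp _ _))

end EnvelopeFunctor

/-! ### The two full subcategories -/

section Subcategories

variable {K : Type u} [Field K] {X : TopCat.{u}} (O : X.Sheaf (CommAlgCat.{u} K))

/-- The full subcategory of locally free Lie algebroids. -/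
def locallyFree : ObjectProperty (LieAlgebroid O) := fun L => L.IsLocallyFree

/-- The full subcategory of cocomplete locally graded free bialgebras. -/
def cocompleteGradedFree : ObjectProperty (Bialgebroid O) :=
  fun A => A.IsCocomplete ∧ A.IsLocallyGradedFree

end Subcategories

end LieAlgd

end

noncomputable section

namespace LieAlgd

/-! ### The Poincaré–Birkhoff–Witt module of a free Lie-Rinehart algebra -/

namespace PBW

variable {R L I : Type*} [CommRing R] [LieRing L] [Module R L] [LieRingModule L R]
  [LieRinehartRing R L] [LinearOrder I]

/-! The adjunction is formal. The enveloping algebra is given by generators and relations, so a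
morphism out of `𝒰(L)` is determined by the sections ι(D). For a bialgebra A, the relations of the
enveloping algebra of 𝒫(A) hold among the primitive sections of A. They give the counit `ofEnv` of
the adjunction, first on presheaves and then on the sheafification; the triangle identities are
equalities between images of the generators.

The equivalence is proved on stalks. Let R be the stalk of O at a point. Three facts carry the
argument.

(1) Poincaré–Birkhoff–Witt. If the stalk of L is free over R with ordered basis b, the ordered
monomials in the ι(bᵢ) are an R-basis of the stalk of `𝒰(L)`. For independence, L is made to act on
the free module on commutative monomials zᵐ, with bᵢ zᵐ = zᵐ⁺ⁱ whenever i is at most every variable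
of m; the rest of the action is forced by recursion on the degree. Its curvature vanishes by a
Bianchi identity (`PBW.curv_eq_zero`), so the enveloping algebra acts, and the monomial with
exponent m carries z⁰ to zᵐ. Spanning follows from equivariance of the map from zᵐ to ordered
monomials (`PBW.monMap_rep`), which only reorders products inside the algebra.

(2) Divided powers. In characteristic zero the monomials in primitive elements can be divided by
factorials, and then Δ(e⁽ᵐ⁾) is the sum of e⁽ᵖ⁾ ⊗ e⁽q⁾ over p + q = m (`comul_divPow`). If the
bialgebra is flat over R, linearly independent primitive elements have linearly independent divided
powers: the reduced coproduct turns a relation into one of lower degree in each tensor factor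
(`DivPow.linearIndepOn_ne_zero`). If they even span the primitive elements, divided powers of degree
at most n span the n-th term of the primitive filtration (`DivPow.filt_eq_span`). Indeed, for x in
the filtration, the reduced coproduct of x is a symmetric cocycle with values in the span of divided
powers; such a cocycle is a coboundary (`DivPow.exists_comul_eq`), so x differs from a combination
of divided powers by a primitive element. Conversely, when ordered monomials form a basis, primitive
combinations have degree one (`primFil_one_le_span`).

(3) Flatness comes from the hypotheses. If all subquotients of the primitive filtration are free,
its terms are free, and a cocomplete A is an increasing union of free modules, hence flat
(`flat_of_free_primGr`).

For locally free L, (1) and (2) identify the primitive elements of `𝒰(L)` with L and give the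
monomials of degree n + 1 as local basis of the n-th subquotient; so the unit is an isomorphism and
`𝒰(L)` is cocomplete and locally graded free. For cocomplete, locally graded free A, the first
subquotient is 𝒫(A), which is therefore locally free. The counit carries the PBW basis of `𝒰(𝒫(A))`
to ordered monomials in a basis of the primitive elements of A, and these form a basis by (2) and
(3). A stalkwise bijective morphism of these sheaves is an isomorphism. -/

lemma end_add_apply {M : Type*} [AddCommGroup M] (f g : AddMonoid.End M) (s : M) :
    (f + g) s = f s + g s := rfl

lemma end_neg_apply {M : Type*} [AddCommGroup M] (f : AddMonoid.End M) (s : M) :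
    (-f) s = -f s := rfl

/-- The monomial `zᵐ` in the free module on all monomials. -/
abbrev z (R : Type*) [CommRing R] {I : Type*} (m : I →₀ ℕ) : (I →₀ ℕ) →₀ R := Finsupp.single m 1

/-- Linear combinations of monomials of degree at most `k`. -/
abbrev degLE (R I : Type*) [CommRing R] (k : ℕ) : Submodule R ((I →₀ ℕ) →₀ R) :=
  Finsupp.supported R R {m | m.degree ≤ k}

lemma z_mem {k : ℕ} {m : I →₀ ℕ} (h : m.degree ≤ k) : z R m ∈ degLE R I k :=
  Finsupp.single_mem_supported R 1 h

lemma degLE_mono {k l : ℕ} (h : k ≤ l) : degLE R I k ≤ degLE R I l :=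
  Finsupp.supported_mono fun _ hm => le_trans hm h

lemma degree_add_single (m : I →₀ ℕ) (i : I) :
    (m + Finsupp.single i 1).degree = m.degree + 1 := by
  simp

lemma lie_one (D : L) : ⁅D, (1 : R)⁆ = 0 := by
  have := LieRinehartRing.leibniz_mul_right D (1 : R) 1
  simpa using this

/-- The operator which applies `D` to all coefficients. -/
def coeffDer (R I : Type*) [CommRing R] [LieRingModule L R] (D : L) :
    AddMonoid.End ((I →₀ ℕ) →₀ R) :=
  Finsupp.mapRange.addMonoidHom (AddMonoidHom.mk' (fun r : R => ⁅D, r⁆) (lie_add D))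

lemma coeffDer_apply (D : L) (s : (I →₀ ℕ) →₀ R) (m : I →₀ ℕ) :
    coeffDer R I D s m = ⁅D, s m⁆ := rfl

variable (b : Module.Basis I R L)

/-- The operator `r zᵐ ↦ D(r) zᵐ + r ∑ᵢ Dᵢ E i m` defined by prescribed values `E i m` of the
basis elements on monomials. -/
def op (E : I → (I →₀ ℕ) → (I →₀ ℕ) →₀ R) (D : L) : AddMonoid.End ((I →₀ ℕ) →₀ R) :=
  coeffDer R I D + (show AddMonoid.End ((I →₀ ℕ) →₀ R) from
    (Finsupp.linearCombination R fun m => b.constr ℕ (fun i => E i m) D).toAddMonoidHom)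

variable (E E' : I → (I →₀ ℕ) → (I →₀ ℕ) →₀ R)

lemma op_apply (D : L) (s : (I →₀ ℕ) →₀ R) :
    op b E D s = coeffDer R I D s +
      Finsupp.linearCombination R (fun m => b.constr ℕ (fun i => E i m) D) s := rfl

lemma op_z (D : L) (m : I →₀ ℕ) : op b E D (z R m) = b.constr ℕ (fun i => E i m) D := by
  have : coeffDer R I D (z R m) = 0 := by
    ext m'
    rw [coeffDer_apply, Finsupp.single_apply]
    split_ifs <;> simp [lie_one]
  simp [op_apply, this]

lemma op_basis_z (i : I) (m : I →₀ ℕ) : op b E (b i) (z R m) = E i m := by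
  rw [op_z, Module.Basis.constr_basis]

lemma op_add (D D' : L) : op b E (D + D') = op b E D + op b E D' := by
  ext s : 1
  have : coeffDer R I (D + D') s = coeffDer R I D s + coeffDer R I D' s := by
    ext m; simp [coeffDer_apply]
  rw [end_add_apply]
  simp only [op_apply, this, map_add, Finsupp.linearCombination_apply, smul_add,
    Finsupp.sum_add]
  abel

lemma op_smul (r : R) (D : L) (s) : op b E (r • D) s = r • op b E D s := by
  have : coeffDer R I (r • D) s = r • coeffDer R I D s := by
    ext m; simp [coeffDer_apply]
  simp only [op_apply, this, map_smul, Finsupp.linearCombination_apply, smul_add,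
    Finsupp.smul_sum, smul_comm r]

lemma op_leibniz (D : L) (r : R) (s) : op b E D (r • s) = r • op b E D s + ⁅D, r⁆ • s := by
  have : coeffDer R I D (r • s) = r • coeffDer R I D s + ⁅D, r⁆ • s := by
    ext m; simp [coeffDer_apply]
  simp only [op_apply, this, map_smul, smul_add]
  abel

-- Differentiating coefficients does not enlarge the support, so in degree at most k the operator
-- consults only the values of `E` in that degree. This makes the recursion below well founded.
variable {E E'} in
lemma op_congr {k : ℕ} (h : ∀ m : I →₀ ℕ, m.degree ≤ k → ∀ i, E i m = E' i m) (D : L)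
    {s : (I →₀ ℕ) →₀ R} (hs : s ∈ degLE R I k) : op b E D s = op b E' D s := by
  rw [op_apply, op_apply, Finsupp.linearCombination_apply, Finsupp.linearCombination_apply]
  congr 1
  refine Finsupp.sum_congr fun m hm => ?_
  have : (fun i => E i m) = fun i => E' i m := funext (h m (hs hm))
  rw [this]

variable {E} in
lemma op_mem {k : ℕ} (h : ∀ m : I →₀ ℕ, m.degree ≤ k → ∀ i, E i m ∈ degLE R I (k + 1)) (D : L)
    {s : (I →₀ ℕ) →₀ R} (hs : s ∈ degLE R I k) : op b E D s ∈ degLE R I (k + 1) := by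
  rw [op_apply]
  refine add_mem (fun m hm => ?_) ?_
  · have : s m ≠ 0 := fun h0 => by
      rw [Finset.mem_coe, Finsupp.mem_support_iff, coeffDer_apply, h0, lie_zero] at hm
      exact hm rfl
    exact Nat.le_succ_of_le (hs (Finsupp.mem_support_iff.2 this))
  · rw [Finsupp.linearCombination_apply]
    refine Submodule.sum_mem _ fun m hm => Submodule.smul_mem _ _ ?_
    rw [Module.Basis.constr_apply]
    exact Submodule.sum_mem _ fun i _ => Submodule.smul_mem _ _ (h m (hs hm) i)

/-- The recursion for the action of `b i` on `zᵐ`: if `j < i` is the smallest variable in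
`m = m' + j`, then `bᵢ zᵐ = bⱼ (bᵢ zᵐ') + [bᵢ, bⱼ] zᵐ'`. -/
def step (i : I) (m : I →₀ ℕ) : (I →₀ ℕ) →₀ R :=
  open Classical in
  -- This term stands for bⱼ z^(m' + i), which must be z^(m + i) because j is at most every variable
  -- involved. Writing it out avoids evaluating `E` at m' + i, which has the same degree as m; what
  -- remains to be acted on has degree at most that of m'.
  z R (m + Finsupp.single i 1) +
  if h : ∃ j ∈ m.support, j < i then
    let j := m.support.min' ⟨h.choose, h.choose_spec.1⟩
    let m' := m - Finsupp.single j 1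
    op b E (b j) (E i m' - z R (m' + Finsupp.single i 1)) + op b E ⁅b i, b j⁆ (z R m')
  else 0

lemma step_of_le {i : I} {m : I →₀ ℕ} (h : ∀ j ∈ m.support, i ≤ j) :
    step b E i m = z R (m + Finsupp.single i 1) := by
  rw [step, dif_neg, add_zero]
  rintro ⟨j, hj, hji⟩
  exact hji.not_ge (h j hj)

lemma support_add_single (m : I →₀ ℕ) (j : I) :
    (m + Finsupp.single j 1).support = insert j m.support := by
  ext k
  by_cases hk : k = j <;> simp [hk, Ne.symm, eq_comm]

lemma step_of_lt {i j : I} {m : I →₀ ℕ} (h : ∀ k ∈ m.support, j ≤ k) (hji : j < i) :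
    step b E i (m + Finsupp.single j 1) =
      z R (m + Finsupp.single j 1 + Finsupp.single i 1) +
        (op b E (b j) (E i m - z R (m + Finsupp.single i 1)) + op b E ⁅b i, b j⁆ (z R m)) := by
  have hj : j ∈ (m + Finsupp.single j 1).support := by
    rw [support_add_single]; exact Finset.mem_insert_self _ _
  have hex : ∃ k ∈ (m + Finsupp.single j 1).support, k < i := ⟨j, hj, hji⟩
  have hmin : (m + Finsupp.single j 1).support.min' ⟨hex.choose, hex.choose_spec.1⟩ = j := by
    refine le_antisymm (Finset.min'_le _ _ hj) (Finset.le_min' _ _ _ fun k hk => ?_)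
    rw [support_add_single, Finset.mem_insert] at hk
    rcases hk with rfl | hk
    · exact le_rfl
    · exact h k hk
  rw [step, dif_pos hex]
  simp only [hmin, add_tsub_cancel_right]

lemma le_or_exists (i : I) (m : I →₀ ℕ) : (∀ j ∈ m.support, i ≤ j) ∨
    ∃ (j : I) (m' : I →₀ ℕ), m = m' + Finsupp.single j 1 ∧ j < i ∧ ∀ k ∈ m'.support, j ≤ k := by
  by_cases h : ∀ j ∈ m.support, i ≤ j
  · exact Or.inl h
  · push Not at h
    obtain ⟨j, hj, hji⟩ := h
    refine Or.inr ⟨m.support.min' ⟨j, hj⟩, m - Finsupp.single (m.support.min' ⟨j, hj⟩) 1, ?_,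
      (Finset.min'_le _ _ hj).trans_lt hji, fun k hk => Finset.min'_le _ _ ?_⟩
    · have := Finset.min'_mem m.support ⟨j, hj⟩
      rw [tsub_add_cancel_of_le]
      rw [Finsupp.single_le_iff]
      exact Nat.one_le_iff_ne_zero.2 (Finsupp.mem_support_iff.1 this)
    · exact Finsupp.support_mono tsub_le_self hk

/-- Iterates of the recursion. -/
def approx : ℕ → I → (I →₀ ℕ) → (I →₀ ℕ) →₀ R
  | 0 => fun _ _ => 0
  | n + 1 => step b (approx n)

/-- The recursion at a monomial uses only smaller degrees, so the n-th iterate is stable below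
degree n and the starting value 0 never matters. The two claims go together: stability of the step
needs the correction term to have low degree, so that `op_congr` applies to it. -/
lemma approx_spec (n : ℕ) : ∀ m : I →₀ ℕ, m.degree < n → ∀ i,
    approx b n i m - z R (m + Finsupp.single i 1) ∈ degLE R I m.degree ∧
      approx b (n + 1) i m = approx b n i m := by
  induction n with
  | zero => intro m hm; exact absurd hm (Nat.not_lt_zero _)
  | succ n ih =>
    intro m hm i
    rcases le_or_exists i m with h | ⟨j, m, rfl, hji, h⟩
    · change step b _ i m - _ ∈ _ ∧ step b _ i m = step b _ i m
      rw [step_of_le _ _ h, step_of_le _ _ h]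
      simp
    · rw [degree_add_single] at hm
      have hm' : m.degree < n := by omega
      have hz : z R m ∈ degLE R I m.degree := z_mem le_rfl
      have hE : ∀ m' : I →₀ ℕ, m'.degree ≤ m.degree → ∀ i,
          approx b n i m' ∈ degLE R I (m.degree + 1) := fun m' h' i => by
        have h1 := (ih m' (by omega) i).1
        have h2 : z R (m' + Finsupp.single i 1) ∈ degLE R I (m.degree + 1) :=
          z_mem (by rw [degree_add_single]; omega)
        have := add_mem (degLE_mono (by omega) h1) h2
        rwa [sub_add_cancel] at this
      have hc : ∀ m' : I →₀ ℕ, m'.degree ≤ m.degree → ∀ i,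
          approx b (n + 1) i m' = approx b n i m' := fun m' h' i => (ih m' (by omega) i).2
      have h1 : approx b (n + 1) i (m + Finsupp.single j 1) = _ := step_of_lt b _ h hji
      have h2 : approx b (n + 1 + 1) i (m + Finsupp.single j 1) = _ := step_of_lt b _ h hji
      rw [h1, h2, add_sub_cancel_left, degree_add_single, hc m le_rfl i]
      refine ⟨add_mem (op_mem b hE _ (ih m hm' i).1) (op_mem b hE _ hz), ?_⟩
      rw [op_congr b hc _ (ih m hm' i).1, op_congr b hc _ hz]

/-- The action of the basis elements on monomials. -/
def act (i : I) (m : I →₀ ℕ) : (I →₀ ℕ) →₀ R := approx b (m.degree + 1) i m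

lemma approx_eq_act {n : ℕ} {m : I →₀ ℕ} (h : m.degree < n) (i : I) :
    approx b n i m = act b i m := by
  induction n, (h : m.degree + 1 ≤ n) using Nat.le_induction with
  | base => rfl
  | succ n hn ih => rw [((approx_spec b n) m hn i).2, ih]

lemma act_sub_mem (i : I) (m : I →₀ ℕ) :
    act b i m - z R (m + Finsupp.single i 1) ∈ degLE R I m.degree :=
  (approx_spec b _ m (Nat.lt_succ_self _) i).1

lemma act_of_le {i : I} {m : I →₀ ℕ} (h : ∀ j ∈ m.support, i ≤ j) :
    act b i m = z R (m + Finsupp.single i 1) := step_of_le b _ h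

/-- Since the iterates stabilise, `act` is a fixed point of the recursion. -/
lemma act_of_lt {i j : I} {m : I →₀ ℕ} (h : ∀ k ∈ m.support, j ≤ k) (hji : j < i) :
    act b i (m + Finsupp.single j 1) =
      z R (m + Finsupp.single j 1 + Finsupp.single i 1) +
        (op b (act b) (b j) (act b i m - z R (m + Finsupp.single i 1)) +
          op b (act b) ⁅b i, b j⁆ (z R m)) := by
  have hc : ∀ m' : I →₀ ℕ, m'.degree ≤ m.degree → ∀ i,
      approx b (m.degree + 1) i m' = act b i m' := fun m' h' i => approx_eq_act b (by omega) i
  have h1 : act b i (m + Finsupp.single j 1) =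
      step b (approx b (m.degree + 1)) i (m + Finsupp.single j 1) := by
    rw [act, degree_add_single]; rfl
  rw [h1, step_of_lt b _ h hji, hc m le_rfl, op_congr b hc _ (act_sub_mem b i m),
    op_congr b hc _ (z_mem le_rfl)]

/-- The action of a Lie-Rinehart algebra on the module of monomials in a basis. -/
abbrev rep (D : L) : AddMonoid.End ((I →₀ ℕ) →₀ R) := op b (act b) D

/-- The curvature of `rep`. -/
def curv (D D' : L) : AddMonoid.End ((I →₀ ℕ) →₀ R) :=
  rep b D * rep b D' - rep b D' * rep b D - rep b ⁅D, D'⁆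

lemma curv_apply (D D' : L) (s) :
    curv b D D' s = rep b D (rep b D' s) - rep b D' (rep b D s) - rep b ⁅D, D'⁆ s := rfl

lemma op_zero : op b E (0 : L) = 0 := by
  ext s : 1
  have := op_smul b E 0 (0 : L) s
  rwa [zero_smul, zero_smul] at this

lemma op_neg (D : L) : op b E (-D) = -op b E D := by
  refine eq_neg_of_add_eq_zero_left ?_
  rw [← op_add, neg_add_cancel, op_zero]

lemma curv_swap (D D' : L) : curv b D' D = -curv b D D' := by
  have : rep b ⁅D', D⁆ = -rep b ⁅D, D'⁆ := by rw [← lie_skew]; exact op_neg b _ _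
  rw [curv, curv, this]
  abel

lemma curv_self (D : L) : curv b D D = 0 := by
  rw [curv, sub_self, lie_self, zero_sub, neg_eq_zero]
  exact op_zero b _

/-- Curvature is tensorial: the derivative terms cancel because the anchor respects brackets.
Together with linearity in the first slot and antisymmetry, this reduces its vanishing to basis
elements acting on monomials. -/
lemma curv_smul_apply (D D' : L) (r : R) (s) : curv b D D' (r • s) = r • curv b D D' s := by
  simp only [curv_apply, op_leibniz, map_add, smul_sub, lie_lie, sub_smul]
  abel

lemma curv_add_left (D₁ D₂ D' : L) : curv b (D₁ + D₂) D' = curv b D₁ D' + curv b D₂ D' := by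
  simp only [curv, add_lie, op_add, add_mul, mul_add]
  abel

lemma curv_smul_left (r : R) (D D' : L) (s) : curv b (r • D) D' s = r • curv b D D' s := by
  have h : ⁅r • D, D'⁆ = r • ⁅D, D'⁆ - ⁅D', r⁆ • D := by
    rw [← lie_skew, LieRinehartRing.leibniz_smul_right, ← lie_skew D, smul_neg]
    abel
  have h' : op b (act b) (r • ⁅D, D'⁆ - ⁅D', r⁆ • D) s =
      r • op b (act b) ⁅D, D'⁆ s - ⁅D', r⁆ • op b (act b) D s := by
    rw [sub_eq_add_neg, op_add, op_neg, ← op_smul, ← op_smul, end_add_apply, end_neg_apply,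
      sub_eq_add_neg]
  simp only [curv_apply, h, h', op_smul, op_leibniz, smul_sub]
  abel

lemma curv_z_of_basis {m : I →₀ ℕ} (h : ∀ i k, curv b (b i) (b k) (z R m) = 0) (D D' : L) :
    curv b D D' (z R m) = 0 := by
  have left : ∀ D', (∀ i, curv b (b i) D' (z R m) = 0) → ∀ D, curv b D D' (z R m) = 0 := by
    intro D' h' D
    induction b.mem_span D using Submodule.span_induction with
    | mem _ hx => obtain ⟨i, rfl⟩ := hx; exact h' i
    | zero =>
      have := curv_smul_left b 0 0 D' (z R m)
      rwa [zero_smul, zero_smul] at this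
    | add D₁ D₂ _ _ h₁ h₂ => rw [curv_add_left, end_add_apply, h₁, h₂, add_zero]
    | smul r D _ hD => rw [curv_smul_left, hD, smul_zero]
  refine left D' (fun i => ?_) D
  rw [curv_swap, end_neg_apply, left (b i) (fun k => h k i), neg_zero]

lemma curv_of_z {p : (I →₀ ℕ) → Prop} {D D' : L} (h : ∀ m, p m → curv b D D' (z R m) = 0) {s}
    (hs : s ∈ Finsupp.supported R R {m | p m}) : curv b D D' s = 0 := by
  rw [← Finsupp.sum_single s, Finsupp.sum, map_sum]
  refine Finset.sum_eq_zero fun m hm => ?_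
  rw [← mul_one (s m), ← smul_eq_mul, ← Finsupp.smul_single, curv_smul_apply, h m (hs hm),
    smul_zero]

/-- Here x, y, w stand for the operators of [A, B], [B, C], [C, A], and u, v for those of [[A, B],
C] and [[B, C], A]; by the Jacobi identity the third double bracket acts by -(u + v). -/
lemma bianchi_aux {P : Type*} [Ring P] (a b c x y w u v : P) :
    (a * b - b * a - x) * c = c * (a * b - b * a - x) +
      (a * (b * c - c * b - y) - (b * c - c * b - y) * a) +
      (b * (c * a - a * c - w) - (c * a - a * c - w) * b) - (x * c - c * x - u) -
      (y * a - a * y - v) - (w * b - b * w - -(u + v)) := by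
  simp only [mul_sub, sub_mul, mul_assoc]
  abel

/-- The Bianchi identity, solved for the curvature of A, B after the action of C. It will be used
with C the smallest variable of a monomial, to pass to a monomial of lower degree. -/
lemma bianchi (A B C : L) :
    curv b A B * rep b C = rep b C * curv b A B + (rep b A * curv b B C - curv b B C * rep b A) +
      (rep b B * curv b C A - curv b C A * rep b B) - curv b ⁅A, B⁆ C - curv b ⁅B, C⁆ A
        - curv b ⁅C, A⁆ B := by
  have h : rep b ⁅⁅A, B⁆, C⁆ + rep b ⁅⁅B, C⁆, A⁆ + rep b ⁅⁅C, A⁆, B⁆ = 0 := by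
    have hj : ⁅⁅A, B⁆, C⁆ + ⁅⁅B, C⁆, A⁆ + ⁅⁅C, A⁆, B⁆ = 0 := by
      rw [← lie_skew, ← lie_skew ⁅B, C⁆, ← lie_skew ⁅C, A⁆, ← neg_add, ← neg_add, neg_eq_zero,
        add_assoc, add_comm, lie_jacobi]
    rw [rep, rep, rep, ← op_add, ← op_add, hj, op_zero]
  have h' : rep b ⁅⁅C, A⁆, B⁆ = -(rep b ⁅⁅A, B⁆, C⁆ + rep b ⁅⁅B, C⁆, A⁆) :=
    eq_neg_of_add_eq_zero_right h
  simp only [curv, h']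
  exact bianchi_aux (P := AddMonoid.End ((I →₀ ℕ) →₀ R)) _ _ _ _ _ _ _ _

/-- The recursion for bᵢ on z^(m + j) was chosen to be exactly this equation, as z^(m + j) is bⱼ zᵐ.
-/
lemma curv_basis_of_lt {i j : I} {m : I →₀ ℕ} (h : ∀ k ∈ m.support, j ≤ k) (hji : j < i) :
    curv b (b i) (b j) (z R m) = 0 := by
  have h' : ∀ k ∈ (m + Finsupp.single i 1).support, j ≤ k := fun k hk => by
    rw [support_add_single, Finset.mem_insert] at hk
    rcases hk with rfl | hk
    · exact hji.le
    · exact h k hk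
  have e : m + Finsupp.single j 1 + Finsupp.single i 1 =
      m + Finsupp.single i 1 + Finsupp.single j 1 := add_right_comm _ _ _
  rw [curv_apply, op_basis_z, op_basis_z, act_of_le b h, op_basis_z, act_of_lt b h hji, map_sub,
    op_basis_z, act_of_le b h', e]
  abel

/-- The curvature of `rep` vanishes. -/
theorem curv_eq_zero (D D' : L) : curv b D D' = 0 := by
  have key : ∀ (n : ℕ) (m : I →₀ ℕ), m.degree < n → ∀ D D' : L, curv b D D' (z R m) = 0 := by
    intro n
    induction n with
    | zero => intro m hm; exact absurd hm (Nat.not_lt_zero _)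
    | succ n ih =>
      intro m hm
      refine curv_z_of_basis b fun i k => ?_
      -- If one of i, k is at most every variable of m, the claim holds by antisymmetry and
      -- `curv_basis_of_lt`. The remaining case is that the smallest variable j of m lies below both
      -- i and k.
      rcases le_or_exists k m with hk | ⟨j, m', rfl, hjk, hj⟩
      · rcases lt_trichotomy k i with h | rfl | h
        · exact curv_basis_of_lt b hk h
        · rw [curv_self]; rfl
        · rcases le_or_exists i m with hi | ⟨j, m', rfl, hji, hj⟩
          · rw [curv_swap, end_neg_apply, curv_basis_of_lt b hi h, neg_zero]
          · have : k ≤ j := hk j (by rw [support_add_single]; exact Finset.mem_insert_self _ _)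
            exact absurd (this.trans_lt hji) h.not_gt
      · by_cases hij : i ≤ j
        · have hi : ∀ l ∈ (m' + Finsupp.single j 1).support, i ≤ l := fun l hl => by
            rw [support_add_single, Finset.mem_insert] at hl
            rcases hl with rfl | hl
            · exact hij
            · exact hij.trans (hj l hl)
          rw [curv_swap, end_neg_apply, curv_basis_of_lt b hi (hij.trans_lt hjk),
            neg_zero]
        · rw [not_le] at hij
          rw [degree_add_single] at hm
          have hm' : m'.degree < n := by omega
          have hlow : ∀ {D D' : L} {s : (I →₀ ℕ) →₀ R}, s ∈ degLE R I m'.degree →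
              curv b D D' s = 0 := fun {D D' s} hs =>
            curv_of_z b (fun m'' h'' => ih m'' (lt_of_le_of_lt h'' hm') D D') hs
          have hz : ∀ D D', curv b D D' (z R m') = 0 := fun D D' => hlow (z_mem le_rfl)
          -- Up to terms of degree at most that of m', covered by induction, bᵢ z^m' is z^(m' + i),
          -- and j is still at most every variable there.
          have top : ∀ i k, j < i → j < k →
              curv b (b k) (b j) (rep b (b i) (z R m')) = 0 := by
            intro i k hji hjk
            rw [op_basis_z, ← sub_add_cancel (act b i m') (z R (m' + Finsupp.single i 1)),
              map_add, hlow (act_sub_mem b i m'), zero_add]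
            refine curv_basis_of_lt b (fun l hl => ?_) hjk
            rw [support_add_single, Finset.mem_insert] at hl
            rcases hl with rfl | hl
            · exact hji.le
            · exact hj l hl
          have e : z R (m' + Finsupp.single j 1) = rep b (b j) (z R m') := by
            rw [op_basis_z, act_of_le b hj]
          -- With z^(m' + j) = bⱼ z^m', every term on the right of the Bianchi identity is a
          -- curvature at z^m', zero by induction, or a curvature involving bⱼ at bᵢ z^m' or bₖ
          -- z^m', zero by `top`.
          have hb := DFunLike.congr_fun (bianchi b (b i) (b k) (b j)) (z R m')
          have t1 := top i k hij hjk
          have t2 := top k i hjk hij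
          rw [← neg_eq_zero, ← end_neg_apply, ← curv_swap] at t2
          rw [e]
          change curv b (b i) (b k) (rep b (b j) (z R m')) =
            rep b (b j) (curv b (b i) (b k) (z R m')) +
              (rep b (b i) (curv b (b k) (b j) (z R m')) -
                curv b (b k) (b j) (rep b (b i) (z R m'))) +
              (rep b (b k) (curv b (b j) (b i) (z R m')) -
                curv b (b j) (b i) (rep b (b k) (z R m'))) - curv b ⁅b i, b k⁆ (b j) (z R m') -
              curv b ⁅b k, b j⁆ (b i) (z R m') - curv b ⁅b j, b i⁆ (b k) (z R m') at hb
          rw [hb]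
          simp [hz, t1, t2]
  ext s : 1
  exact curv_of_z b (p := fun _ => True) (fun m _ => key (m.degree + 1) m (Nat.lt_succ_self _) D D')
    (fun _ _ => trivial)

lemma rep_lie (D D' : L) : rep b ⁅D, D'⁆ = rep b D * rep b D' - rep b D' * rep b D :=
  (sub_eq_zero.1 (curv_eq_zero b D D')).symm

/-! ### Ordered monomials in a ring and their comparison with the polynomial action. -/

section Monomials

variable {A : Type*} [Ring A]

/-- The ordered monomial `eᵐ` in elements `e i` of a ring. -/
def mon (e : I → A) (m : I →₀ ℕ) : A := ((m.toMultiset.sort (· ≤ ·)).map e).prod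

lemma mon_zero (e : I → A) : mon e 0 = 1 := by
  simp [mon]

lemma mon_add_single (e : I → A) {i : I} {m : I →₀ ℕ} (h : ∀ j ∈ m.support, i ≤ j) :
    mon e (m + Finsupp.single i 1) = e i * mon e m := by
  have h1 : (m + Finsupp.single i 1).toMultiset = i ::ₘ m.toMultiset := by
    rw [map_add, Finsupp.toMultiset_single, one_nsmul, add_comm, Multiset.singleton_add]
  rw [mon, h1, Multiset.sort_cons _ _ _ (fun j hj => h j ((Finsupp.mem_toMultiset _ _).1 hj)),
    List.map_cons, List.prod_cons, mon]

lemma mon_single (e : I → A) (i : I) : mon e (Finsupp.single i 1) = e i := by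
  have := mon_add_single e (i := i) (m := 0) (by simp)
  rwa [zero_add, mon_zero, mul_one] at this

lemma map_mon {B : Type*} [Ring B] (f : A →* B) (e : I → A) (m : I →₀ ℕ) :
    f (mon e m) = mon (fun i => f (e i)) m := by
  rw [mon, mon, map_list_prod, List.map_map]
  rfl

/-- Induction on ordered monomials. -/
lemma mon_induction {p : (I →₀ ℕ) → Prop} (zero : p 0)
    (add : ∀ i m, (∀ j ∈ m.support, i ≤ j) → p m → p (m + Finsupp.single i 1)) (m : I →₀ ℕ) :
    p m := by
  induction h : m.degree generalizing m with
  | zero => rwa [(Finsupp.degree_eq_zero_iff m).1 h]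
  | succ n ih =>
    have hne : m.support.Nonempty := by
      rw [Finsupp.support_nonempty_iff]
      rintro rfl
      simp at h
    set j := m.support.min' hne with hj
    have e : m = m - Finsupp.single j 1 + Finsupp.single j 1 := by
      rw [tsub_add_cancel_of_le]
      rw [Finsupp.single_le_iff]
      exact Nat.one_le_iff_ne_zero.2 (Finsupp.mem_support_iff.1 (Finset.min'_mem _ hne))
    rw [e]
    refine add _ _ (fun k hk => Finset.min'_le _ _ (Finsupp.support_mono tsub_le_self hk))
      (ih _ ?_)
    rw [e, degree_add_single] at h
    omega

/-- The outermost factor of an ordered monomial is its smallest variable, and on such arguments the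
action simply adds the variable. Thus z⁰ is a cyclic vector that separates ordered monomials. -/
lemma rep_mon_z (m : I →₀ ℕ) {T : Type*} (f : T → AddMonoid.End ((I →₀ ℕ) →₀ R))
    [Ring T] (hf_one : f 1 = 1) (hf_mul : ∀ s t, f (s * t) = f s * f t) (e : I → T)
    (he : ∀ i, f (e i) = rep b (b i)) : f (mon e m) (z R 0) = z R m := by
  induction m using mon_induction with
  | zero => rw [mon_zero, hf_one]; rfl
  | add i m h ih =>
    rw [mon_add_single e h, hf_mul]
    change f (e i) (f (mon e m) (z R 0)) = _
    rw [ih, he, op_basis_z, act_of_le b h]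

variable [Module R A] [IsScalarTower R A A] (δ : L →+ A)
  (h_smul : ∀ (r : R) D, δ (r • D) = r • δ D)
  (h_lie : ∀ D D', δ ⁅D, D'⁆ = δ D * δ D' - δ D' * δ D)
  (h_leibniz : ∀ D (r : R) a, δ D * (r • a) = r • (δ D * a) + ⁅D, r⁆ • a)

/-- The linear map from the module of monomials which sends `zᵐ` to the ordered monomial. -/
abbrev monMap (R : Type*) [CommRing R] [Module R A] (e : I → A) : ((I →₀ ℕ) →₀ R) →ₗ[R] A :=
  Finsupp.linearCombination R (mon e)

lemma monMap_z (e : I → A) (m : I →₀ ℕ) : monMap R e (z R m) = mon e m := by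
  simp

-- Both sides are additive and R-linear in D and obey the same Leibniz rule in s, so basis elements
-- and monomials suffice. The predicate restricts the monomials, to allow induction on the degree.
include h_smul h_leibniz in
lemma monMap_rep_of_basis {p : (I →₀ ℕ) → Prop}
    (h : ∀ m, p m → ∀ i, monMap R (fun i => δ (b i)) (act b i m) = δ (b i) * mon (fun i => δ (b i)) m)
    (D : L) {s} (hs : s ∈ Finsupp.supported R R {m | p m}) :
    monMap R (fun i => δ (b i)) (rep b D s) = δ D * monMap R (fun i => δ (b i)) s := by
  have hz : ∀ m, p m → monMap R (fun i => δ (b i)) (rep b D (z R m)) =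
      δ D * mon (fun i => δ (b i)) m := by
    intro m hm
    rw [op_z]
    induction b.mem_span D using Submodule.span_induction with
    | mem _ hx => obtain ⟨i, rfl⟩ := hx; rw [Module.Basis.constr_basis, h m hm i]
    | zero => rw [map_zero, map_zero, map_zero, zero_mul]
    | add D₁ D₂ _ _ h₁ h₂ => rw [map_add, map_add, map_add, add_mul, h₁, h₂]
    | smul r D _ hD => rw [map_smul, map_smul, hD, h_smul, smul_mul_assoc]
  have hsum : ∀ t : Finset (I →₀ ℕ), (∀ m ∈ t, p m) → ∀ g : (I →₀ ℕ) → R,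
      monMap R (fun i => δ (b i)) (rep b D (∑ m ∈ t, g m • z R m)) =
        δ D * monMap R (fun i => δ (b i)) (∑ m ∈ t, g m • z R m) := by
    intro t ht g
    rw [map_sum, map_sum, map_sum, Finset.mul_sum]
    refine Finset.sum_congr rfl fun m hm => ?_
    rw [op_leibniz, map_add, map_smul, map_smul, map_smul, monMap_z, h_leibniz, hz m (ht m hm)]
  have e : s = ∑ m ∈ s.support, s m • z R m := by
    conv_lhs => rw [← Finsupp.sum_single s, Finsupp.sum]
    simp
  rw [e]
  exact hsum _ (fun m hm => hs hm) _

include h_smul h_lie h_leibniz in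
/-- The map sending `zᵐ` to the ordered monomial is equivariant. -/
theorem monMap_rep (D : L) (s) :
    monMap R (fun i => δ (b i)) (rep b D s) = δ D * monMap R (fun i => δ (b i)) s := by
  set e : I → A := fun i => δ (b i) with he
  have key : ∀ (n : ℕ) (m : I →₀ ℕ), m.degree < n → ∀ i,
      monMap R e (act b i m) = δ (b i) * mon e m := by
    intro n
    induction n with
    | zero => intro m hm; exact absurd hm (Nat.not_lt_zero _)
    | succ n ih =>
      intro m hm i
      rcases le_or_exists i m with h | ⟨j, m, rfl, hji, h⟩
      · rw [act_of_le b h, monMap_z, mon_add_single e h]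
      · rw [degree_add_single] at hm
        have hm' : m.degree < n := by omega
        have hlow : ∀ D {s}, s ∈ degLE R I m.degree → monMap R e (rep b D s) =
            δ D * monMap R e s := fun D s hs =>
          monMap_rep_of_basis b δ h_smul h_leibniz (fun m'' h'' i => ih m'' (lt_of_le_of_lt h'' hm') i)
            D hs
        have h' : ∀ k ∈ (m + Finsupp.single i 1).support, j ≤ k := fun k hk => by
          rw [support_add_single, Finset.mem_insert] at hk
          rcases hk with rfl | hk
          · exact hji.le
          · exact h k hk
        -- The recursion for bᵢ z^(m + j) is the image of the reordering eᵢ eⱼ eᵐ = eⱼ eᵢ eᵐ + [eᵢ,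
        -- eⱼ] eᵐ; all operators on the right are applied to degree at most that of m, where
        -- equivariance is known.
        rw [act_of_lt b h hji, map_add, map_add, hlow _ (act_sub_mem b i m),
          hlow _ (z_mem le_rfl), map_sub, ih m hm' i, monMap_z, monMap_z, monMap_z,
          add_right_comm m, mon_add_single e h', mon_add_single e h, h_lie, mul_sub, sub_mul,
          mul_assoc, mul_assoc]
        change e j * _ + (_ - e j * _ + _) = _
        abel
  exact monMap_rep_of_basis b δ h_smul h_leibniz (p := fun _ => True)
    (fun m _ i => key _ m (Nat.lt_succ_self _) i) D (fun _ _ => trivial)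

end Monomials

end PBW

/-! ### Divided powers in cocommutative coalgebras -/

namespace DivPow

open Finset.HasAntidiagonal (antidiagonal mem_antidiagonal)

variable (R : Type*) [CommRing R] (I : Type*)

/-- The free module on the non-constant monomials. -/
abbrev F : Type _ := {m : I →₀ ℕ // m ≠ 0} →₀ R

variable {I}

open Classical in
/-- The monomial `zᵐ`, and `0` for `m = 0`. -/
def z (m : I →₀ ℕ) : F R I := if h : m ≠ 0 then Finsupp.single ⟨m, h⟩ 1 else 0

lemma z_zero : z R (0 : I →₀ ℕ) = 0 := dif_neg (by simp)

lemma z_coe (m : {m : I →₀ ℕ // m ≠ 0}) : z R m.1 = Finsupp.single m 1 := dif_pos m.2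

/-- The coefficient of `zᵐ` in a tensor. -/
def coeff {M : Type*} [AddCommMonoid M] [Module R M] (p : {m : I →₀ ℕ // m ≠ 0}) :
    F R I ⊗[R] M →ₗ[R] M :=
  TensorProduct.lid R M ∘ₗ (Finsupp.lapply p).rTensor M

variable {R} {M N : Type*} [AddCommMonoid M] [Module R M] [AddCommMonoid N] [Module R N]

lemma coeff_tmul (p : {m : I →₀ ℕ // m ≠ 0}) (f : F R I) (x : M) :
    coeff R p (f ⊗ₜ x) = f p • x := by
  simp [coeff]

lemma coeff_lTensor (p : {m : I →₀ ℕ // m ≠ 0}) (g : M →ₗ[R] N) (t : F R I ⊗[R] M) :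
    coeff R p (g.lTensor _ t) = g (coeff R p t) := by
  induction t with
  | zero => simp
  | add s t hs ht => simp only [map_add, hs, ht]
  | tmul f x => simp [coeff_tmul]

lemma coeff_ext {s t : F R I ⊗[R] M} (h : ∀ p, coeff R p s = coeff R p t) : s = t := by
  classical
  apply (TensorProduct.finsuppScalarLeft R M {m : I →₀ ℕ // m ≠ 0}).injective
  ext p
  rw [TensorProduct.finsuppScalarLeft_apply, TensorProduct.finsuppScalarLeft_apply]
  exact h p

/-- The first factor is free, so a tensor is a finite family of coefficients and these can be lifted
one at a time. -/
lemma exists_lTensor {g : N →ₗ[R] M} (t : F R I ⊗[R] M)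
    (h : ∀ p, coeff R p t ∈ LinearMap.range g) : ∃ s, g.lTensor (F R I) s = t := by
  classical
  set T := TensorProduct.finsuppScalarLeft R M {m : I →₀ ℕ // m ≠ 0} with hT
  choose c hc using h
  refine ⟨∑ p ∈ (T t).support, Finsupp.single p 1 ⊗ₜ c p, ?_⟩
  apply T.injective
  rw [map_sum, map_sum]
  conv_rhs => rw [← Finsupp.sum_single (T t), Finsupp.sum]
  refine Finset.sum_congr rfl fun p _ => ?_
  rw [LinearMap.lTensor_tmul, hc, ← TensorProduct.finsuppScalarLeft_symm_apply_single,
    LinearEquiv.apply_symm_apply]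
  congr 1
  exact (TensorProduct.finsuppScalarLeft_apply t p).symm

/-! ### The divided power coproduct and its symmetric cocycles. -/

section Coproduct

variable [DecidableEq I]

/-- The coproduct `zᵐ ↦ ∑ zᵖ ⊗ z^q` over the decompositions of `m` into non-zero summands. -/
def comul : F R I →ₗ[R] F R I ⊗[R] F R I :=
  Finsupp.linearCombination R fun m => ∑ x ∈ antidiagonal m.1, z R x.1 ⊗ₜ z R x.2

/-- The contraction `z^(p + q) ↦ z^q`. -/
def contract (p : {m : I →₀ ℕ // m ≠ 0}) : F R I →ₗ[R] F R I := coeff R p ∘ₗ comul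

lemma z_apply (m : I →₀ ℕ) (p : {m : I →₀ ℕ // m ≠ 0}) :
    z R m p = if m = p.1 then 1 else 0 := by
  classical
  rw [z]
  split_ifs with h h' h'
  · subst h'; simp
  · rw [Finsupp.single_apply, if_neg (fun e => h' (congrArg Subtype.val e))]
  · exact absurd (h' ▸ p.2) h
  · rfl

instance : Add {m : I →₀ ℕ // m ≠ 0} :=
  ⟨fun p q => ⟨p.1 + q.1, fun h => p.2 (add_eq_zero.1 h).1⟩⟩

lemma coe_add (p q : {m : I →₀ ℕ // m ≠ 0}) : (p + q).1 = p.1 + q.1 := rfl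

lemma contract_apply (p q : {m : I →₀ ℕ // m ≠ 0}) (f : F R I) :
    contract p f q = f (p + q) := by
  have h : Finsupp.lapply (R := R) q ∘ₗ contract (R := R) p = Finsupp.lapply (p + q) := by
    ext m
    have e : contract p (Finsupp.single m (1 : R)) q =
        ∑ x ∈ antidiagonal m.1, z R x.1 p * z R x.2 q := by
      simp only [contract, comul, LinearMap.comp_apply, Finsupp.linearCombination_single, one_smul,
        map_sum, coeff_tmul, Finsupp.finsetSum_apply, Finsupp.smul_apply, smul_eq_mul]
    simp only [LinearMap.comp_apply, Finsupp.lsingle_apply, Finsupp.lapply_apply, e]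
    simp only [z_apply]
    rw [Finsupp.single_apply]
    by_cases hm : m = p + q
    · rw [if_pos hm, Finset.sum_eq_single (p.1, q.1)]
      · simp
      · rintro ⟨a, c⟩ - hne
        by_cases ha : a = p.1
        · rw [if_neg (show ¬ c = q.1 from fun hc => hne (by rw [ha, hc])), mul_zero]
        · rw [if_neg (show ¬ a = p.1 from ha), zero_mul]
      · intro hn
        exact absurd (mem_antidiagonal.2 (by rw [hm]; rfl)) hn
    · rw [if_neg hm]
      refine Finset.sum_eq_zero fun x hx => ?_
      by_cases ha : x.1 = p.1
      · rw [if_neg (show ¬ x.2 = q.1 from fun hc => hm (Subtype.ext ?_)), mul_zero]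
        rw [coe_add, ← ha, ← hc]
        exact (mem_antidiagonal.1 hx).symm
      · rw [if_neg ha, zero_mul]
  exact LinearMap.congr_fun h f

/-- Extracting the coefficient of zᵖ turns the coproduct of the first factor into contraction by p;
coassociativity then becomes a family of equations between coefficients. -/
lemma coeff_assoc_rTensor (p : {m : I →₀ ℕ // m ≠ 0}) (t : F R I ⊗[R] M) :
    coeff R p (TensorProduct.assoc R (F R I) (F R I) M (comul.rTensor M t)) =
      (contract p).rTensor M t := by
  induction t with
  | zero => simp
  | add s t hs ht => simp only [map_add, hs, ht]
  | tmul f x =>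
    rw [LinearMap.rTensor_tmul, LinearMap.rTensor_tmul, contract, LinearMap.comp_apply]
    generalize comul f = w
    induction w with
    | zero => simp
    | add s t hs ht => simp only [map_add, TensorProduct.add_tmul, hs, ht]
    | tmul g h => rw [TensorProduct.assoc_tmul, coeff_tmul, coeff_tmul, TensorProduct.smul_tmul']

lemma coeff_rTensor_contract (p q : {m : I →₀ ℕ // m ≠ 0}) (t : F R I ⊗[R] M) :
    coeff R q ((contract p).rTensor M t) = coeff R (p + q) t := by
  induction t with
  | zero => simp
  | add s t hs ht => simp only [map_add, hs, ht]
  | tmul f x => rw [LinearMap.rTensor_tmul, coeff_tmul, coeff_tmul, contract_apply]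

lemma coeff_comm (p q : {m : I →₀ ℕ // m ≠ 0}) (t : F R I ⊗[R] F R I) :
    coeff R p (TensorProduct.comm R _ _ t) q = coeff R q t p := by
  induction t with
  | zero => simp
  | add s t hs ht => simp only [map_add, Finsupp.add_apply, hs, ht]
  | tmul f g =>
    rw [TensorProduct.comm_tmul, coeff_tmul, coeff_tmul]
    exact mul_comm _ _

lemma exists_coeff_ne_zero (t : F R I ⊗[R] F R I) :
    {x : {m : I →₀ ℕ // m ≠ 0} × {m : I →₀ ℕ // m ≠ 0} | coeff R x.1 t x.2 ≠ 0}.Finite := by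
  have h : ∀ x : {m : I →₀ ℕ // m ≠ 0} × {m : I →₀ ℕ // m ≠ 0},
      finsuppTensorFinsupp' R _ _ t x = coeff R x.1 t x.2 := by
    intro x
    induction t with
    | zero => simp
    | add s t hs ht => simp only [map_add, Finsupp.add_apply, hs, ht]
    | tmul f g =>
      rw [coeff_tmul]
      exact finsuppTensorFinsupp'_apply_apply R _ _ f g x.1 x.2
  refine (finsuppTensorFinsupp' R _ _ t).hasFiniteSupport.subset fun x hx => ?_
  rw [Function.mem_support, h]
  exact hx

/-- A symmetric cocycle is a coboundary. -/
lemma exists_comul_eq (w : F R I ⊗[R] F R I) (h_comm : TensorProduct.comm R _ _ w = w)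
    (h_cocycle : TensorProduct.assoc R _ _ _ (comul.rTensor _ w) = comul.lTensor _ w) :
    ∃ u : F R I, comul u = w := by
  classical
  have c_comm : ∀ p q, coeff R p w q = coeff R q w p := fun p q => by
    conv_lhs => rw [← h_comm]
    rw [coeff_comm]
  -- Write c(p, q) for the coefficient of zᵖ ⊗ z^q in w. The cocycle condition says c(p + q, r) =
  -- c(p, q + r).
  have c_cocycle : ∀ p q r, coeff R (p + q) w r = coeff R p w (q + r) := fun p q r => by
    have h1 := congrArg (fun t => coeff R p t) h_cocycle
    simp only [coeff_assoc_rTensor, coeff_lTensor] at h1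
    have h2 := congrArg (fun t : F R I ⊗[R] F R I => coeff R q t r) h1
    simp only [coeff_rTensor_contract] at h2
    rw [h2, ← contract_apply]
    rfl
  have hne : ∀ i : I, Finsupp.single i 1 ≠ 0 := fun i => by simp
  let s : I → {m : I →₀ ℕ // m ≠ 0} := fun i => ⟨Finsupp.single i 1, hne i⟩
  have single_or : ∀ (p : {m : I →₀ ℕ // m ≠ 0}) (i : I), p.1 i ≠ 0 →
      p = s i ∨ ∃ p', p = s i + p' := by
    intro p i hi
    have hle : Finsupp.single i 1 ≤ p.1 := by
      rw [Finsupp.single_le_iff]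
      exact Nat.one_le_iff_ne_zero.2 hi
    by_cases h0 : p.1 - Finsupp.single i 1 = 0
    · left
      apply Subtype.ext
      have := add_tsub_cancel_of_le hle
      rw [h0, add_zero] at this
      exact this.symm
    · exact Or.inr ⟨⟨_, h0⟩, Subtype.ext (add_tsub_cancel_of_le hle).symm⟩
  have addne : ∀ p q : {m : I →₀ ℕ // m ≠ 0}, p.1 + q.1 ≠ 0 := fun p q => (p + q).2
  have add_right_cancel' : ∀ p q r : {m : I →₀ ℕ // m ≠ 0}, p + q = p + r → q = r :=
    fun p q r h => Subtype.ext (add_left_cancel (congrArg Subtype.val h))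
  -- The value c(p, q) depends only on p + q: a variable i of p is split off, p = i + p', and p' is
  -- moved to the other argument by the cocycle condition.
  have key : ∀ (p q r : {m : I →₀ ℕ // m ≠ 0}) (i : I), p.1 i ≠ 0 → p + q = s i + r →
      coeff R p w q = coeff R (s i) w r := by
    intro p q r i hi h
    rcases single_or p i hi with rfl | ⟨p', rfl⟩
    · rw [add_right_cancel' _ _ _ h]
    · rw [c_cocycle]
      congr 1
      refine add_right_cancel' (s i) _ _ (Eq.trans (Subtype.ext ?_) h)
      simp only [coe_add, add_assoc]
  -- If i does not occur in p it occurs in q, and symmetry exchanges the two.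
  have key' : ∀ (p q r : {m : I →₀ ℕ // m ≠ 0}) (i : I), p + q = s i + r →
      coeff R p w q = coeff R (s i) w r := by
    intro p q r i h
    by_cases hi : p.1 i = 0
    · rw [c_comm]
      refine key q p r i ?_ (Eq.trans (Subtype.ext (add_comm _ _)) h)
      have := DFunLike.congr_fun (congrArg Subtype.val h) i
      simp only [coe_add, Finsupp.add_apply, hi, s, Finsupp.single_eq_same] at this
      omega
    · exact key p q r i hi h
  have ex : ∀ m : {m : I →₀ ℕ // m ≠ 0}, ∃ i, m.1 i ≠ 0 := fun m => by
    obtain ⟨i, hi⟩ := Finsupp.support_nonempty_iff.2 m.2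
    exact ⟨i, Finsupp.mem_support_iff.1 hi⟩
  choose ch hch using ex
  -- The primitive u has coefficient c(i, m - i) at m, for a chosen variable i of m. Monomials of
  -- degree one have no decomposition; there the coefficient is set to 0, and the coproduct does not
  -- see it.
  let g : {m : I →₀ ℕ // m ≠ 0} → R := fun m =>
    if h : ∃ r, m = s (ch m) + r then coeff R (s (ch m)) w h.choose else 0
  have hg : ∀ p q, g (p + q) = coeff R p w q := by
    intro p q
    have h : ∃ r, p + q = s (ch (p + q)) + r := by
      rcases single_or (p + q) _ (hch (p + q)) with h | h
      · exfalso
        have h1 := congrArg Finsupp.degree (congrArg Subtype.val h)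
        have hp : p.1.degree ≠ 0 := fun h => p.2 ((Finsupp.degree_eq_zero_iff _).1 h)
        have hq : q.1.degree ≠ 0 := fun h => q.2 ((Finsupp.degree_eq_zero_iff _).1 h)
        simp only [coe_add, map_add, s, Finsupp.degree_single] at h1
        omega
      · exact h
    simp only [g]
    rw [dif_pos h]
    exact (key' p q _ _ h.choose_spec).symm
  -- The tensor w has finitely many nonzero coefficients, and g is nonzero only at sums of their
  -- indices.
  have hfin : (Function.support g).Finite := by
    refine ((exists_coeff_ne_zero w).image fun x => x.1 + x.2).subset fun m hm => ?_
    simp only [g, Function.mem_support] at hm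
    split_ifs at hm with h
    · exact ⟨(s (ch m), h.choose), hm, h.choose_spec.symm⟩
    · exact absurd rfl hm
  refine ⟨Finsupp.ofSupportFinite g hfin, coeff_ext fun p => ?_⟩
  ext q
  rw [← hg]
  exact contract_apply p q _

end Coproduct

/-! ### Divided powers and the primitive filtration of a flat cocommutative coalgebra. -/

section Filtration

variable [DecidableEq I] {C : Type*} [AddCommGroup C] [Module R C] [Module.Flat R C]
  (δ : C →ₗ[R] C ⊗[R] C) (v : (I →₀ ℕ) → C)

/-- The linear map `zᵐ ↦ v m`. -/
def toC : F R I →ₗ[R] C := Finsupp.linearCombination R fun m => v m.1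

variable {v} (v_zero : v 0 = 0)
  (δ_v : ∀ m, δ (v m) = ∑ x ∈ antidiagonal m, v x.1 ⊗ₜ v x.2)

include v_zero in
lemma toC_z (m : I →₀ ℕ) : toC v (z R m) = v m := by
  by_cases h : m = 0
  · rw [h, z_zero, map_zero, v_zero]
  · rw [z_coe R ⟨m, h⟩, toC, Finsupp.linearCombination_single, one_smul]

include v_zero δ_v in
lemma δ_toC (f : F R I) : δ (toC v f) = TensorProduct.map (toC v) (toC v) (comul f) := by
  have h : δ ∘ₗ toC v = TensorProduct.map (toC v) (toC v) ∘ₗ comul (R := R) := by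
    ext m
    simp only [LinearMap.comp_apply, Finsupp.lsingle_apply, comul, Finsupp.linearCombination_single,
      one_smul, map_sum, TensorProduct.map_tmul, toC_z v_zero]
    rw [← δ_v, toC, Finsupp.linearCombination_single, one_smul]
  exact LinearMap.congr_fun h f

variable (h_indep : LinearIndependent R fun i => v (Finsupp.single i 1))

-- Applying δ to a relation of degree at most n + 1 gives a relation among tensors whose factors
-- have degree at most n, and these are independent by induction and flatness. This kills all
-- coefficients except those of degree one, where independence is assumed.
include v_zero δ_v h_indep in
lemma linearIndepOn_degree_le (n : ℕ) :
    LinearIndepOn R v {m : I →₀ ℕ | m ≠ 0 ∧ m.degree ≤ n} := by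
  induction n with
  | zero =>
    have : {m : I →₀ ℕ | m ≠ 0 ∧ m.degree ≤ 0} = ∅ := by
      ext m
      simp only [Set.mem_ofPred_eq, Set.mem_empty_iff_false, iff_false, not_and, nonpos_iff_eq_zero]
      exact fun h h' => h ((Finsupp.degree_eq_zero_iff _).1 h')
    rw [this]
    exact linearIndepOn_empty R v
  | succ n ih =>
    rw [linearIndepOn_iff'']
    intro t g ht hg h0
    have hdeg : ∀ {m : I →₀ ℕ}, m ≠ 0 → 0 < m.degree := fun {m} h =>
      Nat.pos_of_ne_zero fun h' => h ((Finsupp.degree_eq_zero_iff _).1 h')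
    -- Pairs (p, q) from different monomials are different, since p + q recovers the monomial; so
    -- each tensor occurs once, with coefficient g(p + q).
    have h1 : ∑ x ∈ t.biUnion antidiagonal with x.1 ≠ 0 ∧ x.2 ≠ 0,
        g (x.1 + x.2) • (v x.1 ⊗ₜ[R] v x.2) = 0 := by
      have := congrArg δ h0
      simp only [map_sum, map_smul, δ_v, map_zero, Finset.smul_sum] at this
      rw [Finset.sum_filter_of_ne, Finset.sum_biUnion]
      · rw [← this]
        refine Finset.sum_congr rfl fun m _ => Finset.sum_congr rfl fun x hx => ?_
        rw [mem_antidiagonal.1 hx]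
      · intro m _ m' _ hne
        rw [Function.onFun, Finset.disjoint_left]
        intro x hx hx'
        exact hne ((mem_antidiagonal.1 hx).symm.trans (mem_antidiagonal.1 hx'))
      · intro x _ hx
        constructor <;> rintro h <;> simp [h, v_zero] at hx
    have h2 := linearIndepOn_iff'.1 (TensorProduct.LinearIndepOn.tmul_of_flat_left ih ih) _
      (fun x => g (x.1 + x.2)) (by
      intro x hx
      simp only [Finset.coe_filter, Finset.mem_biUnion, Set.mem_ofPred_eq] at hx
      obtain ⟨⟨m, hm, hx⟩, h1, h2⟩ := hx
      have hm' : m.degree ≤ n + 1 := (ht hm).2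
      rw [← mem_antidiagonal.1 hx, map_add] at hm'
      have := hdeg h1
      have := hdeg h2
      exact ⟨⟨h1, by omega⟩, ⟨h2, by omega⟩⟩) h1
    -- A nonzero monomial of degree other than one is the sum of a variable and a nonzero rest, so
    -- its coefficient occurs in the tensor relation.
    have big : ∀ m ∈ t, m.degree ≠ 1 → g m = 0 := by
      intro m hm hm1
      have hm0 := (ht hm).1
      obtain ⟨i, hi⟩ := Finsupp.support_nonempty_iff.2 hm0
      have hle : Finsupp.single i 1 ≤ m := by
        rw [Finsupp.single_le_iff]
        exact Nat.one_le_iff_ne_zero.2 (Finsupp.mem_support_iff.1 hi)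
      have e := add_tsub_cancel_of_le hle
      have := h2 (Finsupp.single i 1, m - Finsupp.single i 1) (by
        simp only [Finset.mem_filter, Finset.mem_biUnion]
        refine ⟨⟨m, hm, mem_antidiagonal.2 e⟩, by simp, fun h => hm1 ?_⟩
        rw [← e, h, add_zero, Finsupp.degree_single])
      rwa [e] at this
    have small : LinearIndepOn R v (Set.range fun i : I => Finsupp.single i 1) :=
      (linearIndepOn_range_iff (Finsupp.single_left_injective one_ne_zero) v).2 h_indep
    intro m hm
    by_cases hm1 : m.degree = 1
    · refine linearIndepOn_iff'.1 small (t.filter fun m => m.degree = 1) g ?_ ?_ m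
        (Finset.mem_filter.2 ⟨hm, hm1⟩)
      · intro m hm
        have hm' := Finset.mem_filter.1 hm
        obtain ⟨i, hi⟩ := Finsupp.support_nonempty_iff.2 (ht hm'.1).1
        have hle : Finsupp.single i 1 ≤ m := by
          rw [Finsupp.single_le_iff]
          exact Nat.one_le_iff_ne_zero.2 (Finsupp.mem_support_iff.1 hi)
        have e := add_tsub_cancel_of_le hle
        have h1 : (m - Finsupp.single i 1).degree = 0 := by
          have := hm'.2
          rw [← e, map_add, Finsupp.degree_single] at this
          omega
        rw [(Finsupp.degree_eq_zero_iff _).1 h1, add_zero] at e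
        exact ⟨i, e⟩
      · rw [Finset.sum_filter_of_ne, h0]
        intro m hm hne
        by_contra h
        rw [big m hm h, zero_smul] at hne
        exact hne rfl
    · exact big m hm hm1

include v_zero δ_v h_indep in
/-- Divided powers of linearly independent primitive elements are linearly independent. -/
theorem linearIndepOn_ne_zero : LinearIndepOn R v {m : I →₀ ℕ | m ≠ 0} := by
  rw [linearIndepOn_iff']
  intro t g ht h0
  refine linearIndepOn_iff'.1 (linearIndepOn_degree_le δ v_zero δ_v h_indep (t.sup Finsupp.degree))
    t g (fun m hm => ⟨ht hm, Finset.le_sup (f := Finsupp.degree) hm⟩) h0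

include v_zero δ_v h_indep in
lemma toC_injective : Function.Injective (toC (R := R) v) :=
  linearIndepOn_ne_zero δ v_zero δ_v h_indep

include v_zero δ_v in
/-- The primitive combinations of linearly independent divided powers have degree one. -/
lemma mem_span_of_δ_eq_zero (h : LinearIndepOn R v {m : I →₀ ℕ | m ≠ 0}) {x : C}
    (hx : x ∈ LinearMap.range (toC (R := R) v)) (h0 : δ x = 0) :
    x ∈ Submodule.span R (Set.range fun i => v (Finsupp.single i 1)) := by
  obtain ⟨f, rfl⟩ := hx
  have inj : Function.Injective (toC (R := R) v) := h
  -- `toC` is an injective map compatible with the coproducts, and its tensor square is injective by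
  -- flatness.
  have h1 : comul f = 0 := by
    apply TensorProduct.map_injective_of_flat_flat _ _ inj inj
    rw [← δ_toC δ v_zero δ_v, h0, map_zero]
  rw [toC, Finsupp.linearCombination_apply]
  refine Submodule.sum_mem _ fun m hm => Submodule.smul_mem _ _ (Submodule.subset_span ?_)
  obtain ⟨i, hi⟩ := Finsupp.support_nonempty_iff.2 m.2
  have hle : Finsupp.single i 1 ≤ m.1 := by
    rw [Finsupp.single_le_iff]
    exact Nat.one_le_iff_ne_zero.2 (Finsupp.mem_support_iff.1 hi)
  have e := add_tsub_cancel_of_le hle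
  by_cases hq : m.1 - Finsupp.single i 1 = 0
  · rw [hq, add_zero] at e
    exact ⟨i, by rw [← e]⟩
  -- For a monomial that is not a single variable, the coefficient of f is also a coefficient of its
  -- coproduct, which is zero; so such a monomial cannot occur.
  · have hm' : m = (⟨Finsupp.single i 1, by simp⟩ : {m : I →₀ ℕ // m ≠ 0}) +
        ⟨m.1 - Finsupp.single i 1, hq⟩ := Subtype.ext e.symm
    rw [Finsupp.mem_support_iff, hm', ← contract_apply, contract, LinearMap.comp_apply, h1,
      map_zero] at hm
    exact absurd rfl hm

variable {filt : ℕ → Submodule R C} (filt_zero : filt 0 = ⊥)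
  (filt_succ : ∀ n x, x ∈ filt (n + 1) ↔ δ x ∈ LinearMap.range ((filt n).subtype.rTensor C))

-- In each surviving term v p ⊗ v q of δ(v m) the exponent q is nonzero, so p has strictly smaller
-- degree than m.
include v_zero δ_v filt_zero filt_succ in
lemma mem_filt {n : ℕ} {m : I →₀ ℕ} (h : m.degree ≤ n) : v m ∈ filt n := by
  induction n generalizing m with
  | zero =>
    rw [(Finsupp.degree_eq_zero_iff m).1 (Nat.le_zero.1 h), v_zero]
    exact zero_mem _
  | succ n ih =>
    rw [filt_succ, δ_v]
    refine Submodule.sum_mem _ fun x hx => ?_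
    by_cases h2 : x.2 = 0
    · rw [h2, v_zero, TensorProduct.tmul_zero]
      exact zero_mem _
    · refine ⟨⟨v x.1, ih ?_⟩ ⊗ₜ v x.2, rfl⟩
      rw [← mem_antidiagonal.1 hx, map_add] at h
      have : x.2.degree ≠ 0 := fun h => h2 ((Finsupp.degree_eq_zero_iff _).1 h)
      omega

variable (R I) in
/-- Combinations of monomials of degree at most `n`. -/
abbrev degLE (n : ℕ) : Submodule R (F R I) := Finsupp.supported R R {m | m.1.degree ≤ n}

include v_zero δ_v filt_zero filt_succ in
lemma toC_mem_filt {n : ℕ} {f : F R I} (hf : f ∈ degLE R I n) : toC v f ∈ filt n := by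
  rw [toC, Finsupp.linearCombination_apply]
  exact Submodule.sum_mem _ fun m hm => Submodule.smul_mem _ _
    (mem_filt δ v_zero δ_v filt_zero filt_succ (hf hm))

lemma contract_mem {n : ℕ} {f : F R I} (hf : f ∈ degLE R I n) (p : {m : I →₀ ℕ // m ≠ 0}) :
    contract p f ∈ degLE R I (n - p.1.degree) := by
  intro q hq
  rw [Finset.mem_coe, Finsupp.mem_support_iff, contract_apply] at hq
  have := hf (Finsupp.mem_support_iff.2 hq)
  simp only [Set.mem_ofPred_eq, coe_add, map_add] at this ⊢
  omega

variable (coassoc : ∀ x, TensorProduct.assoc R C C C (δ.rTensor C (δ x)) = δ.lTensor C (δ x))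
  (cocomm : ∀ x, TensorProduct.comm R C C (δ x) = δ x)
  (h_span : ∀ x, δ x = 0 → x ∈ Submodule.span R (Set.range fun i => v (Finsupp.single i 1)))

-- Compatibility of `toC` with the coproducts, with the last factor left in C. It is needed while
-- only the first factor of δ x is known to come from F.
include v_zero δ_v in
lemma assoc_rTensor_δ_toC (y : F R I ⊗[R] C) :
    TensorProduct.assoc R C C C (δ.rTensor C ((toC v).rTensor C y)) =
      (toC v).rTensor (C ⊗[R] C) (((toC v).rTensor C).lTensor (F R I)
        (TensorProduct.assoc R _ _ _ (comul.rTensor C y))) := by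
  induction y with
  | zero => simp
  | add s t hs ht => simp only [map_add, hs, ht]
  | tmul f c =>
    simp only [LinearMap.rTensor_tmul, δ_toC δ v_zero δ_v]
    generalize comul f = w
    induction w with
    | zero => simp
    | add s t hs ht => simp only [map_add, TensorProduct.add_tmul, hs, ht]
    | tmul g h => simp

-- Induction shows in turn that the first and the second factor of δ x come from divided powers. The
-- resulting element of F ⊗ F is a symmetric cocycle, hence the coproduct of some u, and x differs
-- from the image of u by a primitive element. Injectivity of `toC` and flatness transport
-- identities between C and F throughout.
include v_zero δ_v h_indep filt_zero filt_succ coassoc cocomm h_span in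
lemma exists_toC (n : ℕ) (x : C) (hx : x ∈ filt n) : ∃ f ∈ degLE R I n, toC v f = x := by
  induction n using Nat.strong_induction_on generalizing x with
  | _ n ih =>
  have inj := toC_injective (R := R) δ v_zero δ_v h_indep
  rcases n with _ | n
  · rw [filt_zero, Submodule.mem_bot] at hx
    exact ⟨0, zero_mem _, by rw [map_zero, hx]⟩
  obtain ⟨y', hy'⟩ := (filt_succ n x).1 hx
  obtain ⟨y, hyd, hy⟩ : ∃ y ∈ LinearMap.range ((degLE R I n).subtype.rTensor C),
      (toC v).rTensor C y = δ x := by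
    rw [← hy']
    clear hy'
    induction y' with
    | zero => exact ⟨0, zero_mem _, by simp⟩
    | add s t hs ht =>
      obtain ⟨y₁, h₁, e₁⟩ := hs
      obtain ⟨y₂, h₂, e₂⟩ := ht
      exact ⟨y₁ + y₂, add_mem h₁ h₂, by rw [map_add, map_add, e₁, e₂]⟩
    | tmul a c =>
      obtain ⟨f, hf, e⟩ := ih n (Nat.lt_succ_self n) a.1 a.2
      exact ⟨f ⊗ₜ c, ⟨⟨f, hf⟩ ⊗ₜ c, rfl⟩, by simp [e]⟩
  have inj₁ : Function.Injective ((toC (R := R) (I := I) v).rTensor C) :=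
    Module.Flat.rTensor_preserves_injective_linearMap _ inj
  have inj₂ : Function.Injective ((toC (R := R) (I := I) v).rTensor (C ⊗[R] C)) :=
    Module.Flat.rTensor_preserves_injective_linearMap _ inj
  have injF : Function.Injective ((toC (R := R) (I := I) v).lTensor (F R I)) :=
    Module.Flat.lTensor_preserves_injective_linearMap _ inj
  have hmap : ∀ w : F R I ⊗[R] F R I, TensorProduct.map (toC v) (toC v) w =
      (toC v).rTensor C ((toC v).lTensor (F R I) w) := fun w => by
    rw [← LinearMap.comp_apply, LinearMap.rTensor_comp_lTensor]
  have inj₀ : Function.Injective (TensorProduct.map (toC (R := R) (I := I) v) (toC v)) := by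
    intro a c h
    rw [hmap, hmap] at h
    exact injF (inj₁ h)
  -- Coassociativity at x, with the injective `toC` removed from the first tensor factor.
  have hyδ : ((toC v).rTensor C).lTensor (F R I)
      (TensorProduct.assoc R _ _ _ (comul.rTensor C y)) = δ.lTensor (F R I) y := by
    apply inj₂
    rw [← assoc_rTensor_δ_toC δ v_zero δ_v, hy, coassoc, ← hy, ← LinearMap.comp_apply,
      ← LinearMap.comp_apply, LinearMap.lTensor_comp_rTensor, LinearMap.rTensor_comp_lTensor]
  have hcoeff : ∀ p, δ (coeff R p y) = (toC v).rTensor C ((contract p).rTensor C y) := fun p => by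
    rw [← coeff_lTensor, ← hyδ, coeff_lTensor, coeff_assoc_rTensor]
  obtain ⟨w, hw⟩ : ∃ w, (toC v).lTensor (F R I) w = y := by
    refine exists_lTensor y fun p => ?_
    have hp : p.1.degree ≠ 0 := fun h => p.2 ((Finsupp.degree_eq_zero_iff _).1 h)
    -- The coproduct of the coefficient of zᵖ is a contraction of y by p, which lowers the degree of
    -- the first factor by the degree of p. Hence that coefficient lies lower in the filtration.
    have hmem : coeff R p y ∈ filt (n - p.1.degree + 1) := by
      rw [filt_succ, hcoeff]
      obtain ⟨y₀, rfl⟩ := hyd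
      clear hy hyδ hcoeff
      induction y₀ with
      | zero => simp only [map_zero]; exact zero_mem _
      | add s t hs ht => simp only [map_add]; exact add_mem hs ht
      | tmul f c =>
        exact ⟨⟨_, toC_mem_filt δ v_zero δ_v filt_zero filt_succ (contract_mem f.2 p)⟩ ⊗ₜ c, rfl⟩
    -- For n = 0 truncated subtraction gives the index 1 = n + 1, to which induction does not apply;
    -- but then δ x comes from filt 0 ⊗ C, so y = 0. For n > 0 the index is at most n because p is
    -- nonzero.
    rcases Nat.eq_zero_or_pos n with rfl | hn
    · have h0 : y = 0 := by
        apply inj₁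
        rw [hy, map_zero, ← hy']
        have : ∀ t : filt 0 ⊗[R] C, (filt 0).subtype.rTensor C t = 0 := fun t => by
          have : (filt 0).subtype = 0 := by
            ext a
            exact (Submodule.mem_bot R).1 (filt_zero.le a.2)
          rw [this, LinearMap.rTensor_zero]; rfl
        exact this _
      rw [h0, map_zero]
      exact zero_mem _
    · obtain ⟨f, -, hf⟩ := ih _ (by omega) _ hmem
      exact ⟨f, hf⟩
  have hwδ : TensorProduct.map (toC v) (toC v) w = δ x := by rw [hmap, hw, hy]
  -- Symmetry and the cocycle condition for w are those of δ x, pulled back along the injective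
  -- tensor powers of `toC`.
  obtain ⟨u, hu⟩ : ∃ u, comul u = w := by
    refine exists_comul_eq w ?_ ?_
    · apply inj₀
      rw [hwδ, TensorProduct.map_comm, hwδ]
      exact cocomm x
    · have injFF : Function.Injective (((toC (R := R) (I := I) v).rTensor C ∘ₗ
          (toC (R := R) (I := I) v).lTensor (F R I)).lTensor (F R I)) :=
        Module.Flat.lTensor_preserves_injective_linearMap _ (inj₁.comp injF)
      apply injFF
      have e₁ : (((toC (R := R) (I := I) v).rTensor C ∘ₗ
          (toC (R := R) (I := I) v).lTensor (F R I)).lTensor (F R I))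
          (TensorProduct.assoc R _ _ _ (comul.rTensor _ w)) =
          ((toC v).rTensor C).lTensor (F R I)
            (TensorProduct.assoc R _ _ _ (comul.rTensor C ((toC v).lTensor (F R I) w))) := by
        clear hw hwδ
        induction w with
        | zero => simp
        | add s t hs ht => simp only [map_add, hs, ht]
        | tmul f g =>
          simp only [LinearMap.rTensor_tmul, LinearMap.lTensor_tmul]
          generalize comul f = w
          induction w with
          | zero => simp
          | add s t hs ht => simp only [map_add, TensorProduct.add_tmul, hs, ht]
          | tmul a c => simp
      rw [e₁, hw, hyδ, ← hw, ← LinearMap.comp_apply, ← LinearMap.comp_apply,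
        ← LinearMap.lTensor_comp, ← LinearMap.lTensor_comp]
      congr 2
      refine LinearMap.ext fun f => ?_
      rw [LinearMap.comp_apply, δ_toC δ v_zero δ_v, hmap]
      rfl
  obtain ⟨f, hf⟩ : ∃ f, toC v f = x := by
    have h0 : δ (x - toC v u) = 0 := by
      rw [map_sub, δ_toC δ v_zero δ_v, hu, hwδ, sub_self]
    have : Submodule.span R (Set.range fun i => v (Finsupp.single i 1)) ≤
        LinearMap.range (toC (R := R) v) := by
      rw [Submodule.span_le]
      rintro _ ⟨i, rfl⟩
      exact ⟨z R (Finsupp.single i 1), toC_z v_zero _⟩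
    obtain ⟨g, hg⟩ := this (h_span _ h0)
    exact ⟨g + u, by rw [map_add, hg, sub_add_cancel]⟩
  -- For the degree bound, a monomial m of f of degree above n + 1 is split as (m - i) + i, with m -
  -- i of degree above n. The coefficient of z^(m - i) in y is zero because y has degree at most n
  -- in the first factor, so contracting f by m - i gives 0, contradicting the coefficient of f at
  -- m.
  refine ⟨f, fun m hm => ?_, hf⟩
  by_contra hdeg
  simp only [Set.mem_ofPred_eq, not_le] at hdeg
  obtain ⟨i, hi⟩ := Finsupp.support_nonempty_iff.2 m.2
  have hle : Finsupp.single i 1 ≤ m.1 := by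
    rw [Finsupp.single_le_iff]
    exact Nat.one_le_iff_ne_zero.2 (Finsupp.mem_support_iff.1 hi)
  have hs : Finsupp.single i 1 ≠ (0 : I →₀ ℕ) := by simp
  have e := tsub_add_cancel_of_le hle
  have hpd : n < (m.1 - Finsupp.single i 1).degree := by
    rw [← e, map_add, Finsupp.degree_single] at hdeg
    omega
  have hp : m.1 - Finsupp.single i 1 ≠ 0 := fun h => by
    rw [h, map_zero] at hpd
    omega
  have hm' : m = (⟨_, hp⟩ : {m : I →₀ ℕ // m ≠ 0}) + ⟨_, hs⟩ := Subtype.ext e.symm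
  have hyf : (toC v).lTensor (F R I) (comul f) = y := by
    apply inj₁
    rw [hy, ← hmap, ← δ_toC δ v_zero δ_v, hf]
  have hc : coeff R ⟨_, hp⟩ y = 0 := by
    obtain ⟨y₀, rfl⟩ := hyd
    clear hy hyδ hcoeff hw hyf
    induction y₀ with
    | zero => simp only [map_zero]
    | add s t hs ht => simp only [map_add, hs, ht, add_zero]
    | tmul g c =>
      rw [LinearMap.rTensor_tmul, coeff_tmul]
      have : (g : F R I) ⟨_, hp⟩ = 0 := by
        by_contra h
        exact absurd (g.2 (Finsupp.mem_support_iff.2 h)) (not_le.2 hpd)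
      rw [Submodule.subtype_apply, this, zero_smul]
  rw [← hyf, coeff_lTensor] at hc
  have h0 : contract ⟨_, hp⟩ f = 0 := inj (by rw [map_zero]; exact hc)
  rw [Finset.mem_coe, Finsupp.mem_support_iff, hm', ← contract_apply, h0] at hm
  exact hm rfl

include v_zero δ_v h_indep filt_zero filt_succ coassoc cocomm h_span in
/-- If the `v i` are a basis of the primitive elements, then divided powers of degree at most `n`
span the `n`-th term of the primitive filtration. -/
theorem filt_eq_span (n : ℕ) :
    filt n = Submodule.span R (v '' {m : I →₀ ℕ | m ≠ 0 ∧ m.degree ≤ n}) := by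
  refine le_antisymm (fun x hx => ?_) (Submodule.span_le.2 ?_)
  · obtain ⟨f, hf, rfl⟩ := exists_toC δ v_zero δ_v h_indep filt_zero filt_succ coassoc cocomm
      h_span n x hx
    rw [toC, Finsupp.linearCombination_apply]
    exact Submodule.sum_mem _ fun m hm => Submodule.smul_mem _ _
      (Submodule.subset_span ⟨m.1, ⟨m.2, hf hm⟩, rfl⟩)
  · rintro _ ⟨m, hm, rfl⟩
    exact mem_filt δ v_zero δ_v filt_zero filt_succ hm.2

end Filtration

end DivPow

/-! ### Bialgebras generated by a basis of the primitive elements -/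

section ReducedCoproduct

variable {R A : Type u} [CommRing R] [Ring A] [Module R A] [IsScalarTower R A A]
  [Coalgebra R A] [IsRBialgebra R A]

lemma augProj_one : augProj R A 1 = 0 := by
  ext
  rw [coe_augProj, IsRBialgebra.counit_one, one_smul, sub_self]
  rfl

/-- The projection kills 1, so the reduced coproduct is the image of Δ under a surjection onto the
augmentation ideal. Coassociativity and cocommutativity descend along it. -/
lemma redComul_augProj (a : A) : redComul R A (augProj R A a) =
    TensorProduct.map (augProj R A) (augProj R A) (Coalgebra.comul (R := R) a) := by
  change TensorProduct.map (augProj R A) (augProj R A)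
    (Coalgebra.comul (R := R) (augProj R A a : A)) = _
  rw [coe_augProj, map_sub, map_smul, IsRBialgebra.comul_one, map_sub, map_smul,
    TensorProduct.map_tmul, augProj_one, TensorProduct.zero_tmul, smul_zero]
  exact sub_zero (TensorProduct.map (augProj R A) (augProj R A) (Coalgebra.comul (R := R) a))

lemma redComul_comp_augProj : redComul R A ∘ₗ augProj R A =
    TensorProduct.map (augProj R A) (augProj R A) ∘ₗ Coalgebra.comul :=
  LinearMap.ext redComul_augProj

lemma augProj_surjective : Function.Surjective (augProj R A) := fun s => ⟨s, augProj_coe s⟩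

lemma redComul_comm (s : augKer R A) :
    TensorProduct.comm R _ _ (redComul R A s) = redComul R A s := by
  obtain ⟨a, rfl⟩ := augProj_surjective s
  rw [redComul_augProj, ← TensorProduct.map_comm]
  congr 1
  exact LinearMap.congr_fun (Coalgebra.IsCocomm.comm_comp_comul (R := R) (A := A)) a

lemma redComul_coassoc (s : augKer R A) :
    TensorProduct.assoc R _ _ _ ((redComul R A).rTensor _ (redComul R A s)) =
      (redComul R A).lTensor _ (redComul R A s) := by
  obtain ⟨a, rfl⟩ := augProj_surjective s
  have h1 : (redComul R A).rTensor _ ∘ₗ TensorProduct.map (augProj R A) (augProj R A) =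
      TensorProduct.map (TensorProduct.map (augProj R A) (augProj R A)) (augProj R A) ∘ₗ
        (Coalgebra.comul (R := R) (A := A)).rTensor A := by
    rw [LinearMap.rTensor_comp_map, redComul_comp_augProj, LinearMap.map_comp_rTensor]
  have h2 : (redComul R A).lTensor _ ∘ₗ TensorProduct.map (augProj R A) (augProj R A) =
      TensorProduct.map (augProj R A) (TensorProduct.map (augProj R A) (augProj R A)) ∘ₗ
        (Coalgebra.comul (R := R) (A := A)).lTensor A := by
    rw [LinearMap.lTensor_comp_map, redComul_comp_augProj, LinearMap.map_comp_lTensor]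
  have h3 : ∀ t : (A ⊗[R] A) ⊗[R] A, TensorProduct.assoc R _ _ _
      (TensorProduct.map (TensorProduct.map (augProj R A) (augProj R A)) (augProj R A) t) =
      TensorProduct.map (augProj R A) (TensorProduct.map (augProj R A) (augProj R A))
        (TensorProduct.assoc R _ _ _ t) := fun t =>
    LinearMap.congr_fun (TensorProduct.map_map_comp_assoc_eq _ _ _).symm t
  rw [redComul_augProj, ← LinearMap.comp_apply, h1, LinearMap.comp_apply, h3,
    ← LinearMap.comp_apply (LinearMap.lTensor _ _), h2, LinearMap.comp_apply,
    Coalgebra.coassoc_apply]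

lemma iterComul_one_apply (s : augKer R A) : iterComul R A 1 s = redComul R A s := by
  change (LinearMap.rTensor (augKer R A) LinearMap.id) (redComul R A s) = redComul R A s
  rw [LinearMap.rTensor_id]; rfl

instance flat_augKer [Module.Flat R A] : Module.Flat R (augKer R A) :=
  Module.Flat.of_retract (augKer R A).subtype (augProj R A) (LinearMap.ext augProj_coe)

lemma rTensor_eq_zero_iff_of_flat {M N P : Type*} [AddCommGroup M] [AddCommGroup N]
    [AddCommGroup P] [Module R M] [Module R N] [Module R P] [Module.Flat R P] (f : M →ₗ[R] N)
    (t : M ⊗[R] P) :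
    f.rTensor P t = 0 ↔ t ∈ LinearMap.range ((LinearMap.ker f).subtype.rTensor P) :=
  Module.Flat.rTensor_exact P f.exact_subtype_ker_map t

/-- Tensoring with the flat augmentation ideal preserves kernels. This is the recursive description
of the filtration on which the divided power argument is based. -/
lemma mem_ker_iterComul_succ [Module.Flat R A] (n : ℕ) (s : augKer R A) :
    s ∈ LinearMap.ker (iterComul R A (n + 1)) ↔ redComul R A s ∈
      LinearMap.range ((LinearMap.ker (iterComul R A n)).subtype.rTensor (augKer R A)) := by
  exact rTensor_eq_zero_iff_of_flat (iterComul R A n) (redComul R A s)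

/-- The coproduct of a product with a primitive element. -/
lemma comul_prim_mul {p : A} (hp : p ∈ primFil R A 1) {a : A} {ι : Type*} (S : Finset ι)
    (f g : ι → A) (h : Coalgebra.comul (R := R) a = ∑ x ∈ S, f x ⊗ₜ g x) :
    Coalgebra.comul (R := R) (p * a) = ∑ x ∈ S, ((p * f x) ⊗ₜ g x + f x ⊗ₜ (p * g x)) := by
  -- The multiplicativity axiom is stated for families indexed by `Fin n`, so the sum is reindexed.
  have e : ∀ {M : Type u} [AddCommMonoid M] (F : ι → M),
      ∑ x ∈ S, F x = ∑ i : Fin S.card, F (S.equivFin.symm i) := fun F => by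
    rw [← Finset.sum_coe_sort, ← S.equivFin.symm.sum_comp]
  rw [e] at h
  rw [IsRBialgebra.comul_mul p a _ _ _ h, e]
  refine Finset.sum_congr rfl fun i _ => ?_
  rw [(mem_primFil_one p).1 hp, rmul, map_add, TensorProduct.map_tmul, TensorProduct.map_tmul]
  simp

lemma counit_prim_mul_eq_zero (p : A) {a : A}
    (ha : Coalgebra.counit (R := R) a = 0) : Coalgebra.counit (R := R) (p * a) = 0 := by
  rw [IsRBialgebra.counit_mul, ha, zero_smul, mul_zero, map_zero]

end ReducedCoproduct

/-! ### Divided powers of primitive elements in characteristic zero. -/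

section DividedPowers

open Finset.HasAntidiagonal (antidiagonal mem_antidiagonal)

/-- On the right the terms with x.1 i = 0 vanish, and the others arise by adding i to the first
summand. This is the bookkeeping for eᵢ e⁽ᵖ⁾ = (pᵢ + 1) e⁽ᵖ⁺ⁱ⁾. -/
lemma sum_antidiagonal_add_single {I M : Type*} [DecidableEq I] [AddCommMonoid M] (m : I →₀ ℕ)
    (i : I) (G : (I →₀ ℕ) → (I →₀ ℕ) → M) :
    ∑ x ∈ antidiagonal m, (x.1 i + 1) • G (x.1 + Finsupp.single i 1) x.2 =
      ∑ x ∈ antidiagonal (m + Finsupp.single i 1 : I →₀ ℕ), x.1 i • G x.1 x.2 := by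
  rw [← Finset.sum_filter_of_ne (s := antidiagonal (m + Finsupp.single i 1 : I →₀ ℕ))
    (p := fun x : (I →₀ ℕ) × (I →₀ ℕ) => x.1 i ≠ 0)]
  · refine Finset.sum_bij' (fun x _ => (x.1 + Finsupp.single i 1, x.2))
      (fun x _ => (x.1 - Finsupp.single i 1, x.2)) ?_ ?_ ?_ ?_ ?_
    · intro x hx
      rw [Finset.mem_filter, mem_antidiagonal, ← mem_antidiagonal.1 hx]
      refine ⟨add_right_comm _ _ _, by simp⟩
    · intro x hx
      rw [Finset.mem_filter, mem_antidiagonal] at hx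
      have hle : Finsupp.single i 1 ≤ x.1 := by
        rw [Finsupp.single_le_iff]
        exact Nat.one_le_iff_ne_zero.2 hx.2
      rw [mem_antidiagonal]
      apply add_right_cancel (b := Finsupp.single i 1)
      rw [← hx.1]
      change x.1 - Finsupp.single i 1 + x.2 + Finsupp.single i 1 = x.1 + x.2
      rw [add_right_comm, tsub_add_cancel_of_le hle]
    · intro x _
      simp
    · intro x hx
      rw [Finset.mem_filter, mem_antidiagonal] at hx
      have hle : Finsupp.single i 1 ≤ x.1 := by
        rw [Finsupp.single_le_iff]
        exact Nat.one_le_iff_ne_zero.2 hx.2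
      simp [tsub_add_cancel_of_le hle]
    · intro x _
      simp
  · intro x _ hx h
    rw [h, zero_smul] at hx
    exact hx rfl

lemma sum_antidiagonal_swap {I M : Type*} [DecidableEq I] [AddCommMonoid M] (m : I →₀ ℕ)
    (G : (I →₀ ℕ) → (I →₀ ℕ) → M) :
    ∑ x ∈ antidiagonal m, G x.2 x.1 = ∑ x ∈ antidiagonal m, G x.1 x.2 :=
  Finset.sum_equiv (Equiv.prodComm _ _) (fun x => by
    rw [mem_antidiagonal, mem_antidiagonal, add_comm]; rfl) fun _ _ => rfl

/-- The product of the factorials of the exponents of a monomial. -/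
def monFactorial (K : Type*) [Field K] {I : Type*} (m : I →₀ ℕ) : K :=
  m.prod fun _ k => (k.factorial : K)

lemma monFactorial_ne_zero (K : Type*) [Field K] [CharZero K] {I : Type*} (m : I →₀ ℕ) :
    monFactorial K m ≠ 0 :=
  Finset.prod_ne_zero_iff.2 fun _ _ => Nat.cast_ne_zero.2 (Nat.factorial_ne_zero _)

lemma monFactorial_add_single (K : Type*) [Field K] {I : Type*} [DecidableEq I] (m : I →₀ ℕ)
    (i : I) : monFactorial K (m + Finsupp.single i 1) = ((m i + 1 : ℕ) : K) * monFactorial K m := by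
  have h : ∀ m' : I →₀ ℕ, m'.support ⊆ insert i m.support → monFactorial K m' =
      (m' i).factorial * ∏ j ∈ m.support.erase i, ((m' j).factorial : K) := fun m' hm' => by
    rw [monFactorial, Finsupp.prod_of_support_subset m' hm' _ (by simp), ← Finset.insert_erase
      (Finset.mem_insert_self i m.support), Finset.prod_insert (by simp)]
    simp
  rw [h m (Finset.subset_insert _ _), h (m + Finsupp.single i 1) ?_]
  · have : ∏ j ∈ m.support.erase i, (((m + Finsupp.single i 1 : I →₀ ℕ) j).factorial : K) =
        ∏ j ∈ m.support.erase i, ((m j).factorial : K) :=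
      Finset.prod_congr rfl fun j hj => by
        simp [(Finset.mem_erase.1 hj).1.symm]
    rw [this, Finsupp.add_apply, Finsupp.single_eq_same, Nat.factorial_succ]
    push_cast
    ring
  · intro j hj
    by_contra h
    simp only [Finset.mem_insert, Finsupp.mem_support_iff, not_or, not_not] at h
    simp [h.2, Ne.symm h.1] at hj

variable {K R A I : Type u} [Field K] [CharZero K] [CommRing R] [Algebra K R] [Ring A]
  [Algebra K A] [Module R A] [IsScalarTower K R A] [IsScalarTower R A A] [LinearOrder I]

variable (K R) in
/-- The divided power `eᵐ / m!`. -/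
def divPow (e : I → A) (m : I →₀ ℕ) : A :=
  algebraMap K R (monFactorial K m)⁻¹ • PBW.mon e m

lemma algebraMap_smul_divPow (e : I → A) (m : I →₀ ℕ) :
    algebraMap K R (monFactorial K m) • divPow K R e m = PBW.mon e m := by
  rw [divPow, smul_smul, ← map_mul, mul_inv_cancel₀ (monFactorial_ne_zero K m), map_one, one_smul]

lemma divPow_zero (e : I → A) : divPow K R e 0 = 1 := by
  simp [divPow, monFactorial, PBW.mon_zero]

lemma divPow_single (e : I → A) (i : I) : divPow K R e (Finsupp.single i 1) = e i := by
  simp [divPow, monFactorial, PBW.mon_single]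

lemma mul_divPow (e : I → A) {i : I} {m : I →₀ ℕ} (h : ∀ j ∈ m.support, i ≤ j) :
    e i * divPow K R e m = (m i + 1) • divPow K R e (m + Finsupp.single i 1) := by
  rw [divPow, divPow, PBW.mon_add_single e h, algebraMap_smul, algebraMap_smul,
    monFactorial_add_single, mul_smul_comm, ← Nat.cast_smul_eq_nsmul K, smul_smul, mul_inv,
    ← mul_assoc, mul_inv_cancel₀ (Nat.cast_ne_zero.2 (Nat.succ_ne_zero _)), one_mul]

variable [Coalgebra R A] [IsRBialgebra R A] {e : I → A} (he : ∀ i, e i ∈ primFil R A 1)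

-- Multiply the formula for m by a primitive eᵢ with i at most all variables of m. Every p and q
-- with p + q = m has this property too, so no reordering is needed; the two Leibniz terms
-- contribute pᵢ + qᵢ = mᵢ + 1 copies of each summand, and this number can be cancelled.
include he in
lemma comul_divPow (m : I →₀ ℕ) : Coalgebra.comul (R := R) (divPow K R e m) =
    ∑ x ∈ antidiagonal m, divPow K R e x.1 ⊗ₜ[R] divPow K R e x.2 := by
  induction m using PBW.mon_induction with
  | zero =>
    rw [divPow_zero, IsRBialgebra.comul_one, show antidiagonal (0 : I →₀ ℕ) = {(0, 0)} from
      Finset.HasAntidiagonal.antidiagonal_zero, Finset.sum_singleton, divPow_zero]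
  | add i m h ih =>
    have hsub : ∀ {p q : I →₀ ℕ}, p + q = m → ∀ j ∈ p.support, i ≤ j := fun {p q} hpq j hj =>
      h j (Finsupp.support_mono (hpq ▸ le_self_add) hj)
    have h1 := comul_prim_mul (he i) _ _ _ ih
    rw [mul_divPow e h, Finset.sum_add_distrib] at h1
    have h2 : ∑ x ∈ antidiagonal m, (e i * divPow K R e x.1) ⊗ₜ[R] divPow K R e x.2 =
        ∑ x ∈ antidiagonal (m + Finsupp.single i 1 : I →₀ ℕ),
          x.1 i • (divPow K R e x.1 ⊗ₜ[R] divPow K R e x.2) := by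
      rw [← sum_antidiagonal_add_single m i fun p q => divPow K R e p ⊗ₜ[R] divPow K R e q]
      refine Finset.sum_congr rfl fun x hx => ?_
      rw [mul_divPow e (hsub (mem_antidiagonal.1 hx)), TensorProduct.smul_tmul']
    have h3 : ∑ x ∈ antidiagonal m, divPow K R e x.1 ⊗ₜ[R] (e i * divPow K R e x.2) =
        ∑ x ∈ antidiagonal (m + Finsupp.single i 1 : I →₀ ℕ),
          x.2 i • (divPow K R e x.1 ⊗ₜ[R] divPow K R e x.2) := by
      rw [← sum_antidiagonal_swap m fun p q => divPow K R e p ⊗ₜ[R] (e i * divPow K R e q),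
        ← sum_antidiagonal_swap (m + _) fun p q =>
          q i • (divPow K R e p ⊗ₜ[R] divPow K R e q),
        ← sum_antidiagonal_add_single m i fun p q => divPow K R e q ⊗ₜ[R] divPow K R e p]
      refine Finset.sum_congr rfl fun x hx => ?_
      rw [mul_divPow e (hsub (mem_antidiagonal.1 hx)), TensorProduct.tmul_smul]
    rw [h2, h3, ← Finset.sum_add_distrib] at h1
    have h4 : ∀ x ∈ antidiagonal (m + Finsupp.single i 1 : I →₀ ℕ),
        x.1 i • (divPow K R e x.1 ⊗ₜ[R] divPow K R e x.2) +
          x.2 i • (divPow K R e x.1 ⊗ₜ[R] divPow K R e x.2) =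
        (m i + 1) • (divPow K R e x.1 ⊗ₜ[R] divPow K R e x.2) := fun x hx => by
      rw [← add_smul, ← Finsupp.add_apply, mem_antidiagonal.1 hx]
      simp
    rw [Finset.sum_congr rfl h4, ← Finset.smul_sum, map_nsmul, ← Nat.cast_smul_eq_nsmul R,
      ← Nat.cast_smul_eq_nsmul R] at h1
    -- Characteristic zero enters here: mᵢ + 1 is invertible in K, hence in R.
    have hu : IsUnit ((m i + 1 : ℕ) : R) := by
      rw [← map_natCast (algebraMap K R)]
      exact (Ne.isUnit (Nat.cast_ne_zero.2 (Nat.succ_ne_zero _))).map _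
    exact hu.smul_left_cancel.1 h1

include he in
lemma counit_mon {m : I →₀ ℕ} (hm : m ≠ 0) : Coalgebra.counit (R := R) (PBW.mon e m) = 0 := by
  induction m using PBW.mon_induction with
  | zero => exact absurd rfl hm
  | add i m h ih =>
    by_cases h0 : m = 0
    · rw [h0, zero_add, PBW.mon_single]
      exact counit_of_prim (he i)
    · rw [PBW.mon_add_single e h]
      exact counit_prim_mul_eq_zero _ (ih h0)

include he in
lemma counit_divPow {m : I →₀ ℕ} (hm : m ≠ 0) :
    Coalgebra.counit (R := R) (divPow K R e m) = 0 := by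
  rw [divPow, map_smul, counit_mon he hm, smul_zero]

variable (K R) in
/-- The projection of a divided power to the augmentation ideal. -/
def redPow (e : I → A) (m : I →₀ ℕ) : augKer R A := augProj R A (divPow K R e m)

lemma redPow_zero (e : I → A) : redPow K R e 0 = 0 := by
  rw [redPow, divPow_zero, augProj_one]

include he in
lemma coe_redPow {m : I →₀ ℕ} (hm : m ≠ 0) : (redPow K R e m : A) = divPow K R e m := by
  rw [redPow, coe_augProj, counit_divPow he hm, zero_smul, sub_zero]

include he in
lemma redComul_redPow (m : I →₀ ℕ) : redComul R A (redPow K R e m) =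
    ∑ x ∈ antidiagonal m, redPow K R e x.1 ⊗ₜ[R] redPow K R e x.2 := by
  rw [redPow, redComul_augProj, comul_divPow he, map_sum]
  rfl

include he in
lemma coe_redPow_single (i : I) : (redPow K R e (Finsupp.single i 1) : A) = e i := by
  rw [coe_redPow he (by simp), divPow_single]

lemma span_image_divPow (s : Set (I →₀ ℕ)) :
    Submodule.span R (divPow K R e '' s) = Submodule.span R (PBW.mon e '' s) := by
  apply le_antisymm <;> rw [Submodule.span_le] <;> rintro _ ⟨m, hm, rfl⟩
  · exact Submodule.smul_mem _ _ (Submodule.subset_span ⟨m, hm, rfl⟩)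
  · rw [← algebraMap_smul_divPow (K := K) (R := R)]
    exact Submodule.smul_mem _ _ (Submodule.subset_span ⟨m, hm, rfl⟩)

lemma linearIndependent_divPow_iff :
    LinearIndependent R (divPow K R e) ↔ LinearIndependent R (PBW.mon e) := by
  let w : (I →₀ ℕ) → Rˣ := fun m =>
    Units.map (algebraMap K R).toMonoidHom (Units.mk0 _ (monFactorial_ne_zero K m))
  constructor
  · intro h
    convert h.units_smul w using 1
    ext m
    exact (algebraMap_smul_divPow e m).symm
  · intro h
    convert h.units_smul (fun m => (w m)⁻¹) using 1
    ext m
    change _ = ((w m)⁻¹ : Rˣ) • PBW.mon e m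
    rw [← algebraMap_smul_divPow (K := K) (R := R) e m, eq_inv_smul_iff]
    rfl

-- The counit kills every divided power except the zeroth, which is 1; so it detects the coefficient
-- of 1 in a relation and splits that term off.
include he in
lemma linearIndependent_divPow_iff_redPow :
    LinearIndependent R (divPow K R e) ↔ LinearIndepOn R (redPow K R e) {m : I →₀ ℕ | m ≠ 0} := by
  have hc : LinearIndepOn R (redPow K R e) {m : I →₀ ℕ | m ≠ 0} ↔
      LinearIndepOn R (divPow K R e) {m : I →₀ ℕ | m ≠ 0} := by
    rw [LinearIndepOn, LinearIndepOn,
      ← LinearMap.linearIndependent_iff (augKer R A).subtype (Submodule.ker_subtype _)]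
    have : (augKer R A).subtype ∘ (fun m : {m : I →₀ ℕ | m ≠ 0} => redPow K R e m) =
        fun m : {m : I →₀ ℕ | m ≠ 0} => divPow K R e m := funext fun m => coe_redPow he m.2
    rw [this]
  rw [hc]
  refine ⟨fun h => h.linearIndepOn _, fun h => ?_⟩
  rw [linearIndependent_iff']
  intro t g h0
  have g0 : 0 ∈ t → g 0 = 0 := fun ht => by
    have := congrArg (Coalgebra.counit (R := R)) h0
    rw [map_sum, map_zero, Finset.sum_eq_single 0] at this
    · simpa [divPow_zero, IsRBialgebra.counit_one] using this
    · intro m _ hm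
      rw [map_smul, counit_divPow he hm, smul_zero]
    · exact fun hn => absurd ht hn
  intro m hm
  by_cases hm0 : m = 0
  · rw [hm0]; exact g0 (hm0 ▸ hm)
  · refine linearIndepOn_iff'.1 h (t.filter (· ≠ 0)) g (fun m hm => (Finset.mem_filter.1 hm).2) ?_ m
      (Finset.mem_filter.2 ⟨hm, hm0⟩)
    rw [Finset.sum_filter_of_ne, h0]
    rintro m hm hne rfl
    rw [g0 hm, zero_smul] at hne
    exact hne rfl

/-! ### Independent primitive elements of a flat bialgebra. -/

section Basis

variable [Module.Flat R A] (h_indep : LinearIndependent R e)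

include he h_indep in
lemma linearIndependent_redPow_single :
    LinearIndependent R fun i => redPow K R e (Finsupp.single i 1) := by
  rw [← LinearMap.linearIndependent_iff (augKer R A).subtype (Submodule.ker_subtype _)]
  have : (augKer R A).subtype ∘ (fun i => redPow K R e (Finsupp.single i 1)) = e :=
    funext fun i => coe_redPow_single he i
  rwa [this]

include K he h_indep in
/-- The ordered monomials in linearly independent primitive elements of a flat bialgebra are
linearly independent. -/
theorem linearIndependent_mon : LinearIndependent R (PBW.mon e) := by
  rw [← linearIndependent_divPow_iff (K := K), linearIndependent_divPow_iff_redPow he]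
  exact DivPow.linearIndepOn_ne_zero (redComul R A) (redPow_zero e) (redComul_redPow he)
    (linearIndependent_redPow_single he h_indep)

include K he h_indep in
/-- If the `e i` are a basis of the primitive elements of a flat bialgebra, then the ordered
monomials of degree at most `n` span the `n`-th term of the primitive filtration. -/
theorem primFil_eq_span (h_span : primFil R A 1 ≤ Submodule.span R (Set.range e)) (n : ℕ) :
    primFil R A n = Submodule.span R (PBW.mon e '' {m : I →₀ ℕ | m ≠ 0 ∧ m.degree ≤ n}) := by
  have h := DivPow.filt_eq_span (redComul R A) (redPow_zero e) (redComul_redPow (K := K) he)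
    (linearIndependent_redPow_single he h_indep)
    (filt := fun n => LinearMap.ker (iterComul R A n)) LinearMap.ker_id
    mem_ker_iterComul_succ redComul_coassoc redComul_comm (fun s hs => by
      have h1 : (s : A) ∈ primFil R A 1 := ⟨s, (iterComul_one_apply s).trans hs, rfl⟩
      have h2 : Submodule.span R (Set.range e) = (Submodule.span R (Set.range fun i =>
          redPow K R e (Finsupp.single i 1))).map (augKer R A).subtype := by
        rw [Submodule.map_span, ← Set.range_comp]
        congr 2
        exact (funext fun i => coe_redPow_single he i).symm
      have h3 := h_span h1
      rw [h2] at h3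
      obtain ⟨t, ht, hts⟩ := h3
      rwa [← Subtype.ext hts]) n
  rw [primFil, h, Submodule.map_span, ← span_image_divPow (K := K)]
  congr 1
  rw [← Set.image_comp]
  exact Set.image_congr fun m hm => coe_redPow he hm.1

end Basis

include K he in
/-- If the ordered monomials in primitive elements `e i` are a basis, then the `e i` are a basis of
the primitive elements. -/
theorem primFil_one_le_span (h_indep : LinearIndependent R (PBW.mon e))
    (h_span : Submodule.span R (Set.range (PBW.mon e)) = ⊤) :
    primFil R A 1 ≤ Submodule.span R (Set.range e) := by
  -- The monomial basis makes A free, which supplies the flatness used by the divided power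
  -- argument.
  have : Module.Free R A := Module.Free.of_basis (Module.Basis.mk h_indep h_span.ge)
  rintro _ ⟨s, hs, rfl⟩
  have h1 : s ∈ LinearMap.range (DivPow.toC (R := R) (redPow K R e)) := by
    have h2 : (s : A) ∈ Submodule.span R (divPow K R e '' Set.univ) := by
      rw [span_image_divPow, Set.image_univ, h_span]; trivial
    have h3 := Submodule.mem_map_of_mem (f := augProj R A) h2
    rw [augProj_coe, Submodule.map_span, ← Set.image_comp] at h3
    refine Submodule.span_le.2 ?_ h3
    rintro _ ⟨m, -, rfl⟩
    exact ⟨DivPow.z R m, DivPow.toC_z (redPow_zero e) m⟩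
  have h4 := DivPow.mem_span_of_δ_eq_zero (redComul R A) (redPow_zero e)
    (redComul_redPow (K := K) he) ((linearIndependent_divPow_iff_redPow he).1
      (linearIndependent_divPow_iff.2 h_indep)) h1 ((iterComul_one_apply s).symm.trans hs)
  have h5 := Submodule.mem_map_of_mem (f := (augKer R A).subtype) h4
  rw [Submodule.map_span, ← Set.range_comp] at h5
  have h6 : (augKer R A).subtype ∘ (fun i => redPow K R e (Finsupp.single i 1)) = e :=
    funext fun i => coe_redPow_single he i
  rwa [h6] at h5

end DividedPowers

/-! ### The primitive filtration -/

section FiltrationLemmas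

variable {R M : Type*} [CommRing R] [AddCommGroup M] [Module R M]

/-- By the equational criterion: a linear relation involves finitely many elements, so it lives in
one F n and is already trivial there. -/
lemma flat_of_monotone_of_flat (F : ℕ → Submodule R M) (hF : Monotone F)
    (hflat : ∀ n, Module.Flat R (F n)) (h : ∀ x, ∃ n, x ∈ F n) : Module.Flat R M := by
  refine Module.Flat.of_forall_isTrivialRelation fun {l f x} hx => ?_
  choose n hn using fun i => h (x i)
  have hN : ∀ i, x i ∈ F (Finset.univ.sup n) := fun i =>
    hF (Finset.le_sup (Finset.mem_univ i)) (hn i)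
  have h0 : ∑ i, f i • (⟨x i, hN i⟩ : F (Finset.univ.sup n)) = 0 := Subtype.ext (by simpa using hx)
  have := hflat (Finset.univ.sup n)
  obtain ⟨k, a, y, h1, h2⟩ := Module.Flat.isTrivialRelation_of_sum_smul_eq_zero h0
  exact ⟨k, a, fun j => y j, fun i => by simpa using congrArg Subtype.val (h1 i), h2⟩

/-! ### Bases of subquotients from a basis adapted to submodules. -/

section Quotient

variable {J J' : Type*} {v : J → M} {S T : Set J} {P Q : Submodule R M}
  (hP : P = Submodule.span R (v '' T)) (hQ : Q = Submodule.span R (v '' S)) (f : J' → J)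
  (hf : ∀ j, v (f j) ∈ P)

include hQ in
/-- The classes of the remaining elements of a linearly independent family in the quotient by the
span of a subfamily are linearly independent. -/
lemma linearIndependent_mk_of_span (hv : LinearIndependent R v) (hf_inj : Function.Injective f)
    (hf_not : ∀ j, f j ∉ S) : LinearIndependent R fun j =>
      (Submodule.Quotient.mk ⟨v (f j), hf j⟩ : P ⧸ Q.submoduleOf P) := by
  rw [linearIndependent_iff']
  intro t g h0
  have h1 : (∑ j ∈ t, g j • (⟨v (f j), hf j⟩ : P)) ∈ Q.submoduleOf P := by
    rw [← Submodule.Quotient.mk_eq_zero, ← h0, ← Submodule.mkQ_apply, map_sum]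
    rfl
  replace h1 : ((∑ j ∈ t, g j • (⟨v (f j), hf j⟩ : P) : P) : M) ∈ Q := h1
  rw [hQ] at h1
  have h2 : ((∑ j ∈ t, g j • (⟨v (f j), hf j⟩ : P) : P) : M) = ∑ j ∈ t, g j • v (f j) := by simp
  rw [h2] at h1
  have h3 : ∑ j ∈ t, g j • v (f j) ∈ Submodule.span R (v '' Sᶜ) :=
    Submodule.sum_mem _ fun j _ => Submodule.smul_mem _ _ (Submodule.subset_span ⟨_, hf_not j, rfl⟩)
  have h4 := Submodule.disjoint_def.1 (hv.disjoint_span_image disjoint_compl_right) _ h1 h3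
  exact linearIndependent_iff'.1 (hv.comp f hf_inj) t g h4

include hP hQ in
lemma span_mk_of_span (hf_range : ∀ j ∈ T, j ∉ S → j ∈ Set.range f) :
    Submodule.span R (Set.range fun j =>
      (Submodule.Quotient.mk ⟨v (f j), hf j⟩ : P ⧸ Q.submoduleOf P)) = ⊤ := by
  have key : ∀ p ∈ Submodule.span R (v '' T), ∀ hp : p ∈ P,
      (Submodule.Quotient.mk ⟨p, hp⟩ : P ⧸ Q.submoduleOf P) ∈ Submodule.span R (Set.range fun j =>
        (Submodule.Quotient.mk ⟨v (f j), hf j⟩ : P ⧸ Q.submoduleOf P)) := by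
    intro p hp
    induction hp using Submodule.span_induction with
    | mem _ h =>
      obtain ⟨j, hj, rfl⟩ := h
      intro hp
      by_cases hS : j ∈ S
      · have : (Submodule.Quotient.mk ⟨v j, hp⟩ : P ⧸ Q.submoduleOf P) = 0 := by
          rw [Submodule.Quotient.mk_eq_zero]
          exact hQ.ge (Submodule.subset_span ⟨j, hS, rfl⟩)
        rw [this]
        exact zero_mem _
      · obtain ⟨k, rfl⟩ := hf_range j hj hS
        exact Submodule.subset_span ⟨k, rfl⟩
    | zero => exact fun hp => zero_mem _
    | add a b ha hb iha ihb =>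
      intro hp
      exact add_mem (iha (hP ▸ ha)) (ihb (hP ▸ hb))
    | smul r a ha iha =>
      intro hp
      exact Submodule.smul_mem _ r (iha (hP ▸ ha))
  rw [eq_top_iff]
  rintro q -
  obtain ⟨⟨p, hp⟩, rfl⟩ := Submodule.Quotient.mk_surjective _ q
  exact key p (hP ▸ hp) hp

end Quotient

end FiltrationLemmas

/-! ### Monotonicity, freeness and flatness. -/

section PrimitiveFiltration

variable {R A : Type u} [CommRing R] [Ring A] [Module R A] [IsScalarTower R A A]
  [Coalgebra R A] [IsRBialgebra R A]

/-- Each further reduced coproduct acts on the factors already produced, so the iterates factor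
through one another and their kernels increase. -/
lemma exists_iterComul_succ (n : ℕ) : ∃ T : augPow R A n →ₗ[R] augPow R A (n + 1),
    ∀ s, iterComul R A (n + 1) s = T (iterComul R A n s) := by
  induction n with
  | zero => exact ⟨iterComul R A 1, fun s => rfl⟩
  | succ n ih =>
    obtain ⟨T, hT⟩ := ih
    have hT' : iterComul R A (n + 1) = T ∘ₗ iterComul R A n := LinearMap.ext hT
    refine ⟨T.rTensor (augKer R A), fun s => ?_⟩
    change (iterComul R A (n + 1)).rTensor (augKer R A) (redComul R A s) =
      T.rTensor (augKer R A) ((iterComul R A n).rTensor (augKer R A) (redComul R A s))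
    rw [hT', LinearMap.rTensor_comp, LinearMap.comp_apply]

lemma primFil_mono : Monotone (primFil R A) := monotone_nat_of_le_succ fun n => by
  refine Submodule.map_mono fun s hs => ?_
  obtain ⟨T, hT⟩ := exists_iterComul_succ (R := R) (A := A) n
  rw [LinearMap.mem_ker] at hs ⊢
  rw [hT, hs, map_zero]

lemma primFil_zero : primFil R A 0 = ⊥ := by
  have : LinearMap.ker (iterComul R A 0) = ⊥ := LinearMap.ker_id
  rw [primFil, this, Submodule.map_bot]

lemma counit_of_mem_primFil {n : ℕ} {a : A} (ha : a ∈ primFil R A n) :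
    Coalgebra.counit (R := R) a = 0 := by
  obtain ⟨s, -, rfl⟩ := ha
  exact s.2

/-- Each term is an extension of a free subquotient by the preceding free term; a basis of the
submodule and lifts of a basis of the quotient together form a basis. -/
lemma free_primFil (h : ∀ n, Module.Free R (primGr R A n)) (n : ℕ) :
    Module.Free R (primFil R A n) := by
  induction n with
  | zero => rw [primFil_zero]; infer_instance
  | succ n ih =>
    have := h n
    have : Module.Free R ((primFil R A n).submoduleOf (primFil R A (n + 1))) :=
      Module.Free.of_equiv (Submodule.submoduleOfEquivOfLe (primFil_mono n.le_succ)).symm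
    exact Module.Free.of_basis (Module.Basis.sumQuot
      (Module.Free.chooseBasis R ((primFil R A n).submoduleOf (primFil R A (n + 1))))
      (Module.Free.chooseBasis R (primGr R A n)))

/-- The counit is zero on the filtration and recovers r from r • 1, so the sum is direct and the
first summand is a copy of R. -/
lemma free_span_one_sup_primFil (n : ℕ) (h : Module.Free R (primFil R A n)) :
    Module.Free R (Submodule.span R {(1 : A)} ⊔ primFil R A n : Submodule R A) := by
  let f : R × primFil R A n →ₗ[R] A :=
    (LinearMap.toSpanSingleton R A 1).coprod (primFil R A n).subtype
  have hr : LinearMap.range f = Submodule.span R {(1 : A)} ⊔ primFil R A n := by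
    rw [LinearMap.range_coprod, LinearMap.range_toSpanSingleton, Submodule.range_subtype]
  have hf : Function.Injective f := by
    rw [← LinearMap.ker_eq_bot, LinearMap.ker_eq_bot']
    rintro ⟨r, p⟩ h0
    have h0' : r • (1 : A) + (p : A) = 0 := h0
    have h1 : r = 0 := by
      have := congrArg (Coalgebra.counit (R := R)) h0'
      rwa [map_add, map_zero, counit_smul_one, counit_of_mem_primFil p.2, add_zero] at this
    rw [h1, zero_smul, zero_add] at h0'
    exact Prod.ext h1 (Subtype.ext h0')
  rw [← hr]
  exact Module.Free.of_equiv (LinearEquiv.ofInjective f hf)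

/-- A bialgebra which is the union of its primitive filtration is flat if the associated graded
module is free. -/
theorem flat_of_free_primGr (h : ∀ n, Module.Free R (primGr R A n))
    (hc : ∀ a : A, ∃ n, a ∈ Submodule.span R {(1 : A)} ⊔ primFil R A n) : Module.Flat R A :=
  flat_of_monotone_of_flat (fun n => Submodule.span R {(1 : A)} ⊔ primFil R A n)
    (fun _ _ hmn => sup_le_sup_left (primFil_mono hmn) _)
    (fun n => by
      have := free_span_one_sup_primFil n (free_primFil h n)
      infer_instance) hc

end PrimitiveFiltration

/-! ### Bialgebras with a basis of ordered monomials in primitive elements. -/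

section MonomialBasis

variable {K R A I : Type u} [Field K] [CharZero K] [CommRing R] [Algebra K R] [Ring A]
  [Algebra K A] [Module R A] [IsScalarTower K R A] [IsScalarTower R A A] [LinearOrder I]
  [Coalgebra R A] [IsRBialgebra R A] {e : I → A} (he : ∀ i, e i ∈ primFil R A 1)

lemma linearIndependent_of_mon (h_indep : LinearIndependent R (PBW.mon e)) :
    LinearIndependent R e := by
  have h := h_indep.comp (fun i => Finsupp.single i 1)
    (Finsupp.single_left_injective one_ne_zero)
  have e' : PBW.mon e ∘ (fun i => Finsupp.single i 1) = e := funext (PBW.mon_single e)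
  rwa [e'] at h

variable (h_indep : LinearIndependent R (PBW.mon e))
  (h_span : Submodule.span R (Set.range (PBW.mon e)) = ⊤)

include K he h_indep h_span in
/-- If the ordered monomials in primitive elements are a basis, then the monomials of degree at
most `n` span the `n`-th term of the primitive filtration. -/
theorem primFil_eq_span_of_basis (n : ℕ) :
    primFil R A n = Submodule.span R (PBW.mon e '' {m : I →₀ ℕ | m ≠ 0 ∧ m.degree ≤ n}) := by
  have : Module.Free R A := Module.Free.of_basis (Module.Basis.mk h_indep h_span.ge)
  exact primFil_eq_span (K := K) he (linearIndependent_of_mon h_indep)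
    (primFil_one_le_span (K := K) he h_indep h_span) n

include K he h_indep h_span in
lemma mon_mem_primFil {n : ℕ} {m : I →₀ ℕ} (hm : m ≠ 0) (hmn : m.degree ≤ n) :
    PBW.mon e m ∈ primFil R A n := by
  rw [primFil_eq_span_of_basis (K := K) he h_indep h_span]
  exact Submodule.subset_span ⟨m, ⟨hm, hmn⟩, rfl⟩

include K he h_indep h_span in
lemma exists_mem_span_one_sup_primFil (a : A) :
    ∃ n, a ∈ Submodule.span R {(1 : A)} ⊔ primFil R A n := by
  have hmono : Monotone fun n => Submodule.span R {(1 : A)} ⊔ primFil R A n :=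
    fun _ _ hmn => sup_le_sup_left (primFil_mono hmn) _
  have ha : a ∈ Submodule.span R (Set.range (PBW.mon e)) := h_span ▸ Submodule.mem_top
  induction ha using Submodule.span_induction with
  | mem _ h =>
    obtain ⟨m, rfl⟩ := h
    by_cases hm : m = 0
    · rw [hm, PBW.mon_zero]
      exact ⟨0, Submodule.mem_sup_left (Submodule.mem_span_singleton_self _)⟩
    · exact ⟨m.degree, Submodule.mem_sup_right
        (mon_mem_primFil (K := K) he h_indep h_span hm le_rfl)⟩
  | zero => exact ⟨0, zero_mem _⟩
  | add a b _ _ ha hb =>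
    obtain ⟨n, hn⟩ := ha
    obtain ⟨k, hk⟩ := hb
    exact ⟨max n k, add_mem (hmono (le_max_left n k) hn) (hmono (le_max_right n k) hk)⟩
  | smul r a _ ha =>
    obtain ⟨n, hn⟩ := ha
    exact ⟨n, Submodule.smul_mem _ _ hn⟩

lemma ne_zero_of_degree {n : ℕ} (m : {m : I →₀ ℕ // m.degree = n + 1}) : m.1 ≠ 0 := fun h => by
  have := m.2
  rw [h, map_zero] at this
  exact absurd this (by omega)

include K he h_indep h_span in
lemma mon_mem_primFil_succ {n : ℕ} (m : {m : I →₀ ℕ // m.degree = n + 1}) :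
    PBW.mon e m.1 ∈ primFil R A (n + 1) :=
  mon_mem_primFil (K := K) he h_indep h_span (ne_zero_of_degree m) m.2.le

/-- The classes of the ordered monomials of degree `n + 1` form a basis of the subquotient of the
primitive filtration. -/
theorem linearIndependent_primGr (n : ℕ) :
    LinearIndependent R fun m : {m : I →₀ ℕ // m.degree = n + 1} =>
      (Submodule.Quotient.mk ⟨PBW.mon e m.1,
        mon_mem_primFil_succ (K := K) he h_indep h_span m⟩ : primGr R A n) :=
  linearIndependent_mk_of_span (primFil_eq_span_of_basis (K := K) he h_indep h_span n) _ _ h_indep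
    Subtype.val_injective fun m hm => by
      have := hm.2.trans_lt n.lt_succ_self
      exact absurd m.2 this.ne

theorem span_primGr (n : ℕ) :
    Submodule.span R (Set.range fun m : {m : I →₀ ℕ // m.degree = n + 1} =>
      (Submodule.Quotient.mk ⟨PBW.mon e m.1,
        mon_mem_primFil_succ (K := K) he h_indep h_span m⟩ : primGr R A n)) = ⊤ :=
  span_mk_of_span (primFil_eq_span_of_basis (K := K) he h_indep h_span (n + 1))
    (primFil_eq_span_of_basis (K := K) he h_indep h_span n) _ _ fun m hm hn => by
      refine ⟨⟨m, le_antisymm hm.2 ?_⟩, rfl⟩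
      by_contra h
      exact hn ⟨hm.1, by omega⟩

end MonomialBasis

/-! ### The stalks of a Lie algebroid -/

namespace LieAlgebroid

variable {K : Type u} [Field K] {X : TopCat.{u}} {O : X.Sheaf (CommAlgCat.{u} K)}
  {L : LieAlgebroid O} {x : X}

lemma exists_germ_le (V : Opens X) (hV : x ∈ V) (s : L.Stalk x) :
    ∃ (W : Opens X) (hx : x ∈ W) (_ : W ≤ V) (a : L.Sec W), L.germ x hx a = s := by
  obtain ⟨U, hU, a, rfl⟩ := exists_germ s
  exact ⟨U ⊓ V, ⟨hU, hV⟩, inf_le_right, L.res inf_le_left a, germ_res _ _ _ _⟩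

lemma exists_germ₂ (s t : L.Stalk x) :
    ∃ (U : Opens X) (hx : x ∈ U) (D E : L.Sec U), L.germ x hx D = s ∧ L.germ x hx E = t := by
  obtain ⟨U, hU, D, rfl⟩ := exists_germ s
  obtain ⟨V, hV, h, E, rfl⟩ := exists_germ_le U hU t
  exact ⟨V, hV, L.res h D, E, germ_res _ _ _ _, rfl⟩

lemma exists_germ₃ (s t w : L.Stalk x) :
    ∃ (U : Opens X) (hx : x ∈ U) (D E F : L.Sec U),
      L.germ x hx D = s ∧ L.germ x hx E = t ∧ L.germ x hx F = w := by
  obtain ⟨U, hU, D, E, rfl, rfl⟩ := exists_germ₂ s t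
  obtain ⟨V, hV, h, F, rfl⟩ := exists_germ_le U hU w
  exact ⟨V, hV, L.res h D, L.res h E, F, germ_res _ _ _ _, germ_res _ _ _ _, rfl⟩

lemma exists_germ_pair (s : L.Stalk x) (r : OStalk O x) :
    ∃ (U : Opens X) (hx : x ∈ U) (D : L.Sec U) (f : OSec O U),
      L.germ x hx D = s ∧ LieAlgd.germ (oPre O) x hx f = r := by
  obtain ⟨U, hU, D, rfl⟩ := exists_germ s
  obtain ⟨V, hV, h, f, rfl⟩ := LieAlgd.exists_germ_le _ U hU r
  exact ⟨V, hV, L.res h D, f, germ_res _ _ _ _, rfl⟩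

lemma exists_germ₂_pair (s t : L.Stalk x) (r : OStalk O x) :
    ∃ (U : Opens X) (hx : x ∈ U) (D E : L.Sec U) (f : OSec O U),
      L.germ x hx D = s ∧ L.germ x hx E = t ∧ LieAlgd.germ (oPre O) x hx f = r := by
  obtain ⟨U, hU, D, E, rfl, rfl⟩ := exists_germ₂ s t
  obtain ⟨V, hV, h, f, rfl⟩ := LieAlgd.exists_germ_le _ U hU r
  exact ⟨V, hV, L.res h D, L.res h E, f, germ_res _ _ _ _, germ_res _ _ _ _, rfl⟩

lemma exists_germ_pair₂ (s : L.Stalk x) (r r' : OStalk O x) :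
    ∃ (U : Opens X) (hx : x ∈ U) (D : L.Sec U) (f g : OSec O U), L.germ x hx D = s ∧
      LieAlgd.germ (oPre O) x hx f = r ∧ LieAlgd.germ (oPre O) x hx g = r' := by
  obtain ⟨U, hU, D, rfl⟩ := exists_germ s
  obtain ⟨V, hV, h, f, g, rfl, rfl⟩ := LieAlgd.exists_germ_le₂ _ U hU r r'
  exact ⟨V, hV, L.res h D, f, g, germ_res _ _ _ _, rfl, rfl⟩

instance stalkBracket (x : X) : Bracket (L.Stalk x) (L.Stalk x) where
  bracket := DirectLimit.map₂ (F₁ := fun V : Nbhd x => L.Sec V.1)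
    (F₂ := fun V : Nbhd x => L.Sec V.1) (F := fun V : Nbhd x => L.Sec V.1)
    (fun V W h => L.res (U := V.1) (V := W.1) h)
    (fun V W h => L.res (U := V.1) (V := W.1) h) (fun V W h => L.res (U := V.1) (V := W.1) h)
    (fun V (D E : L.Sec V.1) => ⁅D, E⁆) (fun _ _ h D E => L.res_lie h D E)

lemma germ_lie {U : Opens X} (hx : x ∈ U) (D E : L.Sec U) :
    L.germ x hx ⁅D, E⁆ = ⁅L.germ x hx D, L.germ x hx E⁆ :=
  (DirectLimit.map₂_def (F₁ := fun V : Nbhd x => L.Sec V.1) (F₂ := fun V : Nbhd x => L.Sec V.1)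
    (F := fun V : Nbhd x => L.Sec V.1)
    (fun V W h => L.res (U := V.1) (V := W.1) h)
    (fun V W h => L.res (U := V.1) (V := W.1) h) (fun V W h => L.res (U := V.1) (V := W.1) h)
    (fun V (D E : L.Sec V.1) => ⁅D, E⁆) (fun _ _ h D E => L.res_lie h D E)
    (nbhd U hx) D E).symm

instance stalkLieRing (x : X) : LieRing (L.Stalk x) where
  add_lie s t w := by
    obtain ⟨U, hx, D, E, F, rfl, rfl, rfl⟩ := exists_germ₃ s t w
    rw [← map_add, ← germ_lie, ← germ_lie, ← germ_lie, add_lie, map_add]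
  lie_add s t w := by
    obtain ⟨U, hx, D, E, F, rfl, rfl, rfl⟩ := exists_germ₃ s t w
    rw [← map_add, ← germ_lie, ← germ_lie, ← germ_lie, lie_add, map_add]
  lie_self s := by
    obtain ⟨U, hx, D, rfl⟩ := exists_germ s
    rw [← germ_lie, lie_self, map_zero]
  leibniz_lie s t w := by
    obtain ⟨U, hx, D, E, F, rfl, rfl, rfl⟩ := exists_germ₃ s t w
    simp only [← germ_lie, ← map_add]
    rw [leibniz_lie]

instance stalkAnchor (x : X) : Bracket (L.Stalk x) (OStalk O x) where
  bracket := DirectLimit.map₂ (F₁ := fun V : Nbhd x => L.Sec V.1)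
    (F₂ := fun V : Nbhd x => OSec O V.1) (F := fun V : Nbhd x => OSec O V.1)
    (fun V W h => L.res (U := V.1) (V := W.1) h)
    (fun V W h => LieAlgd.res (oPre O) (U := V.1) (V := W.1) h)
    (fun V W h => LieAlgd.res (oPre O) (U := V.1) (V := W.1) h)
    (fun V (D : L.Sec V.1) (f : OSec O V.1) => ⁅D, f⁆) (fun _ _ h D f => L.res_anchor h D f)

lemma germ_anchor {U : Opens X} (hx : x ∈ U) (D : L.Sec U) (f : OSec O U) :
    LieAlgd.germ (oPre O) x hx ⁅D, f⁆ = ⁅L.germ x hx D, LieAlgd.germ (oPre O) x hx f⁆ :=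
  (DirectLimit.map₂_def (F₁ := fun V : Nbhd x => L.Sec V.1) (F₂ := fun V : Nbhd x => OSec O V.1)
    (F := fun V : Nbhd x => OSec O V.1)
    (fun V W h => L.res (U := V.1) (V := W.1) h)
    (fun V W h => LieAlgd.res (oPre O) (U := V.1) (V := W.1) h)
    (fun V W h => LieAlgd.res (oPre O) (U := V.1) (V := W.1) h)
    (fun V (D : L.Sec V.1) (f : OSec O V.1) => ⁅D, f⁆) (fun _ _ h D f => L.res_anchor h D f)
    (nbhd U hx) D f).symm

instance stalkLieRingModule (x : X) : LieRingModule (L.Stalk x) (OStalk O x) where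
  add_lie s t r := by
    obtain ⟨U, hx, D, E, f, rfl, rfl, rfl⟩ := exists_germ₂_pair s t r
    rw [← map_add, ← germ_anchor, ← germ_anchor, ← germ_anchor, add_lie, map_add]
  lie_add s r r' := by
    obtain ⟨U, hx, D, f, g, rfl, rfl, rfl⟩ := exists_germ_pair₂ s r r'
    rw [← map_add, ← germ_anchor, ← germ_anchor, ← germ_anchor, lie_add, map_add]
  leibniz_lie s t r := by
    obtain ⟨U, hx, D, E, f, rfl, rfl, rfl⟩ := exists_germ₂_pair s t r
    simp only [← germ_lie, ← germ_anchor, ← map_add]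
    rw [leibniz_lie]

instance stalkLieRinehartRing (x : X) : LieRinehartRing (OStalk O x) (L.Stalk x) where
  lie_smul_eq_mul' r r' s := by
    obtain ⟨U, hx, D, f, g, rfl, rfl, rfl⟩ := exists_germ_pair₂ s r r'
    rw [← germ_smul, ← germ_anchor, ← germ_anchor, ← map_mul, LieRinehartRing.lie_smul_eq_mul]
  leibniz_mul_right' s r r' := by
    obtain ⟨U, hx, D, f, g, rfl, rfl, rfl⟩ := exists_germ_pair₂ s r r'
    rw [smul_eq_mul]
    simp only [← germ_anchor, ← map_mul, ← map_add]
    rw [LieRinehartRing.leibniz_mul_right, smul_eq_mul]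
  leibniz_smul_right' s t r := by
    obtain ⟨U, hx, D, E, f, rfl, rfl, rfl⟩ := exists_germ₂_pair s t r
    simp only [← germ_anchor, ← germ_smul, ← germ_lie, ← map_add]
    rw [LieRinehartRing.leibniz_smul_right]

lemma der_eq_lie {V : Opens X} (hV : x ∈ V) (D : L.Sec V) (r : OStalk O x) :
    L.der hV D r = ⁅L.germ x hV D, r⁆ := by
  obtain ⟨W, hx, h, f, rfl⟩ := LieAlgd.exists_germ_le _ V hV r
  rw [L.der_germ h hx, germ_anchor, germ_res]

variable (L x) in
/-- The canonical map from a Lie algebroid to its universal enveloping algebra on stalks. -/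
def stalkι : L.Stalk x →+ L.envAlg.Stalk x :=
  AddMonoidHom.mk' (DirectLimit.lift (fun V W h => L.res (U := V.1) (V := W.1) h)
    (fun (W : Nbhd x) (D : L.Sec W.1) => L.ιx W.2 D) (fun _ W h D => (L.ιx_res h W.2 D).symm))
    fun s t => by
      obtain ⟨U, hx, D, E, rfl, rfl⟩ := exists_germ₂ s t
      rw [← map_add]
      exact map_add (L.ιx hx) D E

lemma stalkι_germ {U : Opens X} (hx : x ∈ U) (D : L.Sec U) :
    L.stalkι x (L.germ x hx D) = L.ιx hx D := rfl

lemma stalkι_smul (r : OStalk O x) (s : L.Stalk x) :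
    L.stalkι x (r • s) = r • L.stalkι x s := by
  obtain ⟨U, hx, D, f, rfl, rfl⟩ := exists_germ_pair s r
  rw [← germ_smul, stalkι_germ, ιx_smul, stalkι_germ]

lemma stalkι_lie (s t : L.Stalk x) : L.stalkι x ⁅s, t⁆ =
    L.stalkι x s * L.stalkι x t - L.stalkι x t * L.stalkι x s := by
  obtain ⟨U, hx, D, E, rfl, rfl⟩ := exists_germ₂ s t
  rw [← germ_lie, stalkι_germ, ιx_lie, stalkι_germ, stalkι_germ]

lemma stalkι_mul_smul (s : L.Stalk x) (r : OStalk O x) (a : L.envAlg.Stalk x) :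
    L.stalkι x s * (r • a) = r • (L.stalkι x s * a) + ⁅s, r⁆ • a := by
  obtain ⟨U, hx, D, rfl⟩ := exists_germ s
  rw [← der_eq_lie]
  exact L.isLeibniz_ιx hx D r a

lemma stalkι_mem_primFil (s : L.Stalk x) :
    L.stalkι x s ∈ primFil (OStalk O x) (L.envAlg.Stalk x) 1 := by
  obtain ⟨U, hx, D, rfl⟩ := exists_germ s
  exact (mem_primFil_one _).2 (L.comul_ιx hx D)

lemma lie_algebraMap (s : L.Stalk x) (k : K) : ⁅s, algebraMap K (OStalk O x) k⁆ = 0 := by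
  obtain ⟨U, hx, D, rfl⟩ := exists_germ s
  rw [← der_eq_lie, Algebra.algebraMap_eq_smul_one, map_smul, der_one, smul_zero]

/-! ### The Poincaré–Birkhoff–Witt theorem on stalks. -/

section PBW

variable {I : Type u} [LinearOrder I] (b : Module.Basis I (OStalk O x) (L.Stalk x))

/-- The operator on polynomials by which an element of the stalk acts. -/
def polyOp (s : L.Stalk x) : Module.End K ((I →₀ ℕ) →₀ OStalk O x) where
  toFun := PBW.rep b s
  map_add' := map_add _
  map_smul' k t := by
    rw [← algebraMap_smul (OStalk O x) k t, PBW.op_leibniz, lie_algebraMap, zero_smul, add_zero,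
      algebraMap_smul]
    rfl

/-- The action of the universal enveloping algebra on polynomials. -/
def polyAct : L.envAlg.Stalk x →+* Module.End K ((I →₀ ℕ) →₀ OStalk O x) :=
  act (fun V hV D => polyOp b (L.germ x hV D))
    (fun V hV D E => LinearMap.ext fun t => by
      change PBW.rep b _ t = PBW.rep b _ t + PBW.rep b _ t
      rw [map_add]
      exact DFunLike.congr_fun (PBW.op_add b (PBW.act b) _ _) t)
    (fun V hV D E => LinearMap.ext fun t => by
      change PBW.rep b _ t = PBW.rep b _ (PBW.rep b _ t) - PBW.rep b _ (PBW.rep b _ t)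
      -- Vanishing of the curvature is what this relation of the enveloping algebra requires.
      rw [germ_lie, PBW.rep_lie]
      rfl)
    (fun V hV f D t => by
      change PBW.rep b _ t = _ • PBW.rep b _ t
      rw [germ_smul, PBW.op_smul])
    (fun V hV D r t => by
      change PBW.rep b _ (r • t) = r • PBW.rep b _ t + _
      rw [der_eq_lie, PBW.op_leibniz])
    (fun V W h hx D => by rw [germ_res])

lemma polyAct_stalkι (s : L.Stalk x) (t) : polyAct b (L.stalkι x s) t = PBW.rep b s t := by
  obtain ⟨U, hx, D, rfl⟩ := exists_germ s
  exact LinearMap.congr_fun (act_ιx _ _ _ _ _ _ U hx D) t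

/-- The ordered monomials in a basis of the stalk of a Lie algebroid are linearly independent in
the stalk of the universal enveloping algebra. -/
theorem linearIndependent_mon_stalkι :
    LinearIndependent (OStalk O x) (PBW.mon fun i => L.stalkι x (b i)) := by
  -- Θ applies an element of the enveloping algebra to the constant polynomial 1. It carries ordered
  -- monomials to the monomials zᵐ, which are independent.
  let Θ : L.envAlg.Stalk x →ₗ[OStalk O x] ((I →₀ ℕ) →₀ OStalk O x) :=
    { toFun := fun a => polyAct b a (PBW.z _ 0)
      map_add' := fun a c => by rw [map_add, LinearMap.add_apply]
      map_smul' := fun r a => act_smul _ _ _ _ _ _ r a _ }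
  have h : Θ ∘ (PBW.mon fun i => L.stalkι x (b i)) = fun m => PBW.z (OStalk O x) m :=
    funext fun m => PBW.rep_mon_z b m (fun a => (polyAct b a).toAddMonoidHom)
      (by rw [map_one]; rfl) (fun s t => by rw [map_mul]; rfl) _
      (fun i => AddMonoidHom.ext fun t => polyAct_stalkι b _ t)
  refine LinearIndependent.of_comp Θ ?_
  rw [h]
  exact Finsupp.linearIndependent_single_one _ _

/-- The ordered monomials in a basis of the stalk of a Lie algebroid generate the stalk of the
universal enveloping algebra. -/
theorem span_mon_stalkι :
    Submodule.span (OStalk O x) (Set.range (PBW.mon fun i => L.stalkι x (b i))) = ⊤ := by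
  have h := PBW.monMap_rep b (L.stalkι x) stalkι_smul stalkι_lie
    (fun s r a => stalkι_mul_smul s r a)
  rw [← Finsupp.range_linearCombination, eq_top_iff]
  intro a _
  induction a using env_induction with
  | h_one => exact ⟨PBW.z _ 0, (PBW.monMap_z _ _).trans (PBW.mon_zero _)⟩
  | h_add a c ha hc => exact add_mem (ha trivial) (hc trivial)
  | h_smul r a ha => exact Submodule.smul_mem _ _ (ha trivial)
  | h_ι V hx D a ha =>
    obtain ⟨t, rfl⟩ := ha trivial
    -- By equivariance, the span of the ordered monomials is stable under left multiplication by
    -- ι(D); as it contains 1 and is a submodule, it is everything.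
    exact ⟨PBW.rep b (L.germ x hx D) t, h _ t⟩

end PBW

end LieAlgebroid

/-! ### Morphisms of sheaves defined on stalks -/

section Glue

variable {K : Type u} [Field K] {X : TopCat.{u}} {F G : X.Presheaf (AlgCat.{u} K)}

section

variable (hG : G.IsSheaf) (μ : ∀ y : X, Stalk F y →ₐ[K] Stalk G y)
  (h : ∀ (U : Opens X) (s : Sec F U),
    IsLocallySection G (U := U) fun y => μ y.1 (germ F y.1 y.2 s))

/-- The section whose germs are the images of the germs of a given section. -/
def glue {U : Opens X} (s : Sec F U) : Sec G U := (exists_sec hG (h U s)).choose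

lemma germ_glue {U : Opens X} (s : Sec F U) (y : X) (hy : y ∈ U) :
    germ G y hy (glue hG μ h s) = μ y (germ F y hy s) :=
  (exists_sec hG (h U s)).choose_spec y hy

/-- The morphism of sheaves defined by homomorphisms of stalks which carry sections to
sections. -/
def homOfStalks : F ⟶ G where
  app U := AlgCat.ofHom
    { toFun := fun s => glue hG μ h s
      map_one' := sec_ext hG fun y hy => by rw [germ_glue, map_one, map_one, map_one]
      map_mul' := fun s t => sec_ext hG fun y hy => by
        rw [map_mul, germ_glue, germ_glue, germ_glue, map_mul, map_mul]
      map_zero' := sec_ext hG fun y hy => by rw [germ_glue, map_zero, map_zero, map_zero]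
      map_add' := fun s t => sec_ext hG fun y hy => by
        rw [map_add, germ_glue, germ_glue, germ_glue, map_add, map_add]
      commutes' := fun k => sec_ext hG fun y hy => by
        rw [germ_glue, AlgHom.commutes, AlgHom.commutes, AlgHom.commutes] }
  naturality U V i := by
    ext s
    refine sec_ext (U := V.unop) hG fun y hy => ?_
    change germ G y hy (glue hG μ h (res F (leOfHom i.unop) s)) =
      germ G y hy (res G (leOfHom i.unop) (glue hG μ h s))
    rw [germ_glue, germ_res, germ_res, germ_glue]

lemma germ_homOfStalks {U : Opens X} (s : Sec F U) (y : X) (hy : y ∈ U) :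
    germ G y hy (onSec (homOfStalks hG μ h) U s) = μ y (germ F y hy s) := germ_glue hG μ h s y hy

lemma onStalk_homOfStalks (y : X) (a : Stalk F y) : onStalk (homOfStalks hG μ h) y a = μ y a := by
  obtain ⟨U, hy, a, rfl⟩ := exists_germ _ a
  rw [onStalk_germ, germ_homOfStalks]

end

lemma hom_ext_stalk (hG : G.IsSheaf) {φ ψ : F ⟶ G} (h : ∀ y a, onStalk φ y a = onStalk ψ y a) :
    φ = ψ := by
  ext U s
  exact sec_ext hG fun y hy => h y (germ F y hy s)

/-- Evaluation of germs of sections of the sheafification. -/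
def evAlg (F : X.Presheaf (AlgCat.{u} K)) (y : X) : Stalk (shf F) y →ₐ[K] Stalk F y :=
  { ev F y with
    commutes' := fun k => by
      change ev F y _ = _
      rw [← AlgHom.commutes (germ (shf F) y (Opens.mem_top y)) k, ev_germ]
      rfl }

lemma isLocallySection_ev (ψ : F ⟶ G) (U : Opens X) (s : Sec (shf F) U) :
    IsLocallySection G (U := U) fun y =>
      (onStalk ψ y.1).comp (evAlg F y.1) (germ (shf F) y.1 y.2 s) := fun x => by
  obtain ⟨V, hx, hV, a, ha⟩ := exists_local F s x.1 x.2
  refine ⟨V, hx, hV, onSec ψ V a, fun y hy => ?_⟩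
  change onStalk ψ y (evAlg F y (germ (shf F) y (hV hy) s)) = onStalk ψ y (germ F y hy a)
  rw [← germ_res _ hV y hy, ha]
  rfl

/-- The morphism out of a sheafification induced by a morphism of presheaves. -/
def shfLift (hG : G.IsSheaf) (ψ : F ⟶ G) : shf F ⟶ G :=
  homOfStalks hG (fun y => (onStalk ψ y).comp (evAlg F y)) (isLocallySection_ev ψ)

lemma toShf_shfLift (hG : G.IsSheaf) (ψ : F ⟶ G) : toShf F ≫ shfLift hG ψ = ψ := by
  refine hom_ext_stalk hG fun y a => ?_
  obtain ⟨U, hy, a, rfl⟩ := exists_germ _ a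
  change germ G y hy (onSec (shfLift hG ψ) U (onSec (toShf F) U a)) = _
  rw [shfLift, germ_homOfStalks]
  rfl

end Glue

/-! ### The adjunction -/

section Adjunction

variable {K : Type u} [Field K] {X : TopCat.{u}} {O : X.Sheaf (CommAlgCat.{u} K)}

namespace LieAlgebroid

variable {L M : LieAlgebroid O}

/-- Stalks of the enveloping algebra are generated by the structure sheaf and the germs of the ι(D),
and morphisms are linear over the structure sheaf. -/
lemma envAlg_hom_ext {A : ExtAlg O} {φ ψ : ExtAlg.Hom L.envAlg A}
    (h : ∀ (U : Opens X) (D : L.Sec U), onSec φ.hom U (L.ι D) = onSec ψ.hom U (L.ι D)) :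
    φ.hom = ψ.hom := by
  refine hom_ext_stalk A.isSheaf fun y a => ?_
  change φ.stalk y a = ψ.stalk y a
  induction a using env_induction with
  | h_one => rw [ExtAlg.Hom.stalk_one, ExtAlg.Hom.stalk_one]
  | h_add a b ha hb => rw [map_add, map_add, ha, hb]
  | h_smul r a ha => rw [map_smul, map_smul, ha]
  | h_ι V hx D a ha =>
    rw [ExtAlg.Hom.stalk_mul, ExtAlg.Hom.stalk_mul, ha]
    congr 1
    exact congrArg (A.germ y hx) (h V D)

lemma envBialgebroid_hom_ext {A : Bialgebroid O} {φ ψ : L.envBialgebroid ⟶ A}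
    (h : ∀ (U : Opens X) (D : L.Sec U),
      onSec φ.map.hom U (L.ι D) = onSec ψ.map.hom U (L.ι D)) : φ = ψ :=
  Bialgebroid.Hom.ext' (envAlg_hom_ext (φ := φ.map) (ψ := ψ.map) h)

lemma envAlgMap_ι (φ : L ⟶ M) {U : Opens X} (D : L.Sec U) :
    onSec (envAlgMap φ).hom U (L.ι D) = M.ι (φ.app U D) := by
  change onSec (toShf L.envPre ≫ shfMap (envPreMap φ)) U (Env.δ D) = _
  rw [toShf_shfMap]
  exact congrArg (cl (L := M)) (envMap_δ φ D)

lemma ι_mem_prim {U : Opens X} (D : L.Sec U) : L.ι D ∈ L.envBialgebroid.prim U :=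
  fun x hx => (mem_primFil_one _).2 (L.comul_ιx hx D)

variable (L) in
/-- The unit `D ↦ ι(D)` of the adjunction. -/
def toPrim : L ⟶ L.envBialgebroid.primAlgebroid where
  app U :=
    { toFun := fun D => (⟨L.ι D, ι_mem_prim D⟩ : L.envBialgebroid.prim U)
      map_add' := fun D E => Subtype.ext (map_add L.ι D E)
      map_smul' := fun k D => Subtype.ext (by
        change L.ι (k • D) = k • L.ι D
        rw [← algebraMap_smul (OSec O U) k D, ι_smul, AlgHom.commutes, ← Algebra.smul_def])
      map_lie' := fun {D E} => Subtype.ext (L.ι_lie D E)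
      map_smul_apply' := fun f D => Subtype.ext (L.ι_smul f D)
      -- Both anchors become the commutator of ι(D) and f in the enveloping algebra, where functions
      -- embed because the counit is a retraction.
      apply_lie' := fun f D => L.envBialgebroid.η_injective (by
        refine Eq.trans ?_ (Bialgebroid.η_anchor (ι_mem_prim D) f).symm
        exact (eq_sub_of_add_eq' (L.ι_mul_η D f).symm)) }
  naturality h D := Subtype.ext (L.res_ι h D).symm

end LieAlgebroid

namespace Bialgebroid

variable (A : Bialgebroid O)

/-- The inclusion of the primitive sections. -/
def primVal {U : Opens X} : A.primAlgebroid.Sec U →+ A.alg.Sec U :=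
  AddMonoidHom.mk' (Subtype.val (p := fun a => a ∈ A.prim U)) fun _ _ => rfl

variable {A} in
lemma primVal_mem {U : Opens X} (D : A.primAlgebroid.Sec U) : A.primVal D ∈ A.prim U :=
  Subtype.property (p := fun a => a ∈ A.prim U) D

lemma res_primVal {U V : Opens X} (h : V ≤ U) (D : A.primAlgebroid.Sec U) :
    A.alg.res h (A.primVal D) = A.primVal (A.primAlgebroid.res h D) := rfl

/-- The canonical homomorphism from the universal enveloping algebra of primitive sections. -/
def envToSec (U : Opens X) : Env K (OSec O U) (A.primAlgebroid.Sec U) →ₐ[K] A.alg.Sec U :=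
  -- Bracket and module structure on primitive sections are commutator and left multiplication by
  -- definition; only the anchor relation has content, and it is `η_anchor`.
  Env.lift (A.alg.η U) A.primVal (fun D E => rfl) (fun f D => rfl)
    (fun D f => by exact (add_eq_of_eq_sub' (η_anchor (primVal_mem D) f)).symm)

lemma envToSec_η {U : Opens X} (f : OSec O U) : A.envToSec U (Env.η f) = A.alg.η U f :=
  Env.lift_η _ _ _ _ _ f

lemma envToSec_δ {U : Opens X} (D : A.primAlgebroid.Sec U) :
    A.envToSec U (Env.δ D) = A.primVal D :=
  Env.lift_δ _ _ _ _ _ _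

/-- The canonical morphism from the presheaf of universal enveloping algebras. -/
def envPreToAlg : A.primAlgebroid.envPre ⟶ A.alg.presheaf where
  app U := AlgCat.ofHom (A.envToSec U.unop)
  naturality U V i := by
    ext a
    change A.envToSec V.unop (A.primAlgebroid.envRes (leOfHom i.unop) a) =
      A.alg.res (leOfHom i.unop) (A.envToSec U.unop a)
    induction a using Env.induction with
    | h_one => simp only [map_one]
    | h_add a b ha hb => simp only [map_add, ha, hb]
    | h_η f a ha =>
      rw [map_mul, map_mul, map_mul, map_mul, ha, LieAlgebroid.envRes_η, envToSec_η, envToSec_η,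
        onSec_res]
    | h_δ D a ha =>
      rw [map_mul, map_mul, map_mul, map_mul, ha, LieAlgebroid.envRes_δ]
      rw [envToSec_δ, envToSec_δ, res_primVal]

/-- The canonical morphism of sheaves of algebras from the universal enveloping algebra of the
primitive elements. -/
def envToAlg : ExtAlg.Hom A.primAlgebroid.envAlg A.alg where
  hom := shfLift A.alg.isSheaf A.envPreToAlg
  unit_hom := by
    change (A.primAlgebroid.envUnit ≫ toShf _) ≫ shfLift _ _ = _
    rw [Category.assoc, toShf_shfLift]
    ext U f
    exact A.envToSec_η f

lemma envToAlg_ι {U : Opens X} (D : A.primAlgebroid.Sec U) :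
    onSec A.envToAlg.hom U (A.primAlgebroid.ι D) = A.primVal D := by
  change onSec (toShf _ ≫ shfLift A.alg.isSheaf A.envPreToAlg) U (Env.δ D) = _
  rw [toShf_shfLift]
  exact A.envToSec_δ D

lemma envToAlg_stalk_ιx {x : X} {V : Opens X} (hx : x ∈ V) (D : A.primAlgebroid.Sec V) :
    A.envToAlg.stalk x (A.primAlgebroid.ιx hx D) = A.alg.germ x hx (A.primVal D) :=
  congrArg (A.alg.germ x hx) (A.envToAlg_ι D)

/-- The anchor of primitive sections, f ↦ ε(D f), seen on stalks. In this form it matches the axiom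
ε(ab) = ε(a ε(b)), by which the counit of the adjunction respects ε. -/
lemma der_prim {x : X} {V : Opens X} (hx : x ∈ V) (D : A.primAlgebroid.Sec V)
    (r : OStalk O x) : A.primAlgebroid.der hx D r = Coalgebra.counit (R := OStalk O x)
      (A.alg.germ x hx (A.primVal D) * r • (1 : A.alg.Stalk x)) := by
  obtain ⟨W, hW, h, f, rfl⟩ := exists_germ_le _ V hx r
  rw [A.primAlgebroid.der_germ h hW]
  change LieAlgd.germ (oPre O) x hW (A.ε (A.alg.res h (A.primVal D) * A.alg.η W f)) = _
  rw [germ_ε, map_mul, germ_res, ← ExtAlg.ηx_eq]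
  rfl

/-- The counit of the adjunction. -/
def ofEnv : A.primAlgebroid.envBialgebroid ⟶ A where
  map := A.envToAlg
  counit_comp x := by
    ext a
    change Coalgebra.counit (R := OStalk O x) (A.envToAlg.stalk x a) =
      Coalgebra.counit (R := OStalk O x) (A := A.primAlgebroid.envAlg.Stalk x) a
    induction a using LieAlgebroid.env_induction with
    | h_one => rw [ExtAlg.Hom.stalk_one, IsRBialgebra.counit_one, IsRBialgebra.counit_one]
    | h_add a b ha hb => rw [map_add, map_add, map_add, ha, hb]
    | h_smul r a ha => rw [map_smul, map_smul, map_smul, ha]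
    | h_ι V hx D a ha =>
      rw [ExtAlg.Hom.stalk_mul, envToAlg_stalk_ιx, LieAlgebroid.counit_ιx_mul,
        IsRBialgebra.counit_mul, ha]
      exact (A.der_prim hx D _).symm
  comul_comp x := by
    ext a
    change Coalgebra.comul (R := OStalk O x) (A.envToAlg.stalk x a) =
      TensorProduct.map (A.envToAlg.stalk x) (A.envToAlg.stalk x)
        (Coalgebra.comul (R := OStalk O x) (A := A.primAlgebroid.envAlg.Stalk x) a)
    induction a using LieAlgebroid.env_induction with
    | h_one =>
      rw [ExtAlg.Hom.stalk_one, IsRBialgebra.comul_one, IsRBialgebra.comul_one,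
        TensorProduct.map_tmul, ExtAlg.Hom.stalk_one]
    | h_add a b ha hb => rw [map_add, map_add, map_add, map_add, ha, hb]
    | h_smul r a ha => rw [map_smul, map_smul, map_smul, map_smul, ha]
    | h_ι V hx D a ha =>
      -- Δ(a) is written as a finite sum so that the formula for Δ of a primitive element times a
      -- can be applied to its image in A.
      obtain ⟨S, hS⟩ := TensorProduct.exists_finset
        (Coalgebra.comul (R := OStalk O x) (A := A.primAlgebroid.envAlg.Stalk x) a)
      rw [hS, map_sum] at ha
      rw [ExtAlg.Hom.stalk_mul, envToAlg_stalk_ιx, LieAlgebroid.comul_ιx_mul, hS, map_sum, map_sum,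
        comul_prim_mul (primVal_mem D x hx) S
          (fun t => A.envToAlg.stalk x t.1) (fun t => A.envToAlg.stalk x t.2) ha]
      refine Finset.sum_congr rfl fun t _ => ?_
      rw [LieAlgebroid.boxι_tmul, map_add, TensorProduct.map_tmul, TensorProduct.map_tmul,
        ExtAlg.Hom.stalk_mul, ExtAlg.Hom.stalk_mul, envToAlg_stalk_ιx]

end Bialgebroid

variable (O) in
/-- The universal enveloping algebroid functor is left adjoint to the functor of primitive
elements. -/
def envPrimAdjunction : envFunctor O ⊣ primFunctor O :=
  Adjunction.mkOfUnitCounit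
    { unit :=
        { app := fun L => L.toPrim
          naturality := fun L M φ => LieAlgebroid.Hom.ext' fun U D =>
            Subtype.ext (LieAlgebroid.envAlgMap_ι φ D).symm }
      counit :=
        { app := fun A => A.ofEnv
          naturality := fun A B ψ => LieAlgebroid.envBialgebroid_hom_ext fun U D =>
            (congrArg (onSec B.envToAlg.hom U) (LieAlgebroid.envAlgMap_ι
              (Bialgebroid.primMap ψ) D)).trans ((B.envToAlg_ι _).trans
                (congrArg (onSec ψ.map.hom U) (A.envToAlg_ι D)).symm) }
      -- Both composites fix the generators ι(D), which determine a morphism out of the enveloping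
      -- algebroid.
      left_triangle := by
        ext L : 2
        exact LieAlgebroid.envBialgebroid_hom_ext fun U D =>
          (congrArg (onSec L.envBialgebroid.envToAlg.hom U)
            (LieAlgebroid.envAlgMap_ι L.toPrim D)).trans (L.envBialgebroid.envToAlg_ι _)
      right_triangle := by
        ext A : 2
        exact LieAlgebroid.Hom.ext' fun U D => Subtype.ext (A.envToAlg_ι D) }

end Adjunction

/-! ### Universal enveloping algebroids of locally free Lie algebroids -/

section LocallyFreeAlgebroids

variable {K : Type u} [Field K] {X : TopCat.{u}} {O : X.Sheaf (CommAlgCat.{u} K)}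

lemma injective_of_linearIndependent_comp {R M N I : Type*} [CommRing R] [AddCommGroup M]
    [AddCommGroup N] [Module R M] [Module R N] (b : Module.Basis I R M) (f : M →ₗ[R] N)
    (h : LinearIndependent R (f ∘ b)) : Function.Injective f := by
  have e : f = Finsupp.linearCombination R (f ∘ b) ∘ₗ b.repr.toLinearMap := b.ext fun i => by simp
  have h' : Function.Injective (Finsupp.linearCombination R (f ∘ b)) := h
  have h'' := h'.comp b.repr.injective
  rwa [e]

namespace LieAlgebroid

variable {L M : LieAlgebroid O}

lemma germ_eq {U V : Opens X} {x : X} {hU : x ∈ U} {hV : x ∈ V} {D : L.Sec U} {E : L.Sec V}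
    (h : L.germ x hU D = L.germ x hV E) :
    ∃ (W : Opens X) (_ : x ∈ W) (h₁ : W ≤ U) (h₂ : W ≤ V), L.res h₁ D = L.res h₂ E := by
  obtain ⟨W, h₁, h₂, e⟩ := Quotient.exact h
  exact ⟨W.1, W.2, h₁, h₂, e⟩

lemma sec_ext {U : Opens X} {D E : L.Sec U}
    (h : ∀ (x : X) (hx : x ∈ U), L.germ x hx D = L.germ x hx E) : D = E := by
  choose W hx h₁ h₂ e using fun x : U => germ_eq (h x.1 x.2)
  refine TopCat.Sheaf.eq_of_locally_eq' ⟨L.presheaf, L.isSheaf⟩ W U (fun x => homOfLE (h₁ x)) ?_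
    D E e
  intro x hxU
  exact Opens.mem_iSup.2 ⟨⟨x, hxU⟩, hx ⟨x, hxU⟩⟩

/-- A morphism of Lie algebroids which is bijective on sections is an isomorphism. -/
lemma isIso_of_bijective (φ : L ⟶ M) (h : ∀ U, Function.Bijective (φ.app U)) : IsIso φ := by
  let g : ∀ U, M.Sec U → L.Sec U := fun U => (Equiv.ofBijective _ (h U)).symm
  have hg : ∀ U E, φ.app U (g U E) = E := fun U => (Equiv.ofBijective _ (h U)).apply_symm_apply
  have hg' : ∀ U D, g U (φ.app U D) = D := fun U => (Equiv.ofBijective _ (h U)).symm_apply_apply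
  let ψ : M ⟶ L :=
    { app := fun U =>
        { toFun := g U
          map_add' := fun D E => (h U).1 (by
            refine (hg U _).trans ((map_add (φ.app U).toLieHom _ _).trans ?_).symm
            exact congrArg₂ (· + ·) (hg U D) (hg U E))
          map_smul' := fun k D => (h U).1 (by
            refine (hg U _).trans ((map_smul (φ.app U).toLieHom k _).trans ?_).symm
            exact congrArg (k • ·) (hg U D))
          map_lie' := fun {D E} => (h U).1 (by
            refine (hg U _).trans (((φ.app U).toLieHom.map_lie _ _).trans ?_).symm
            exact congrArg₂ (⁅·, ·⁆) (hg U D) (hg U E))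
          map_smul_apply' := fun f D => (h U).1 (by
            refine (hg U _).trans (((φ.app U).map_smul_apply f _).trans ?_).symm
            exact congrArg (f • ·) (hg U D))
          apply_lie' := fun f D => by
            refine Eq.trans ?_ ((φ.app U).apply_lie f (g U D)).symm
            exact congrArg (fun D => ⁅D, f⁆) (hg U D).symm }
      naturality := fun {U V} hVU D => (h V).1 (by
        refine (hg V _).trans ((φ.naturality hVU _).trans ?_).symm
        exact congrArg (M.res hVU) (hg U D)) }
  exact ⟨ψ, Hom.ext' hg', Hom.ext' hg⟩

/-- The linear order on the index set is an arbitrary well-ordering; it is there only to make sense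
of ordered monomials. -/
lemma exists_local_basis (hL : L.IsLocallyFree) (x : X) :
    ∃ (U : Opens X) (_ : x ∈ U) (I : Type u) (_ : LinearOrder I) (D : I → L.Sec U),
      ∀ (y : X) (hy : y ∈ U), ∃ b : Module.Basis I (OStalk O y) (L.Stalk y),
        ∀ i, b i = L.germ y hy (D i) := by
  obtain ⟨U, hx, I, e, he, hb⟩ := hL x
  choose D hD using he
  refine ⟨U, hx, I, IsWellOrder.linearOrder WellOrderingRel, D, fun y hy => ?_⟩
  refine ⟨Module.Basis.mk (hb ⟨y, hy⟩).1 (hb ⟨y, hy⟩).2.ge, fun i => ?_⟩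
  rw [Module.Basis.mk_apply, hD i ⟨y, hy⟩]

section

variable {y : X} {I : Type u} [LinearOrder I] (b : Module.Basis I (OStalk O y) (L.Stalk y))

-- The images of the basis elements are the ordered monomials of degree one, which are independent
-- by PBW.
include b in
lemma stalkι_injective_of_basis : Function.Injective (L.stalkι y) := by
  let f : L.Stalk y →ₗ[OStalk O y] L.envAlg.Stalk y :=
    { toFun := L.stalkι y
      map_add' := map_add _
      map_smul' := fun r s => stalkι_smul r s }
  have h : LinearIndependent (OStalk O y) (f ∘ b) :=
    linearIndependent_of_mon (linearIndependent_mon_stalkι b)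
  exact injective_of_linearIndependent_comp b f h

-- By PBW the ordered monomials are a basis, and then the primitive elements are spanned by those of
-- degree one, which come from L.
include b in
lemma exists_stalkι_eq_of_basis [CharZero K] {a : L.envAlg.Stalk y}
    (ha : a ∈ primFil (OStalk O y) (L.envAlg.Stalk y) 1) : ∃ s, L.stalkι y s = a := by
  have h := primFil_one_le_span (K := K) (fun i => stalkι_mem_primFil (b i))
    (linearIndependent_mon_stalkι b) (span_mon_stalkι b) ha
  clear ha
  induction h using Submodule.span_induction with
  | mem _ h => obtain ⟨i, rfl⟩ := h; exact ⟨b i, rfl⟩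
  | zero => exact ⟨0, map_zero _⟩
  | add a c _ _ ha hc =>
    obtain ⟨s, rfl⟩ := ha
    obtain ⟨t, rfl⟩ := hc
    exact ⟨s + t, map_add _ _ _⟩
  | smul r a _ ha =>
    obtain ⟨s, rfl⟩ := ha
    exact ⟨r • s, stalkι_smul _ _⟩

end

lemma ι_injective (hL : L.IsLocallyFree) {U : Opens X} : Function.Injective (L.ι (U := U)) := by
  intro D E h
  refine sec_ext fun y hy => ?_
  obtain ⟨V, hV, I, _, F, hb⟩ := exists_local_basis hL y
  obtain ⟨b, -⟩ := hb y hV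
  exact stalkι_injective_of_basis b (congrArg (L.envAlg.germ y hy) h)

/-- Surjectivity on stalks gives preimages locally. They agree on overlaps because ι is injective,
so they glue. -/
lemma exists_ι_eq [CharZero K] (hL : L.IsLocallyFree) {U : Opens X} {a : L.envAlg.Sec U}
    (ha : ∀ (y : X) (hy : y ∈ U),
      L.envAlg.germ y hy a ∈ primFil (OStalk O y) (L.envAlg.Stalk y) 1) :
    ∃ D, L.ι D = a := by
  have hloc : ∀ y : U, ∃ (W : Opens X) (_ : y.1 ∈ W) (hW : W ≤ U) (D : L.Sec W),
      L.ι D = L.envAlg.res hW a := by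
    intro y
    obtain ⟨V, hV, I, _, F, hb⟩ := exists_local_basis hL y.1
    obtain ⟨b, -⟩ := hb y.1 hV
    obtain ⟨s, hs⟩ := exists_stalkι_eq_of_basis b (ha y.1 y.2)
    obtain ⟨V', hV', D, rfl⟩ := exists_germ s
    rw [stalkι_germ] at hs
    obtain ⟨W, hyW, h₁, h₂, e⟩ := LieAlgd.germ_eq _
      (show L.envAlg.germ y.1 hV' (L.ι D) = L.envAlg.germ y.1 y.2 a from hs)
    exact ⟨W, hyW, h₂, L.res h₁ D, by rw [← res_ι]; exact e⟩
  choose W hyW hW D hD using hloc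
  have hcov : U ≤ iSup W := fun x hxU => Opens.mem_iSup.2 ⟨⟨x, hxU⟩, hyW ⟨x, hxU⟩⟩
  obtain ⟨E, hE, -⟩ := TopCat.Sheaf.existsUnique_gluing' ⟨L.presheaf, L.isSheaf⟩ W U
    (fun x => homOfLE (hW x)) hcov D (by
      intro y z
      change L.res inf_le_left (D y) = L.res inf_le_right (D z)
      refine ι_injective hL ?_
      rw [← res_ι, ← res_ι, hD, hD, LieAlgd.res_res, LieAlgd.res_res])
  have hE' : ∀ y, L.res (hW y) E = D y := hE
  refine ⟨E, LieAlgd.sec_ext L.envAlg.isSheaf fun y hy => ?_⟩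
  rw [← LieAlgd.germ_res _ (hW ⟨y, hy⟩) y (hyW ⟨y, hy⟩), res_ι, hE', hD, LieAlgd.germ_res]

/-- The unit of the adjunction is an isomorphism for locally free Lie algebroids. -/
theorem isIso_toPrim [CharZero K] (hL : L.IsLocallyFree) : IsIso L.toPrim := by
  refine isIso_of_bijective _ fun U => ⟨fun D E h => ?_, fun a => ?_⟩
  · exact ι_injective hL (congrArg L.envBialgebroid.primVal h)
  · obtain ⟨D, hD⟩ := exists_ι_eq hL (a := L.envBialgebroid.primVal a)
      (fun y hy => Bialgebroid.primVal_mem a y hy)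
    exact ⟨D, Subtype.ext hD⟩

/-- A single family of sections over U yields PBW bases at all points of U; this uniformity is
needed for local freeness of the subquotient sheaves. -/
lemma exists_local_mon_basis (hL : L.IsLocallyFree) (x : X) :
    ∃ (U : Opens X) (_ : x ∈ U) (I : Type u) (_ : LinearOrder I) (a : I → L.envAlg.Sec U),
      ∀ (y : X) (hy : y ∈ U),
        (∀ i, L.envAlg.germ y hy (a i) ∈ primFil (OStalk O y) (L.envAlg.Stalk y) 1) ∧
        LinearIndependent (OStalk O y) (PBW.mon fun i => L.envAlg.germ y hy (a i)) ∧
        Submodule.span (OStalk O y)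
          (Set.range (PBW.mon fun i => L.envAlg.germ y hy (a i))) = ⊤ := by
  obtain ⟨U, hx, I, _, D, hb⟩ := exists_local_basis hL x
  refine ⟨U, hx, I, inferInstance, fun i => L.ι (D i), fun y hy => ?_⟩
  obtain ⟨b, hbD⟩ := hb y hy
  have e : (fun i => L.envAlg.germ y hy (L.ι (D i))) = fun i => L.stalkι y (b i) :=
    funext fun i => by rw [hbD i]; rfl
  refine ⟨fun i => ι_mem_prim (D i) y hy, ?_, ?_⟩
  · rw [e]; exact linearIndependent_mon_stalkι b
  · rw [e]; exact span_mon_stalkι b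

/-- The universal enveloping algebroid of a locally free Lie algebroid is cocomplete. -/
theorem isCocomplete_envBialgebroid [CharZero K] (hL : L.IsLocallyFree) :
    L.envBialgebroid.IsCocomplete := by
  intro U a x hx
  obtain ⟨V, hV, I, _, s, hs⟩ := exists_local_mon_basis hL x
  obtain ⟨h₁, h₂, h₃⟩ := hs x hV
  exact exists_mem_span_one_sup_primFil (K := K) h₁ h₂ h₃ (L.envAlg.germ x hx a)

/-- The universal enveloping algebroid of a locally free Lie algebroid is locally graded free. -/
theorem isLocallyGradedFree_envBialgebroid [CharZero K] (hL : L.IsLocallyFree) :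
    L.envBialgebroid.IsLocallyGradedFree := by
  intro n x
  obtain ⟨U, hx, I, _, a, ha⟩ := exists_local_mon_basis hL x
  have hmem : ∀ (m : {m : I →₀ ℕ // m.degree = n + 1}) (y : X) (hy : y ∈ U),
      PBW.mon (fun i => L.envAlg.germ y hy (a i)) m.1 ∈
        primFil (OStalk O y) (L.envAlg.Stalk y) (n + 1) := fun m y hy =>
    mon_mem_primFil_succ (K := K) (ha y hy).1 (ha y hy).2.1 (ha y hy).2.2 m
  refine ⟨U, hx, {m : I →₀ ℕ // m.degree = n + 1}, fun m y => Submodule.Quotient.mk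
    ⟨PBW.mon (fun i => L.envAlg.germ y.1 y.2 (a i)) m.1, hmem m y.1 y.2⟩, fun m y => ?_,
    fun y => ⟨?_, ?_⟩⟩
  -- Taking germs is multiplicative, so the monomials in germs are germs of a monomial section and
  -- define sections of the subquotient sheaf.
  · have e : ∀ (z : X) (hz : z ∈ U), L.envAlg.germ z hz (PBW.mon a m.1) =
        PBW.mon (fun i => L.envAlg.germ z hz (a i)) m.1 := fun z hz =>
      PBW.map_mon (L.envAlg.germ z hz : L.envAlg.Sec U →* L.envAlg.Stalk z) a m.1
    refine ⟨U, y.2, le_rfl, PBW.mon a m.1, fun z hz => ?_, fun z hz => ?_⟩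
    · exact (e z hz).symm ▸ hmem m z hz
    · exact congrArg Submodule.Quotient.mk (Subtype.ext (e z hz).symm)
  · exact linearIndependent_primGr (K := K) (ha y.1 y.2).1 (ha y.1 y.2).2.1 (ha y.1 y.2).2.2 n
  · exact span_primGr (K := K) (ha y.1 y.2).1 (ha y.1 y.2).2.1 (ha y.1 y.2).2.2 n

end LieAlgebroid

end LocallyFreeAlgebroids

/-! ### Cocomplete locally graded free bialgebras -/

/-- The embedding of the first subquotient of the primitive filtration. -/
def primGrZero (R A : Type u) [CommRing R] [Ring A] [Module R A] [IsScalarTower R A A]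
    [Coalgebra R A] [IsRBialgebra R A] : primGr R A 0 →ₗ[R] A :=
  Submodule.liftQ _ (primFil R A 1).subtype fun s hs => by
    have hs' : (s : A) ∈ primFil R A 0 := hs
    rw [primFil_zero] at hs'
    exact hs'

section PrimGrZero

variable {R A : Type u} [CommRing R] [Ring A] [Module R A] [IsScalarTower R A A]
  [Coalgebra R A] [IsRBialgebra R A]

lemma primGrZero_mk (s : primFil R A 1) : primGrZero R A (Submodule.Quotient.mk s) = s := rfl

lemma primGrZero_mem (q : primGr R A 0) : primGrZero R A q ∈ primFil R A 1 := by
  obtain ⟨s, rfl⟩ := Submodule.Quotient.mk_surjective _ q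
  exact s.2

lemma ker_primGrZero : LinearMap.ker (primGrZero R A) = ⊥ := by
  rw [LinearMap.ker_eq_bot']
  intro q hq
  obtain ⟨s, rfl⟩ := Submodule.Quotient.mk_surjective _ q
  rw [primGrZero_mk] at hq
  have : s = 0 := Subtype.ext hq
  rw [this, Submodule.Quotient.mk_zero]

end PrimGrZero

section GradedFree

variable {K : Type u} [Field K] {X : TopCat.{u}} {O : X.Sheaf (CommAlgCat.{u} K)}

namespace Bialgebroid

variable {A B : Bialgebroid O}

variable (A) in
/-- The map from the stalk of the sheaf of primitive elements. -/
def primGerm (x : X) : A.primAlgebroid.Stalk x →ₗ[OStalk O x] A.alg.Stalk x where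
  toFun s := A.envToAlg.stalk x (A.primAlgebroid.stalkι x s)
  map_add' s t := by rw [map_add, map_add]
  map_smul' r s := by rw [LieAlgebroid.stalkι_smul, map_smul, RingHom.id_apply]

lemma primGerm_germ {x : X} {U : Opens X} (hx : x ∈ U) (D : A.primAlgebroid.Sec U) :
    A.primGerm x (A.primAlgebroid.germ x hx D) = A.alg.germ x hx (A.primVal D) :=
  A.envToAlg_stalk_ιx hx D

lemma primGerm_injective (x : X) : Function.Injective (A.primGerm x) := by
  rw [injective_iff_map_eq_zero]
  intro s hs
  obtain ⟨U, hx, D, rfl⟩ := LieAlgebroid.exists_germ s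
  rw [primGerm_germ, ← map_zero (A.alg.germ x hx)] at hs
  obtain ⟨W, hW, h₁, h₂, e⟩ := germ_eq _ hs
  have h0 : A.primAlgebroid.res h₁ D = 0 := Subtype.ext (e.trans (map_zero _))
  rw [← LieAlgebroid.germ_res h₁ x hW, h0, map_zero]

lemma primGerm_mem (x : X) (s : A.primAlgebroid.Stalk x) : A.primGerm x s ∈ A.fil 1 x := by
  obtain ⟨U, hx, D, rfl⟩ := LieAlgebroid.exists_germ s
  rw [primGerm_germ]
  exact primVal_mem D x hx

/-- As Ā₀ = 0, the first subquotient is the sheaf of primitive elements itself. Its local basis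
consists of families that are locally sections of A, and these glue to primitive sections. -/
lemma exists_local_prim (hA : A.IsLocallyGradedFree) (x : X) :
    ∃ (U : Opens X) (_ : x ∈ U) (I : Type u) (_ : LinearOrder I) (D : I → A.primAlgebroid.Sec U),
      ∀ (y : X) (hy : y ∈ U),
        LinearIndependent (OStalk O y) (fun i => A.alg.germ y hy (A.primVal (D i))) ∧
        A.fil 1 y ≤ Submodule.span (OStalk O y)
          (Set.range fun i => A.alg.germ y hy (A.primVal (D i))) := by
  obtain ⟨U, hx, I, e, he, hb⟩ := hA 0 x
  have hq : ∀ i, IsLocallySection A.alg.presheaf (U := U)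
      fun y => primGrZero (OStalk O y.1) (A.alg.Stalk y.1) (e i y) := fun i z => by
    obtain ⟨V, hz, hV, a, ha, h⟩ := he i z
    refine ⟨V, hz, hV, a, fun y hy => ?_⟩
    change primGrZero (OStalk O y) (A.alg.Stalk y) (e i ⟨y, hV hy⟩) = _
    rw [h y hy, primGrZero_mk]
  choose a ha using fun i => exists_sec A.alg.isSheaf (hq i)
  have ha' : ∀ i, a i ∈ A.prim U := fun i y hy => by
    rw [ha i y hy]
    exact primGrZero_mem _
  refine ⟨U, hx, I, IsWellOrder.linearOrder WellOrderingRel, fun i => (⟨a i, ha' i⟩ : A.prim U),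
    fun y hy => ?_⟩
  have h : (fun i => A.alg.germ y hy (a i)) =
      primGrZero (OStalk O y) (A.alg.Stalk y) ∘ fun i => e i ⟨y, hy⟩ := funext fun i => ha i y hy
  change LinearIndependent (OStalk O y) (fun i => A.alg.germ y hy (a i)) ∧
    A.fil 1 y ≤ Submodule.span (OStalk O y) (Set.range fun i => A.alg.germ y hy (a i))
  rw [h]
  refine ⟨(hb ⟨y, hy⟩).1.map' _ ker_primGrZero, fun p hp => ?_⟩
  rw [Set.range_comp, ← Submodule.map_span, (hb ⟨y, hy⟩).2]
  exact ⟨Submodule.Quotient.mk ⟨p, hp⟩, trivial, rfl⟩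

/-- A basis of the stalk of the Lie algebroid of primitive elements. -/
lemma exists_local_prim_basis (hA : A.IsLocallyGradedFree) (x : X) :
    ∃ (U : Opens X) (_ : x ∈ U) (I : Type u) (_ : LinearOrder I) (D : I → A.primAlgebroid.Sec U),
      ∀ (y : X) (hy : y ∈ U),
        LinearIndependent (OStalk O y) (fun i => A.primAlgebroid.germ y hy (D i)) ∧
        Submodule.span (OStalk O y) (Set.range fun i => A.primAlgebroid.germ y hy (D i)) = ⊤ ∧
        A.fil 1 y ≤ Submodule.span (OStalk O y)
          (Set.range fun i => A.primGerm y (A.primAlgebroid.germ y hy (D i))) := by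
  obtain ⟨U, hx, I, hI, D, hD⟩ := exists_local_prim hA x
  refine ⟨U, hx, I, hI, D, fun y hy => ?_⟩
  obtain ⟨h₁, h₂⟩ := hD y hy
  have e : (fun i => A.alg.germ y hy (A.primVal (D i))) =
      A.primGerm y ∘ fun i => A.primAlgebroid.germ y hy (D i) :=
    funext fun i => (primGerm_germ hy (D i)).symm
  rw [e] at h₁ h₂
  refine ⟨h₁.of_comp _, ?_, h₂⟩
  rw [eq_top_iff]
  rintro s -
  have h := h₂ (primGerm_mem y s)
  rw [Set.range_comp, ← Submodule.map_span] at h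
  obtain ⟨t, ht, hts⟩ := h
  rwa [← primGerm_injective y hts]

/-- The Lie algebroid of primitive elements of a locally graded free bialgebra is locally free. -/
theorem isLocallyFree_primAlgebroid (hA : A.IsLocallyGradedFree) :
    A.primAlgebroid.IsLocallyFree := fun x => by
  obtain ⟨U, hx, I, _, D, hD⟩ := exists_local_prim_basis hA x
  exact ⟨U, hx, I, fun i y => A.primAlgebroid.germ y.1 y.2 (D i), fun i => ⟨D i, fun _ => rfl⟩,
    fun y => ⟨(hD y.1 y.2).1, (hD y.1 y.2).2.1⟩⟩

lemma exists_mem_of_isCocomplete (hA : A.IsCocomplete) {x : X} (a : A.alg.Stalk x) :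
    ∃ n, a ∈ Submodule.span (OStalk O x) {(1 : A.alg.Stalk x)} ⊔ A.fil n x := by
  obtain ⟨U, hx, a, rfl⟩ := exists_germ _ a
  exact hA U a x hx

/-- Flatness is a consequence of the two hypotheses: the stalk is an increasing union of free
modules built from the free subquotients. -/
lemma flat_stalk (hc : A.IsCocomplete) (hA : A.IsLocallyGradedFree) (x : X) :
    Module.Flat (OStalk O x) (A.alg.Stalk x) := by
  refine flat_of_free_primGr (fun n => ?_) (exists_mem_of_isCocomplete hc)
  obtain ⟨U, hx, I, e, -, hb⟩ := hA n x
  exact Module.Free.of_basis (Module.Basis.mk (hb ⟨x, hx⟩).1 (hb ⟨x, hx⟩).2.ge)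

/-- The counit of the adjunction is bijective on the stalks of a cocomplete locally graded free
bialgebra. -/
theorem bijective_envToAlg_stalk [CharZero K] (hc : A.IsCocomplete) (hA : A.IsLocallyGradedFree)
    (x : X) : Function.Bijective (A.envToAlg.stalk x) := by
  obtain ⟨U, hx, I, _, D, hD⟩ := exists_local_prim_basis hA x
  obtain ⟨h₁, h₂, h₃⟩ := hD x hx
  let b := Module.Basis.mk h₁ h₂.ge
  have hb : ∀ i, b i = A.primAlgebroid.germ x hx (D i) := fun i => Module.Basis.mk_apply _ _ i
  have := flat_stalk hc hA x
  set e : I → A.alg.Stalk x := fun i => A.primGerm x (A.primAlgebroid.germ x hx (D i)) with he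
  have e_mem : ∀ i, e i ∈ primFil (OStalk O x) (A.alg.Stalk x) 1 := fun i => primGerm_mem x _
  have e_indep : LinearIndependent (OStalk O x) e :=
    h₁.map' (A.primGerm x) (LinearMap.ker_eq_bot.2 (primGerm_injective x))
  let c := Module.Basis.mk (LieAlgebroid.linearIndependent_mon_stalkι b)
    (LieAlgebroid.span_mon_stalkι b).ge
  -- The morphism is multiplicative, so it sends the PBW basis c to the ordered monomials in the
  -- basis e of the primitive elements of A.
  have hmon : A.envToAlg.stalk x ∘ c = PBW.mon e := funext fun m => by
    have h := PBW.map_mon (onStalk A.envToAlg.hom x :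
      A.primAlgebroid.envAlg.Stalk x →* A.alg.Stalk x)
      (fun i => A.primAlgebroid.stalkι x (b i)) m
    rw [Function.comp_apply, Module.Basis.mk_apply]
    refine h.trans (congrArg (fun e => PBW.mon e m) (funext fun i => ?_))
    rw [hb i]
    rfl
  -- Injectivity is independence of the monomials in A, which rests on flatness. For surjectivity,
  -- cocompleteness places an element in the span of 1 plus some term of the filtration, and that
  -- term is spanned by monomials.
  refine ⟨injective_of_linearIndependent_comp c _ ?_, ?_⟩
  · rw [hmon]
    exact linearIndependent_mon (K := K) e_mem e_indep
  · rw [← LinearMap.range_eq_top, eq_top_iff]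
    rintro a -
    obtain ⟨n, hn⟩ := exists_mem_of_isCocomplete hc a
    refine (sup_le ?_ ?_ : _ ≤ LinearMap.range (A.envToAlg.stalk x)) hn
    · rw [Submodule.span_singleton_le_iff_mem]
      exact ⟨1, ExtAlg.Hom.stalk_one _ x⟩
    · change primFil (OStalk O x) (A.alg.Stalk x) n ≤ _
      rw [primFil_eq_span (K := K) e_mem e_indep h₃ n, Submodule.span_le]
      rintro _ ⟨m, -, rfl⟩
      exact ⟨c m, congrFun hmon m⟩

/-- A morphism of bialgebras which is bijective on stalks is an isomorphism. -/
theorem isIso_of_bijective_stalk (φ : A ⟶ B) (h : ∀ x, Function.Bijective (φ.map.stalk x)) :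
    IsIso φ := by
  let μ : ∀ x, B.alg.Stalk x →ₐ[K] A.alg.Stalk x := fun x =>
    (AlgEquiv.ofBijective (onStalk φ.map.hom x) (h x)).symm
  have hμ : ∀ x b, onStalk φ.map.hom x (μ x b) = b := fun x =>
    (AlgEquiv.ofBijective (onStalk φ.map.hom x) (h x)).apply_symm_apply
  have hμ' : ∀ x a, μ x (onStalk φ.map.hom x a) = a := fun x =>
    (AlgEquiv.ofBijective (onStalk φ.map.hom x) (h x)).symm_apply_apply
  -- The stalkwise inverses carry sections to sections: a section representing the preimage of one
  -- germ maps to the given section on a neighbourhood, and there injectivity identifies all its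
  -- germs with the preimages.
  have hsec : ∀ (U : Opens X) (s : B.alg.Sec U),
      IsLocallySection A.alg.presheaf (U := U) fun y => μ y.1 (B.alg.germ y.1 y.2 s) := by
    intro U s x
    obtain ⟨V, hx, a, ha⟩ := exists_germ _ (μ x.1 (B.alg.germ x.1 x.2 s))
    have h1 : B.alg.germ x.1 hx (onSec φ.map.hom V a) = B.alg.germ x.1 x.2 s := by
      rw [← onStalk_germ, ha, hμ]
    obtain ⟨W, hxW, hWV, hWU, e⟩ := germ_eq _ h1
    refine ⟨W, hxW, hWU, A.alg.res hWV a, fun y hy => ?_⟩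
    change μ y (B.alg.germ y (hWU hy) s) = _
    rw [← germ_res _ hWU y hy, ← e, germ_res, ← onStalk_germ, hμ', germ_res]
  let g : B.alg.presheaf ⟶ A.alg.presheaf := homOfStalks A.alg.isSheaf μ hsec
  have hg : ∀ x b, onStalk g x b = μ x b := fun x b => onStalk_homOfStalks _ _ _ x b
  have h1 : φ.map.hom ≫ g = 𝟙 _ := hom_ext_stalk A.alg.isSheaf fun y a => by
    obtain ⟨U, hy, a, rfl⟩ := exists_germ _ a
    exact (hg y (onStalk φ.map.hom y (A.alg.germ y hy a))).trans (hμ' y _)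
  have h2 : g ≫ φ.map.hom = 𝟙 _ := hom_ext_stalk B.alg.isSheaf fun y b => by
    obtain ⟨U, hy, b, rfl⟩ := exists_germ _ b
    exact (congrArg (onStalk φ.map.hom y) (hg y (B.alg.germ y hy b))).trans (hμ y _)
  let gm : ExtAlg.Hom B.alg A.alg :=
    ⟨g, by rw [← φ.map.unit_hom, Category.assoc, h1, Category.comp_id]⟩
  have hgm : ∀ x b, φ.map.stalk x (gm.stalk x b) = b := fun x b =>
    (congrArg (onStalk φ.map.hom x) (hg x b)).trans (hμ x b)
  have hgm' : ∀ x, gm.stalk x ∘ₗ φ.map.stalk x = LinearMap.id := fun x =>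
    LinearMap.ext fun a => (hg x _).trans (hμ' x a)
  -- Compatibility of the inverse with Δ and ε follows by composing the equations for φ with the
  -- inverse.
  let ψ : B ⟶ A :=
    { map := gm
      counit_comp := fun x => LinearMap.ext fun b => by
        have := LinearMap.congr_fun (φ.counit_comp x) (gm.stalk x b)
        rw [LinearMap.comp_apply, hgm] at this
        exact this.symm
      comul_comp := fun x => LinearMap.ext fun b => by
        have := LinearMap.congr_fun (φ.comul_comp x) (gm.stalk x b)
        rw [LinearMap.comp_apply, hgm] at this
        rw [LinearMap.comp_apply, LinearMap.comp_apply, this, LinearMap.comp_apply,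
          ← LinearMap.comp_apply (TensorProduct.map _ _), ← TensorProduct.map_comp, hgm',
          TensorProduct.map_id, LinearMap.id_apply] }
  exact ⟨ψ, Hom.ext' h1, Hom.ext' h2⟩

/-- The counit of the adjunction is an isomorphism for cocomplete locally graded free
bialgebras. -/
theorem isIso_ofEnv [CharZero K] (hc : A.IsCocomplete) (hA : A.IsLocallyGradedFree) :
    IsIso A.ofEnv :=
  isIso_of_bijective_stalk _ (bijective_envToAlg_stalk hc hA)

end Bialgebroid

end GradedFree

/-! ### The equivalence of categories -/

section Equivalence

variable {K : Type u} [Field K] [CharZero K] {X : TopCat.{u}} {O : X.Sheaf (CommAlgCat.{u} K)}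

lemma cocompleteGradedFree_envFunctor {L : LieAlgebroid O} (hL : locallyFree O L) :
    cocompleteGradedFree O ((envFunctor O).obj L) :=
  ⟨L.isCocomplete_envBialgebroid hL, L.isLocallyGradedFree_envBialgebroid hL⟩

lemma locallyFree_primFunctor {A : Bialgebroid O} (hA : cocompleteGradedFree O A) :
    locallyFree O ((primFunctor O).obj A) :=
  A.isLocallyFree_primAlgebroid hA.2

lemma isIso_unit_app {L : LieAlgebroid O} (hL : locallyFree O L) :
    IsIso ((envPrimAdjunction O).unit.app L) := L.isIso_toPrim hL

lemma isIso_counit_app {A : Bialgebroid O} (hA : cocompleteGradedFree O A) :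
    IsIso ((envPrimAdjunction O).counit.app A) := A.isIso_ofEnv hA.1 hA.2

variable (O) in
/-- The universal enveloping algebroid functor on locally free Lie algebroids. -/
abbrev envRestricted : (locallyFree O).FullSubcategory ⥤ (cocompleteGradedFree O).FullSubcategory :=
  (cocompleteGradedFree O).lift ((locallyFree O).ι ⋙ envFunctor O)
    fun L => cocompleteGradedFree_envFunctor L.property

variable (O) in
/-- The functor of primitive elements on cocomplete locally graded free bialgebras. -/
abbrev primRestricted :
    (cocompleteGradedFree O).FullSubcategory ⥤ (locallyFree O).FullSubcategory :=
  (locallyFree O).lift ((cocompleteGradedFree O).ι ⋙ primFunctor O)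
    fun A => locallyFree_primFunctor A.property

variable (O) in
/-- The restriction of the adjunction to the full subcategories. -/
def restrictedAdjunction : envRestricted O ⊣ primRestricted O :=
  (envPrimAdjunction O).restrictFullyFaithful (locallyFree O).fullyFaithfulι
    (cocompleteGradedFree O).fullyFaithfulι (Iso.refl _) (Iso.refl _)

instance isIso_restrictedAdjunction_unit_app (L : (locallyFree O).FullSubcategory) :
    IsIso ((restrictedAdjunction O).unit.app L) := by
  have : IsIso ((locallyFree O).ι.map ((restrictedAdjunction O).unit.app L)) := by
    -- In the ambient category the restricted unit is the original unit composed with images of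
    -- identities, and the fully faithful inclusion reflects isomorphisms.
    rw [restrictedAdjunction, Adjunction.map_restrictFullyFaithful_unit_app]
    exact IsIso.comp_isIso' (isIso_unit_app L.property) (IsIso.comp_isIso'
      (inferInstanceAs (IsIso ((primFunctor O).map (𝟙 _)))) (inferInstanceAs (IsIso (𝟙 _))))
  exact isIso_of_fully_faithful (locallyFree O).ι _

instance isIso_restrictedAdjunction_counit_app (A : (cocompleteGradedFree O).FullSubcategory) :
    IsIso ((restrictedAdjunction O).counit.app A) := by
  have : IsIso ((cocompleteGradedFree O).ι.map ((restrictedAdjunction O).counit.app A)) := by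
    rw [restrictedAdjunction, Adjunction.map_restrictFullyFaithful_counit_app]
    exact IsIso.comp_isIso' (inferInstanceAs (IsIso (𝟙 _))) (IsIso.comp_isIso'
      (inferInstanceAs (IsIso ((envFunctor O).map (𝟙 _)))) (isIso_counit_app A.property))
  exact isIso_of_fully_faithful (cocompleteGradedFree O).ι _

end Equivalence

end LieAlgd

end

theorem mainTheorem2 (K : Type u) [Field K] [CharZero K] (X : TopCat.{u})
    (O : X.Sheaf (CommAlgCat.{u} K)) :
    ∃ adj : LieAlgd.envFunctor O ⊣ LieAlgd.primFunctor O,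
      (∀ (L : LieAlgd.LieAlgebroid O) (U : Opens X) (D : L.Sec U),
        Subtype.val (p := fun a => a ∈ L.envBialgebroid.prim U) ((adj.unit.app L).app U D) =
          L.ι D) ∧
      ∃ (hU : ∀ L, LieAlgd.locallyFree O L →
          LieAlgd.cocompleteGradedFree O ((LieAlgd.envFunctor O).obj L))
        (hP : ∀ A, LieAlgd.cocompleteGradedFree O A →
          LieAlgd.locallyFree O ((LieAlgd.primFunctor O).obj A)),
        (∀ L, LieAlgd.locallyFree O L → IsIso (adj.unit.app L)) ∧
        (∀ A, LieAlgd.cocompleteGradedFree O A → IsIso (adj.counit.app A)) ∧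
        ∃ e : (LieAlgd.locallyFree O).FullSubcategory ≌
            (LieAlgd.cocompleteGradedFree O).FullSubcategory,
          e.functor = (LieAlgd.cocompleteGradedFree O).lift
            ((LieAlgd.locallyFree O).ι ⋙ LieAlgd.envFunctor O) (fun L => hU L.obj L.property) ∧
          e.inverse = (LieAlgd.locallyFree O).lift
            ((LieAlgd.cocompleteGradedFree O).ι ⋙ LieAlgd.primFunctor O)
              (fun A => hP A.obj A.property) :=
  -- The equivalence is that of the restricted adjunction, whose unit and counit are invertible; its
  -- functors are by construction the restrictions of 𝒰 and 𝒫.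
  ⟨LieAlgd.envPrimAdjunction O, fun _ _ _ => rfl,
    fun _ => LieAlgd.cocompleteGradedFree_envFunctor, fun _ => LieAlgd.locallyFree_primFunctor,
    fun _ => LieAlgd.isIso_unit_app, fun _ => LieAlgd.isIso_counit_app,
    (LieAlgd.restrictedAdjunction O).toEquivalence, rfl, rfl⟩
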